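/- Let $k\ge 4$ be an integer, $N$ a square-free positive integer, $\rho=(N_0,N_1,N_2)$ a triple of positive integers with $N_0N_1N_2=N$, and $\chi$ a Dirichlet character modulo $N$. For $m\mid N$ write $\chi_m$ for the component of $\chi$ modulo $m$, so that $\chi=\chi_m\chi_{N/m}$; assume $\chi_{N_1}^2=1$. Let $\Gamma_0(N)$ be the group of $\gamma=\begin{pmatrix}A_\gamma&B_\gamma\\C_\gamma&D_\gamma\end{pmatrix}\in Sp_2(\mathbb Z)$ ($4\times4$ matrices in $2\times2$ blocks) with $C_\gamma\equiv0\pmod N$. For a triple $\sigma=(S_0,S_1,S_2)$ with $S_0S_1S_2=N$ let $M_\sigma$ be an integral diagonal matrix with $M_\sigma\equiv 0\ (S_0)$, $M_\sigma\equiv\mathrm{diag}(1,0)\ (S_1)$, $M_\sigma\equiv I\ (S_2)$, let $\gamma_\sigma=\begin{pmatrix}I&0\\M_\sigma&I\end{pmatrix}$, and for $\tau$ in the Siegel upper half space of degree $2$ put $$\mathbb E_\sigma(\tau)=\tfrac12\sum_{\gamma}\overline\chi(\det D_\gamma)\,\det\big(C_{\gamma_\sigma\gamma}\,\tau+D_{\gamma_\sigma\gamma}\big)^{-k},$$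 where $\gamma$ runs over elements of $\Gamma_0(N)$ such that $\Gamma_\infty^+\gamma_\sigma\gamma$ runs once over the $\Gamma_0(N)$-orbit of $\Gamma_\infty^+\gamma_\sigma$, with $\Gamma_\infty^+=\{\gamma\in Sp_2(\mathbb Z):C_\gamma=0,\ \det D_\gamma=1\}$. (This does not depend on the choices whenever $\chi_{S_1}^2=1$.) For a prime $p$ put $X=\mathrm{diag}(p,1)$, $\delta_1=\mathrm{diag}(X,X^{-1})$ and $$f|T_1(p^2)=p^{k-3}\sum_\gamma\overline\chi(\det D_\gamma)\,f|\delta_1^{-1}\gamma,\qquad (f|\gamma)(\tau)=(\det\gamma)^{k/2}\det(C_\gamma\tau+D_\gamma)^{-k}f\big((A_\gamma\tau+B_\gamma)(C_\gamma\tau+D_\gamma)^{-1}\big),$$ where in the sum $\gamma$ runs over representatives of $\big(\delta_1\Gamma_0(N)\delta_1^{-1}\cap\Gamma_0(N)\big)\backslash\Gamma_0(N)$. Let $q$ be a prime dividing $N_0$, and set $\rho'=(N_0/q,\,qN_1,\,N_2)$, $\rho''=(N_0/q,\,N_1,\,qN_2)$. Then, on the Siegel upper half space of degree $2$, $$\mathbb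 E_\rho|T_1(q^2)=\begin{cases} \chi_{N_2}(q^2)(q+1)\mathbb E_\rho+q^{-1}\big(\chi_{N/q}(q)q^{k-1}+\chi_{N_2}(q^2)\big)(q-1)\mathbb E_{\rho'}+\chi_{N_2}(q^2)q^{-2}(q^2-1)\mathbb E_{\rho''}&\text{if }\chi_q=1,\\[2pt] \chi_{N_2}(q^2)(q+1)\mathbb E_\rho+\left(\tfrac{-1}{q}\right)\chi_{N_2}(q^2)q^{-2}(q^2-1)\mathbb E_{\rho''}&\text{if }\chi_q^2=1,\ \chi_q\ne1,\\[2pt] \chi_{N_2}(q^2)(q+1)\mathbb E_\rho&\text{if }\chi_q^2\ne1. \end{cases}$$ -/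

import Mathlib

open Matrix

noncomputable section

namespace SiegelTwo

/-- The group `Sp₂(ℤ)` of `4 × 4` integral symplectic matrices, written in `2 × 2` blocks. -/
abbrev Sp2Z : Type := Matrix.symplecticGroup (Fin 2) ℤ

/-- The block `A` of `γ = (A B; C D)`. -/
abbrev blockA (γ : Sp2Z) : Matrix (Fin 2) (Fin 2) ℤ := γ.1.toBlocks₁₁

/-- The block `B` of `γ = (A B; C D)`. -/
abbrev blockB (γ : Sp2Z) : Matrix (Fin 2) (Fin 2) ℤ := γ.1.toBlocks₁₂

/-- The block `C` of `γ = (A B; C D)`. -/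
abbrev blockC (γ : Sp2Z) : Matrix (Fin 2) (Fin 2) ℤ := γ.1.toBlocks₂₁

/-- The block `D` of `γ = (A B; C D)`. -/
abbrev blockD (γ : Sp2Z) : Matrix (Fin 2) (Fin 2) ℤ := γ.1.toBlocks₂₂

lemma blockC_mul (γ δ : Sp2Z) :
    blockC (γ * δ) = blockC γ * blockA δ + blockD γ * blockC δ := by
  ext i j
  simp [blockA, blockC, blockD, Matrix.toBlocks₂₁, Matrix.toBlocks₁₁, Matrix.toBlocks₂₂,
    Matrix.mul_apply]

lemma blockD_mul (γ δ : Sp2Z) :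
    blockD (γ * δ) = blockC γ * blockB δ + blockD γ * blockD δ := by
  ext i j
  simp [blockB, blockC, blockD, Matrix.toBlocks₂₁, Matrix.toBlocks₁₂, Matrix.toBlocks₂₂,
    Matrix.mul_apply]

lemma inv_val (γ : Sp2Z) :
    (γ⁻¹).1 = fromBlocks (blockD γ)ᵀ (-(blockB γ)ᵀ) (-(blockC γ)ᵀ) (blockA γ)ᵀ := by
  rw [SymplecticGroup.coe_inv]
  conv_lhs => rw [← Matrix.fromBlocks_toBlocks γ.1]
  simp [Matrix.J, Matrix.fromBlocks_transpose, Matrix.fromBlocks_multiply, Matrix.fromBlocks_neg]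

lemma blockC_inv (γ : Sp2Z) : blockC γ⁻¹ = -(blockC γ)ᵀ := by
  unfold blockC; rw [inv_val]; simp

lemma blockD_inv (γ : Sp2Z) : blockD γ⁻¹ = (blockA γ)ᵀ := by
  unfold blockD; rw [inv_val]; simp

/-- `Γ₀(N)`: the symplectic matrices `(A B; C D)` with `C ≡ 0 (mod N)`. -/
def Gamma0 (N : ℕ) : Subgroup Sp2Z where
  carrier := {γ | ∀ i j, (N : ℤ) ∣ blockC γ i j}
  one_mem' := by
    intro i j
    simp [blockC, Matrix.toBlocks₂₁]
  mul_mem' := by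
    intro γ δ hγ hδ i j
    rw [blockC_mul]
    simp only [Matrix.add_apply, Matrix.mul_apply]
    exact dvd_add (Finset.dvd_sum fun l _ => Dvd.dvd.mul_right (hγ i l) _)
      (Finset.dvd_sum fun l _ => Dvd.dvd.mul_left (hδ l j) _)
  inv_mem' := by
    intro γ hγ i j
    rw [blockC_inv]
    simpa using hγ j i

/-- The subgroup of index two of `Γ_∞ = {(A B; C D) ∈ Sp₂(ℤ) : C = 0}` given by `det D = 1`
(in `Γ_∞` one has `det A = det D = ±1`). Two elements of `Sp₂(ℤ)` with bottom rows `(M N)` and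
`(M' N')` lie in the same right coset of it iff `(M' N') = G (M N)` for some `G ∈ SL₂(ℤ)`. -/
def GammaInfPlus : Subgroup Sp2Z where
  carrier := {γ | blockC γ = 0 ∧ (blockD γ).det = 1}
  one_mem' := by
    refine ⟨?_, ?_⟩
    · ext i j
      simp [blockC, Matrix.toBlocks₂₁]
    · have : blockD 1 = 1 := by
        ext i j
        simp [blockD, Matrix.toBlocks₂₂, Matrix.one_apply]
      rw [this, Matrix.det_one]
  mul_mem' := by
    rintro γ δ ⟨h1, h2⟩ ⟨h3, h4⟩
    refine ⟨?_, ?_⟩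
    · rw [blockC_mul, h1, h3]; simp
    · rw [blockD_mul, h1]; simp [h2, h4]
  inv_mem' := by
    rintro γ ⟨h1, h2⟩
    refine ⟨?_, ?_⟩
    · rw [blockC_inv, h1]; simp
    · have h := blockD_mul γ γ⁻¹
      rw [mul_inv_cancel, h1, Matrix.zero_mul, zero_add] at h
      have h1' : blockD 1 = 1 := by
        ext i j
        simp [blockD, Matrix.toBlocks₂₂, Matrix.one_apply]
      have h' := congrArg Matrix.det h
      rw [Matrix.det_mul, h2, one_mul, h1', Matrix.det_one] at h'
      exact h'.symm

/-- The Siegel upper half space of degree 2. -/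
def upperHalfSpace : Set (Matrix (Fin 2) (Fin 2) ℂ) :=
  {τ | τ.IsSymm ∧ (τ.map Complex.im).PosDef}

/-- `γ₀⁻¹ Γ_∞⁺ γ₀ ∩ Γ₀(N)`, as a subgroup of `Γ₀(N)`: the elements `γ` and `γ'` of `Γ₀(N)` lie in
the same right coset of it iff `Γ_∞⁺ γ₀ γ = Γ_∞⁺ γ₀ γ'`. Its right cosets thus parametrise
the `Γ₀(N)`-orbit of `Γ_∞⁺ γ₀`. -/
def cuspStabilizer (N : ℕ) (γ₀ : Sp2Z) : Subgroup (Gamma0 N) :=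
  (GammaInfPlus.comap (MulAut.conj γ₀).toMonoidHom).subgroupOf (Gamma0 N)

/-- `∑ χ̄(det D_γ) det(Mτ + N)⁻ᵏ`, where `(M N)` is the bottom row of `γ₀ γ` and `γ` runs
over representatives in `Γ₀(N)` of the elements `Γ_∞⁺ γ₀ γ` of the `Γ₀(N)`-orbit of `Γ_∞⁺ γ₀`,
halved because every coset of `Γ_∞` consists of two cosets of `Γ_∞⁺`. -/
def eisensteinAt (k : ℕ) {N : ℕ} (χ : DirichletCharacter ℂ N) (γ₀ : Sp2Z)
    (τ : Matrix (Fin 2) (Fin 2) ℂ) : ℂ :=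
  (1 / 2 : ℂ) *
    ∑' c : Quotient (QuotientGroup.rightRel (cuspStabilizer N γ₀)),
      (starRingEnd ℂ) (χ (((blockD (c.out : Gamma0 N).1).det : ℤ) : ZMod N)) *
        (((blockC (γ₀ * (c.out : Gamma0 N).1)).map (Int.cast : ℤ → ℂ) * τ +
          (blockD (γ₀ * (c.out : Gamma0 N).1)).map (Int.cast : ℤ → ℂ)).det ^ k)⁻¹

/-- A diagonal matrix that is `0` modulo `N₀`, `diag(1, 0)` modulo `N₁` and the identity modulo
`N₂`, when `N₀`, `N₁`, `N₂` are pairwise coprime (see `cuspMatrix_spec`). -/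
def cuspMatrix (N₀ N₁ N₂ : ℕ) : Matrix (Fin 2) (Fin 2) ℤ :=
  Matrix.diagonal ![(N₀ : ℤ) ^ Nat.totient (N₁ * N₂), ((N₀ * N₁ : ℕ) : ℤ) ^ Nat.totient N₂]

lemma cuspMatrix_spec {N₀ N₁ N₂ : ℕ} (h : Squarefree (N₀ * N₁ * N₂)) :
    (cuspMatrix N₀ N₁ N₂).map (Int.cast : ℤ → ZMod N₀) = 0 ∧
    (cuspMatrix N₀ N₁ N₂).map (Int.cast : ℤ → ZMod N₁) = Matrix.diagonal ![1, 0] ∧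
    (cuspMatrix N₀ N₁ N₂).map (Int.cast : ℤ → ZMod N₂) = 1 := by
  have hne : N₀ * N₁ * N₂ ≠ 0 := h.ne_zero
  have h12 : N₁ * N₂ ≠ 0 := fun h0 => hne (by rw [mul_assoc, h0, mul_zero])
  have h2 : N₂ ≠ 0 := fun h0 => hne (by rw [h0, mul_zero])
  have c01_2 : (N₀ * N₁).Coprime N₂ := Nat.coprime_of_squarefree_mul h
  have c0_12 : N₀.Coprime (N₁ * N₂) := Nat.coprime_of_squarefree_mul (by rwa [← mul_assoc])
  have t12 : Nat.totient (N₁ * N₂) ≠ 0 := (Nat.totient_pos.2 (Nat.pos_of_ne_zero h12)).ne'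
  have t2 : Nat.totient N₂ ≠ 0 := (Nat.totient_pos.2 (Nat.pos_of_ne_zero h2)).ne'
  have e12 : N₀ ^ Nat.totient (N₁ * N₂) ≡ 1 [MOD N₁ * N₂] := Nat.ModEq.pow_totient c0_12
  have e2 : (N₀ * N₁) ^ Nat.totient N₂ ≡ 1 [MOD N₂] := Nat.ModEq.pow_totient c01_2
  have x1 : (N₀ : ZMod N₁) ^ Nat.totient (N₁ * N₂) = 1 := by
    have := (ZMod.natCast_eq_natCast_iff _ _ N₁).2 e12.of_mul_right
    simpa using this
  have x2 : (N₀ : ZMod N₂) ^ Nat.totient (N₁ * N₂) = 1 := by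
    have := (ZMod.natCast_eq_natCast_iff _ _ N₂).2 e12.of_mul_left
    simpa using this
  have y2 : ((N₀ : ZMod N₂) * N₁) ^ Nat.totient N₂ = 1 := by
    have := (ZMod.natCast_eq_natCast_iff _ _ N₂).2 e2
    simpa using this
  refine ⟨?_, ?_, ?_⟩ <;> ext i j <;> fin_cases i <;> fin_cases j <;>
    simp [cuspMatrix, t12, t2, x1, x2, y2]

/-- `γ_ρ = (I 0; M_ρ I)` for `ρ = (N₀, N₁, N₂)`. -/
def cuspElement (N₀ N₁ N₂ : ℕ) : Sp2Z :=
  ⟨fromBlocks 1 0 (cuspMatrix N₀ N₁ N₂) 1, by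
    rw [SymplecticGroup.fromBlocks_mem_iff]
    simp [cuspMatrix]⟩

/-- The Eisenstein series `E_ρ` of weight `k`, level `N` and character `χ`, for the partition
`ρ = (N₀, N₁, N₂)` of `N = N₀ N₁ N₂`. -/
def eisenstein (k : ℕ) {N : ℕ} (χ : DirichletCharacter ℂ N) (N₀ N₁ N₂ : ℕ) :
    Matrix (Fin 2) (Fin 2) ℂ → ℂ :=
  eisensteinAt k χ (cuspElement N₀ N₁ N₂)

/-- `(f | γ)(τ) = (det γ)^{k/2} det(Cτ + D)⁻ᵏ f((Aτ + B)(Cτ + D)⁻¹)` for `γ = (A B; C D)`. -/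
def slash (k : ℕ) (f : Matrix (Fin 2) (Fin 2) ℂ → ℂ)
    (γ : Matrix (Fin 2 ⊕ Fin 2) (Fin 2 ⊕ Fin 2) ℝ) (τ : Matrix (Fin 2) (Fin 2) ℂ) : ℂ :=
  let A := γ.toBlocks₁₁.map Complex.ofReal
  let B := γ.toBlocks₁₂.map Complex.ofReal
  let C := γ.toBlocks₂₁.map Complex.ofReal
  let D := γ.toBlocks₂₂.map Complex.ofReal
  ((γ.det ^ ((k : ℝ) / 2) : ℝ) : ℂ) * ((C * τ + D).det ^ k)⁻¹ * f ((A * τ + B) * (C * τ + D)⁻¹)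

/-- `δ₁ = diag(X, X⁻¹)` with `X = diag(p, 1)`. -/
def heckeDelta (p : ℕ) : Matrix (Fin 2 ⊕ Fin 2) (Fin 2 ⊕ Fin 2) ℝ :=
  fromBlocks (Matrix.diagonal ![(p : ℝ), 1]) 0 0 (Matrix.diagonal ![(p : ℝ), 1])⁻¹

/-- A symplectic integral matrix as a real matrix. -/
def toReal (γ : Sp2Z) : Matrix (Fin 2 ⊕ Fin 2) (Fin 2 ⊕ Fin 2) ℝ :=
  γ.1.map (Int.cast : ℤ → ℝ)

lemma toReal_one : toReal 1 = 1 := by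
  simp [toReal]

lemma toReal_mul (γ δ : Sp2Z) : toReal (γ * δ) = toReal γ * toReal δ := by
  simp only [toReal, Submonoid.coe_mul]
  exact Matrix.map_mul (f := Int.castRingHom ℝ)

/-- `δ₁ Γ₀(N) δ₁⁻¹ ∩ Γ₀(N)`, as a subgroup of `Γ₀(N)`. -/
def heckeSubgroup (N p : ℕ) : Subgroup (Gamma0 N) where
  carrier := {γ | ∃ g ∈ Gamma0 N, heckeDelta p * toReal g = toReal γ.1 * heckeDelta p}
  one_mem' := ⟨1, one_mem _, by simp [toReal_one]⟩
  mul_mem' := by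
    rintro γ γ' ⟨g, hg, h⟩ ⟨g', hg', h'⟩
    refine ⟨g * g', mul_mem hg hg', ?_⟩
    rw [toReal_mul, ← mul_assoc, h, mul_assoc, h', ← mul_assoc, Subgroup.coe_mul, toReal_mul]
  inv_mem' := by
    rintro γ ⟨g, hg, h⟩
    refine ⟨g⁻¹, inv_mem hg, ?_⟩
    have hγ : toReal (γ.1)⁻¹ * toReal γ.1 = 1 := by
      rw [← toReal_mul, inv_mul_cancel, toReal_one]
    have hg1 : toReal g * toReal g⁻¹ = 1 := by
      rw [← toReal_mul, mul_inv_cancel, toReal_one]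
    calc heckeDelta p * toReal g⁻¹
        = toReal (γ.1)⁻¹ * (toReal γ.1 * heckeDelta p) * toReal g⁻¹ := by
          rw [← mul_assoc (toReal (γ.1)⁻¹), hγ, one_mul]
      _ = toReal (γ⁻¹ : Gamma0 N).1 * heckeDelta p := by
          rw [← h, mul_assoc, mul_assoc, hg1, mul_one, Subgroup.coe_inv]

/-- The Hecke operator `T₁(p²)` in weight `k`, level `N` and character `χ`:
`f | T₁(p²) = p^{k-3} ∑ χ̄(det D_γ) f | δ₁⁻¹ γ`, where `γ` runs over representatives of
`(δ₁ Γ₀(N) δ₁⁻¹ ∩ Γ₀(N)) \ Γ₀(N)`. The number of cosets is finite. -/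
def heckeT1 (k : ℕ) {N : ℕ} (χ : DirichletCharacter ℂ N) (p : ℕ)
    (f : Matrix (Fin 2) (Fin 2) ℂ → ℂ) (τ : Matrix (Fin 2) (Fin 2) ℂ) : ℂ :=
  (p : ℂ) ^ ((k : ℤ) - 3) *
    ∑ᶠ c : Quotient (QuotientGroup.rightRel (heckeSubgroup N p)),
      (starRingEnd ℂ) (χ (((blockD (c.out : Gamma0 N).1).det : ℤ) : ZMod N)) *
        slash k f ((heckeDelta p)⁻¹ * toReal (c.out : Gamma0 N).1) τ

open Classical in
/-- The component `χ_m`, a character modulo `m`, of a character `χ` modulo `N` in the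
decomposition `χ = χ_m χ_{N/m}`, where `m ∣ N` is coprime to `N / m` (see `component_mul`):
`χ_m(a) = χ(b)` where `b ≡ a (mod m)` and `b ≡ 1 (mod N / m)`.
It is set to be trivial for all other `m`. -/
def component {N : ℕ} (χ : DirichletCharacter ℂ N) (m : ℕ) : DirichletCharacter ℂ m :=
  if h : m * (N / m) = N ∧ m.Coprime (N / m) then
    MulChar.ofUnitHom (χ.toUnitHom.comp
      ((Units.map ((ZMod.chineseRemainder h.2).symm.trans
          (ZMod.ringEquivCongr h.1)).toRingHom.toMonoidHom).comp
        (MulEquiv.prodUnits.symm.toMonoidHom.comp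
          (MonoidHom.inl (ZMod m)ˣ (ZMod (N / m))ˣ))))
  else 1

lemma component_apply_aux {N : ℕ} (χ : DirichletCharacter ℂ N) {m : ℕ}
    (h : m * (N / m) = N) (hc : m.Coprime (N / m)) {a b : ℤ} (ha : IsUnit (a : ZMod m))
    (hab : (b : ZMod m) = a) (hb : (b : ZMod (N / m)) = 1) :
    component χ m a = χ b := by
  obtain ⟨u, hu⟩ := ha
  rw [← hu, component, dif_pos ⟨h, hc⟩, MulChar.ofUnitHom_coe, MonoidHom.comp_apply,
    MulChar.coe_toUnitHom]
  congr 1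
  change ZMod.ringEquivCongr h ((ZMod.chineseRemainder hc).symm ((u : ZMod m), 1)) = b
  have : (ZMod.chineseRemainder hc).symm ((u : ZMod m), 1) = ((b : ℤ) : ZMod (m * (N / m))) := by
    rw [RingEquiv.symm_apply_eq, map_intCast]
    ext
    · simp [hu, hab]
    · simp [hb]
  rw [this, map_intCast]

/-- The decomposition `χ = χ_m χ_n` for `N = m n` with `m` and `n` coprime. -/
lemma component_mul {N m n : ℕ} (χ : DirichletCharacter ℂ N) (hN : m * n = N) (hN0 : N ≠ 0)
    (hc : m.Coprime n) (a : ℤ) :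
    χ a = component χ m a * component χ n a := by
  have hm0 : m ≠ 0 := fun h => hN0 (by rw [← hN, h, zero_mul])
  have hn0 : n ≠ 0 := fun h => hN0 (by rw [← hN, h, mul_zero])
  have dm : N / m = n := by rw [← hN, Nat.mul_div_cancel_left n (Nat.pos_of_ne_zero hm0)]
  have dn : N / n = m := by rw [← hN, Nat.mul_div_cancel m (Nat.pos_of_ne_zero hn0)]
  by_cases hu : IsUnit (a : ZMod m) ∧ IsUnit (a : ZMod n)
  · obtain ⟨u, v, huv⟩ : IsCoprime (m : ℤ) (n : ℤ) := Nat.isCoprime_iff_coprime.2 hc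
    have em : (v : ZMod m) * n = 1 := by
      have := congrArg (Int.cast : ℤ → ZMod m) huv
      simpa using this
    have en : (u : ZMod n) * m = 1 := by
      have := congrArg (Int.cast : ℤ → ZMod n) huv
      simpa using this
    have h1 : component χ m a = χ ((v * n * a + u * m : ℤ) : ZMod N) := by
      refine component_apply_aux χ (by rw [dm, hN]) (by rwa [dm]) hu.1 ?_ ?_
      · push_cast; rw [em]; simp
      · rw [dm]; push_cast; rw [en]; simp
    have h2 : component χ n a = χ ((u * m * a + v * n : ℤ) : ZMod N) := by
      refine component_apply_aux χ (by rw [dn, mul_comm, hN]) (by rw [dn]; exact hc.symm)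
        hu.2 ?_ ?_
      · push_cast; rw [en]; simp
      · rw [dn]; push_cast; rw [em]; simp
    rw [h1, h2, ← map_mul, ← Int.cast_mul]
    congr 1
    rw [ZMod.intCast_eq_intCast_iff_dvd_sub]
    refine ⟨u * v * (a - 1) ^ 2, ?_⟩
    have hN' : (N : ℤ) = m * n := by rw [← hN]; push_cast; ring
    rw [hN']
    linear_combination (a * (u * m + v * n) + a) * huv
  · have hN1 : ¬ IsUnit (a : ZMod N) := by
      intro h
      apply hu
      have hm : m ∣ N := ⟨n, hN.symm⟩
      have hn : n ∣ N := ⟨m, by rw [mul_comm, hN]⟩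
      exact ⟨by simpa using h.map (ZMod.castHom hm (ZMod m)),
        by simpa using h.map (ZMod.castHom hn (ZMod n))⟩
    rw [MulChar.map_nonunit _ hN1]
    by_cases h1 : IsUnit (a : ZMod m)
    · rw [MulChar.map_nonunit (component χ n) (fun h2 => hu ⟨h1, h2⟩), mul_zero]
    · rw [MulChar.map_nonunit (component χ m) h1, zero_mul]

end SiegelTwo

end

noncomputable section

namespace SiegelTwo

/-! ### Plücker coordinates of the bottom row -/

/-! A coset of `GammaInfPlus` is determined by the 2×2 minors of the bottom row `(C D)`. Since `C
Dᵀ` is symmetric, these minors reduce to five integers `(a, b, c, d, e)` with `a e + b² + c d = 0`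
and no common factor, and every such vector occurs (`exists_plucker_eq`). The automorphy factor
`det(Cτ + D)` is linear in this vector. Hence each Eisenstein series becomes half of a sum over all
primitive isotropic vectors `v` of `weight v · (v.eval τ)⁻ᵏ` (`eisenstein_eq_tsum`). The weight is a
product over primes `p ∣ N` of local factors: `conj ψ(e)`, a quadratic value of a rank-one form, or
`ψ(a)`, according to the rank prescribed at `p`. It vanishes outside the `Γ₀(N)`-orbit of the cusp.
The three series in the formula differ only in the factor at `q`.

The Hecke operator is a sum over `(q + 1) q³` representatives, all in `GammaInfPlus`: a line in the
plane over the field with `q` elements, followed by a translation. Applying `δ₁⁻¹` to the series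
permits a reindexing of its vectors by primitive ones (`tsum_contract`). The new coefficient of `u`
has two branches, according to whether `q` divides `u.e`. Away from `q` they multiply the weight by
`χ_{N₂}(q²)` and `χ_{N/q}(q)` respectively (`contractWeight_weight`).

What remains is a sum at `q` over the representatives, evaluated in `sum_parts` on three strata
modulo `q`: `a ≠ 0`, then `a = 0` with `(c, d) ≠ 0`, then `a = b = c = d = 0`. The strata carry,
respectively, the sum of `conj χ_q(x²)`, the sum of `conj χ_q(x)`, and the single value `conj
χ_q(e)`; they produce the terms in `E_ρ''`, `E_ρ'` and `E_ρ`. The cases of the theorem record which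
character sums vanish. Weight at least four gives absolute convergence
(`summable_inv_norm_eval_pow`), which justifies the interchange of sums. -/

lemma blockA_mul (γ δ : Sp2Z) :
    blockA (γ * δ) = blockA γ * blockA δ + blockB γ * blockC δ := by
  ext i j
  simp [blockA, blockB, blockC, Matrix.toBlocks₂₁, Matrix.toBlocks₁₁, Matrix.toBlocks₁₂,
    Matrix.mul_apply]

lemma blockB_mul (γ δ : Sp2Z) :
    blockB (γ * δ) = blockA γ * blockB δ + blockB γ * blockD δ := by
  ext i j
  simp [blockA, blockB, blockD, Matrix.toBlocks₁₁, Matrix.toBlocks₁₂, Matrix.toBlocks₂₂,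
    Matrix.mul_apply]

lemma blockA_inv (γ : Sp2Z) : blockA γ⁻¹ = (blockD γ)ᵀ := by
  unfold blockA; rw [inv_val]; simp

lemma blockB_inv (γ : Sp2Z) : blockB γ⁻¹ = -(blockB γ)ᵀ := by
  unfold blockB; rw [inv_val]; simp

lemma blockA_one : blockA 1 = 1 := by
  ext i j; simp [blockA, Matrix.toBlocks₁₁, Matrix.one_apply]

lemma blockB_one : blockB 1 = 0 := by
  ext i j; simp [blockB, Matrix.toBlocks₁₂]

lemma blockC_one : blockC 1 = 0 := by
  ext i j; simp [blockC, Matrix.toBlocks₂₁]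

lemma blockD_one : blockD 1 = 1 := by
  ext i j; simp [blockD, Matrix.toBlocks₂₂, Matrix.one_apply]

lemma mul_transpose_AD (γ : Sp2Z) :
    blockA γ * (blockD γ)ᵀ - blockB γ * (blockC γ)ᵀ = 1 := by
  have h := blockA_mul γ γ⁻¹
  rw [mul_inv_cancel, blockA_one, blockA_inv, blockC_inv, Matrix.mul_neg] at h
  rw [h, sub_eq_add_neg]

lemma mul_transpose_CD (γ : Sp2Z) :
    blockC γ * (blockD γ)ᵀ = blockD γ * (blockC γ)ᵀ := by
  have h := blockC_mul γ γ⁻¹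
  rw [mul_inv_cancel, blockC_one, blockA_inv, blockC_inv, Matrix.mul_neg] at h
  exact (eq_of_sub_eq_zero (by rw [sub_eq_add_neg]; exact h.symm))

lemma mul_transpose_AB (γ : Sp2Z) :
    blockA γ * (blockB γ)ᵀ = blockB γ * (blockA γ)ᵀ := by
  have h := blockB_mul γ γ⁻¹
  rw [mul_inv_cancel, blockB_one, blockB_inv, blockD_inv, Matrix.mul_neg, neg_add_eq_sub] at h
  exact (eq_of_sub_eq_zero h.symm).symm

lemma transpose_mul_AC (γ : Sp2Z) :
    (blockA γ)ᵀ * blockC γ = (blockC γ)ᵀ * blockA γ := by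
  have h := blockC_mul γ⁻¹ γ
  rw [inv_mul_cancel, blockC_one, blockC_inv, blockD_inv, Matrix.neg_mul, neg_add_eq_sub] at h
  exact eq_of_sub_eq_zero h.symm

/-- The symplectic relations between the rows of `γ`, entry by entry. -/
lemma row_relations (γ : Sp2Z) :
    (blockA γ 0 0 * blockD γ 0 0 + blockA γ 0 1 * blockD γ 0 1
      - (blockB γ 0 0 * blockC γ 0 0 + blockB γ 0 1 * blockC γ 0 1) = 1) ∧
    (blockA γ 0 0 * blockD γ 1 0 + blockA γ 0 1 * blockD γ 1 1
      - (blockB γ 0 0 * blockC γ 1 0 + blockB γ 0 1 * blockC γ 1 1) = 0) ∧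
    (blockA γ 1 0 * blockD γ 0 0 + blockA γ 1 1 * blockD γ 0 1
      - (blockB γ 1 0 * blockC γ 0 0 + blockB γ 1 1 * blockC γ 0 1) = 0) ∧
    (blockA γ 1 0 * blockD γ 1 0 + blockA γ 1 1 * blockD γ 1 1
      - (blockB γ 1 0 * blockC γ 1 0 + blockB γ 1 1 * blockC γ 1 1) = 1) ∧
    (blockC γ 0 0 * blockD γ 1 0 + blockC γ 0 1 * blockD γ 1 1
      = blockD γ 0 0 * blockC γ 1 0 + blockD γ 0 1 * blockC γ 1 1) ∧
    (blockA γ 0 0 * blockB γ 1 0 + blockA γ 0 1 * blockB γ 1 1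
      = blockB γ 0 0 * blockA γ 1 0 + blockB γ 0 1 * blockA γ 1 1) := by
  have h1 := fun i j => congrFun (congrFun (mul_transpose_AD γ) i) j
  have h2 := congrFun (congrFun (mul_transpose_CD γ) 0) 1
  have h3 := congrFun (congrFun (mul_transpose_AB γ) 0) 1
  simp only [Matrix.sub_apply, Matrix.mul_apply, Fin.sum_univ_two, Matrix.transpose_apply]
    at h1 h2 h3
  refine ⟨?_, ?_, ?_, ?_, h2, h3⟩
  · simpa using h1 0 0
  · simpa using h1 0 1
  · simpa using h1 1 0
  · simpa using h1 1 1

lemma col_relation (γ : Sp2Z) :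
    blockA γ 0 0 * blockC γ 0 1 + blockA γ 1 0 * blockC γ 1 1
      = blockC γ 0 0 * blockA γ 0 1 + blockC γ 1 0 * blockA γ 1 1 := by
  have h2 := congrFun (congrFun (transpose_mul_AC γ) 0) 1
  simpa only [Matrix.mul_apply, Fin.sum_univ_two, Matrix.transpose_apply] using h2

/-- Vectors of the quadratic space `a e + b² + c d` that carries the Plücker coordinates of
coprime symmetric pairs. -/
@[ext]
structure PVec where
  a : ℤ
  b : ℤ
  c : ℤ
  d : ℤ
  e : ℤ

namespace PVec

/-- The alternating form with coordinates `v`, evaluated at two column vectors. -/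
def wedge (v : PVec) (x₀ x₁ x₂ x₃ y₀ y₁ y₂ y₃ : ℤ) : ℤ :=
  -- Five coordinates suffice for six minors: for a symmetric pair the minor of columns 1 and 3 is
  -- the negative of that of columns 0 and 2.
  v.a * (x₀ * y₁ - x₁ * y₀) + v.b * ((x₀ * y₂ - x₂ * y₀) - (x₁ * y₃ - x₃ * y₁)) +
    v.c * (x₀ * y₃ - x₃ * y₀) + v.d * (x₁ * y₂ - x₂ * y₁) + v.e * (x₂ * y₃ - x₃ * y₂)

/-- The right action of the symplectic group on Plücker coordinates. -/
def act (γ : Sp2Z) (v : PVec) : PVec where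
  a := v.wedge (blockA γ 0 0) (blockA γ 1 0) (blockC γ 0 0) (blockC γ 1 0)
    (blockA γ 0 1) (blockA γ 1 1) (blockC γ 0 1) (blockC γ 1 1)
  b := v.wedge (blockA γ 0 0) (blockA γ 1 0) (blockC γ 0 0) (blockC γ 1 0)
    (blockB γ 0 0) (blockB γ 1 0) (blockD γ 0 0) (blockD γ 1 0)
  c := v.wedge (blockA γ 0 0) (blockA γ 1 0) (blockC γ 0 0) (blockC γ 1 0)
    (blockB γ 0 1) (blockB γ 1 1) (blockD γ 0 1) (blockD γ 1 1)
  d := v.wedge (blockA γ 0 1) (blockA γ 1 1) (blockC γ 0 1) (blockC γ 1 1)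
    (blockB γ 0 0) (blockB γ 1 0) (blockD γ 0 0) (blockD γ 1 0)
  e := v.wedge (blockB γ 0 0) (blockB γ 1 0) (blockD γ 0 0) (blockD γ 1 0)
    (blockB γ 0 1) (blockB γ 1 1) (blockD γ 0 1) (blockD γ 1 1)

/-- Primitive isotropic vectors. -/
structure IsCusp (v : PVec) : Prop where
  isotropic : v.a * v.e + v.b ^ 2 + v.c * v.d = 0
  primitive : ∀ p : ℕ, p.Prime → ¬((p : ℤ) ∣ v.a ∧ (p : ℤ) ∣ v.b ∧ (p : ℤ) ∣ v.c ∧ (p : ℤ) ∣ v.d ∧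
    (p : ℤ) ∣ v.e)

/-- `det (M τ + N)` in terms of the Plücker coordinates of `(M N)`. -/
def eval (v : PVec) (τ : Matrix (Fin 2) (Fin 2) ℂ) : ℂ :=
  v.a * τ.det - v.b * (τ 0 1 + τ 1 0) + v.c * τ 0 0 - v.d * τ 1 1 + v.e

lemma dvd_wedge {v : PVec} {p : ℤ} (h : p ∣ v.a ∧ p ∣ v.b ∧ p ∣ v.c ∧ p ∣ v.d ∧ p ∣ v.e)
    (x₀ x₁ x₂ x₃ y₀ y₁ y₂ y₃ : ℤ) : p ∣ v.wedge x₀ x₁ x₂ x₃ y₀ y₁ y₂ y₃ := by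
  obtain ⟨ha, hb, hc, hd, he⟩ := h
  exact dvd_add (dvd_add (dvd_add (dvd_add (ha.mul_right _) (hb.mul_right _)) (hc.mul_right _))
    (hd.mul_right _)) (he.mul_right _)

end PVec

/-- The Plücker coordinates of the bottom row of a symplectic matrix. -/
def plucker (γ : Sp2Z) : PVec where
  a := blockC γ 0 0 * blockC γ 1 1 - blockC γ 0 1 * blockC γ 1 0
  b := blockC γ 0 0 * blockD γ 1 0 - blockD γ 0 0 * blockC γ 1 0
  c := blockC γ 0 0 * blockD γ 1 1 - blockD γ 0 1 * blockC γ 1 0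
  d := blockC γ 0 1 * blockD γ 1 0 - blockD γ 0 0 * blockC γ 1 1
  e := blockD γ 0 0 * blockD γ 1 1 - blockD γ 0 1 * blockD γ 1 0

/-- This is Cauchy–Binet: a minor of `(C D)γ` is the alternating form attached to the rows of `(C
D)`, evaluated at two columns of `γ`. -/
lemma plucker_mul (g γ : Sp2Z) : plucker (g * γ) = (plucker g).act γ := by
  obtain ⟨-, -, -, -, h, -⟩ := row_relations g
  have key : ∀ x₀ x₁ x₂ x₃ y₀ y₁ y₂ y₃ : ℤ,
      (plucker g).wedge x₀ x₁ x₂ x₃ y₀ y₁ y₂ y₃ =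
        (blockC g 0 0 * x₀ + blockC g 0 1 * x₁ + blockD g 0 0 * x₂ + blockD g 0 1 * x₃) *
        (blockC g 1 0 * y₀ + blockC g 1 1 * y₁ + blockD g 1 0 * y₂ + blockD g 1 1 * y₃) -
        (blockC g 0 0 * y₀ + blockC g 0 1 * y₁ + blockD g 0 0 * y₂ + blockD g 0 1 * y₃) *
        (blockC g 1 0 * x₀ + blockC g 1 1 * x₁ + blockD g 1 0 * x₂ + blockD g 1 1 * x₃) := by
    intro x₀ x₁ x₂ x₃ y₀ y₁ y₂ y₃
    simp only [plucker, PVec.wedge]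
    linear_combination (x₃ * y₁ - x₁ * y₃) * h
  ext <;> simp only [PVec.act, key] <;>
    simp only [plucker, blockC_mul, blockD_mul, Matrix.add_apply, Matrix.mul_apply,
      Fin.sum_univ_two] <;> ring

lemma plucker_one : plucker 1 = ⟨0, 0, 0, 0, 1⟩ := by
  simp [plucker, blockC_one, blockD_one]

/-- Symmetry of `τ` is not needed, because `eval` uses both off-diagonal entries; the symmetry of `C
Dᵀ` gives them the same coefficient. -/
lemma eval_plucker (g : Sp2Z) (τ : Matrix (Fin 2) (Fin 2) ℂ) :
    (plucker g).eval τ = ((blockC g).map (Int.cast : ℤ → ℂ) * τ +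
      (blockD g).map (Int.cast : ℤ → ℂ)).det := by
  obtain ⟨-, -, -, -, h, -⟩ := row_relations g
  have h' := congrArg (Int.cast : ℤ → ℂ) h
  push_cast at h'
  simp only [PVec.eval, plucker, Matrix.det_fin_two, Matrix.add_apply, Matrix.mul_apply,
    Fin.sum_univ_two, Matrix.map_apply]
  push_cast
  linear_combination (-τ 1 0) * h'

/-- Isotropy is the Plücker relation. For primitivity, `g⁻¹` acts integrally and sends the vector to
that of the identity, whose last coordinate is 1, so a common prime factor would divide 1. -/
lemma plucker_isCusp (g : Sp2Z) : (plucker g).IsCusp where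
  isotropic := by
    obtain ⟨-, -, -, -, h, -⟩ := row_relations g
    simp only [plucker]
    linear_combination (blockC g 0 0 * blockD g 1 0 - blockD g 0 0 * blockC g 1 0) * h
  primitive := by
    intro p hp hv
    have h : (plucker (g * g⁻¹)).e = 1 := by rw [mul_inv_cancel, plucker_one]
    rw [plucker_mul] at h
    have hd : (p : ℤ) ∣ 1 := h ▸ PVec.dvd_wedge hv _ _ _ _ _ _ _ _
    exact hp.one_lt.ne' (by exact_mod_cast Int.eq_one_of_dvd_one (by positivity) hd)

/-- An element with the same Plücker coordinates as the identity lies in `Γ_∞⁺`. -/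
lemma mem_gammaInfPlus_iff (h : Sp2Z) : h ∈ GammaInfPlus ↔ plucker h = ⟨0, 0, 0, 0, 1⟩ := by
  constructor
  · rintro ⟨hC, hD⟩
    rw [Matrix.det_fin_two] at hD
    simp only [plucker, hC]
    simpa using hD
  · intro hp
    have ha := congrArg PVec.a hp
    have hb := congrArg PVec.b hp
    have hc := congrArg PVec.c hp
    have hd := congrArg PVec.d hp
    have he := congrArg PVec.e hp
    obtain ⟨-, -, -, -, hs, -⟩ := row_relations h
    simp only [plucker] at ha hb hc hd he
    refine ⟨?_, by rw [Matrix.det_fin_two]; linear_combination he⟩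
    ext i j
    fin_cases i <;> fin_cases j <;> simp only [Fin.zero_eta, Fin.mk_one, Fin.isValue, Matrix.zero_apply]
    -- As in Cramer's rule, each entry of `C` times `e = det D = 1` is a combination of the
    -- vanishing minors `b`, `c`, `d`.
    · linear_combination (blockD h 0 0) * hc - (blockD h 0 1) * hb - (blockC h 0 0) * he
    · linear_combination (blockD h 0 0) * (hs - hb) - (blockD h 0 1) * hd - (blockC h 0 1) * he
    · linear_combination (blockD h 1 0) * hc - (blockD h 1 1) * hb - (blockC h 1 0) * he
    · linear_combination (blockD h 1 0) * (hs - hb) - (blockD h 1 1) * hd - (blockC h 1 1) * he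

lemma plucker_mul_left {h : Sp2Z} (hh : h ∈ GammaInfPlus) (g : Sp2Z) :
    plucker (h * g) = plucker g := by
  rw [plucker_mul, (mem_gammaInfPlus_iff h).1 hh, ← plucker_one, ← plucker_mul, one_mul]

/-- This identifies the cosets `Γ_∞⁺ g` with Plücker vectors, the dictionary behind
`eisenstein_eq_tsum`. -/
lemma mul_inv_mem_gammaInfPlus_iff (g g' : Sp2Z) :
    g' * g⁻¹ ∈ GammaInfPlus ↔ plucker g' = plucker g := by
  constructor
  · intro h
    have := plucker_mul_left h g
    rwa [inv_mul_cancel_right] at this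
  · intro h
    rw [mem_gammaInfPlus_iff, plucker_mul, h, ← plucker_mul, mul_inv_cancel, plucker_one]

/-! ### Transitivity of the symplectic group on primitive isotropic vectors -/

/-- The symplectic matrix with given blocks. -/
def ofBlocks (A B C D : Matrix (Fin 2) (Fin 2) ℤ) (h1 : A * Dᵀ - B * Cᵀ = 1)
    (h2 : A * Bᵀ = B * Aᵀ) (h3 : C * Dᵀ = D * Cᵀ) : Sp2Z :=
  ⟨fromBlocks A B C D, by
    rw [SymplecticGroup.mem_iff, Matrix.J, Matrix.fromBlocks_transpose,
      Matrix.fromBlocks_multiply, Matrix.fromBlocks_multiply]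
    have h4 : C * Bᵀ - D * Aᵀ = -1 := by
      have := congrArg Matrix.transpose h1
      simp only [Matrix.transpose_sub, Matrix.transpose_mul, Matrix.transpose_transpose,
        Matrix.transpose_one] at this
      rw [← this]; abel
    congr 1
    · simp [h2]
    · simp only [mul_zero, mul_one, zero_add, mul_neg, add_zero, neg_mul]
      rw [← h1]; abel
    · simp only [mul_zero, mul_one, zero_add, mul_neg, add_zero, neg_mul]
      have h5 : D * Aᵀ - C * Bᵀ = 1 := by simpa using congrArg Neg.neg h4
      rw [← h5]; abel
    · simp [h3]⟩

@[simp] lemma blockA_ofBlocks {A B C D : Matrix (Fin 2) (Fin 2) ℤ} (h1 h2 h3) :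
    blockA (ofBlocks A B C D h1 h2 h3) = A := by simp [blockA, ofBlocks]

@[simp] lemma blockB_ofBlocks {A B C D : Matrix (Fin 2) (Fin 2) ℤ} (h1 h2 h3) :
    blockB (ofBlocks A B C D h1 h2 h3) = B := by simp [blockB, ofBlocks]

@[simp] lemma blockC_ofBlocks {A B C D : Matrix (Fin 2) (Fin 2) ℤ} (h1 h2 h3) :
    blockC (ofBlocks A B C D h1 h2 h3) = C := by simp [blockC, ofBlocks]

@[simp] lemma blockD_ofBlocks {A B C D : Matrix (Fin 2) (Fin 2) ℤ} (h1 h2 h3) :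
    blockD (ofBlocks A B C D h1 h2 h3) = D := by simp [blockD, ofBlocks]

/-- A symmetric pair whose Plücker vector is primitive is the bottom row of a symplectic
matrix. -/
lemma exists_plucker_of_rows (v : PVec) (x₀ x₁ x₂ x₃ y₀ y₁ y₂ y₃ : ℤ)
    (ha : x₀ * y₁ - x₁ * y₀ = v.a) (hb : x₀ * y₂ - x₂ * y₀ = v.b) (hc : x₀ * y₃ - x₃ * y₀ = v.c)
    (hd : x₁ * y₂ - x₂ * y₁ = v.d) (hb' : x₁ * y₃ - x₃ * y₁ = -v.b)
    (he : x₂ * y₃ - x₃ * y₂ = v.e) {ua ub uc ud ue : ℤ}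
    (hu : v.a * ua + v.b * ub + v.c * uc + v.d * ud + v.e * ue = 1) :
    ∃ γ : Sp2Z, plucker γ = v := by
  -- The Bézout relation between the minors yields integral vectors `a`, `b` dual to the rows: `x·a
  -- = y·b = 1` and `x·b = y·a = 0`. They become the top rows after a symplectic twist.
  obtain ⟨a₀, ha₀⟩ : ∃ t, t = ua * y₁ + ub * y₂ + uc * y₃ := ⟨_, rfl⟩
  obtain ⟨a₁, ha₁⟩ : ∃ t, t = -ua * y₀ + ud * y₂ := ⟨_, rfl⟩
  obtain ⟨a₂, ha₂⟩ : ∃ t, t = -ub * y₀ - ud * y₁ + ue * y₃ := ⟨_, rfl⟩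
  obtain ⟨a₃, ha₃⟩ : ∃ t, t = -uc * y₀ - ue * y₂ := ⟨_, rfl⟩
  obtain ⟨b₀, hb₀⟩ : ∃ t, t = -(ua * x₁ + ub * x₂ + uc * x₃) := ⟨_, rfl⟩
  obtain ⟨b₁, hb₁⟩ : ∃ t, t = ua * x₀ - ud * x₂ := ⟨_, rfl⟩
  obtain ⟨b₂, hb₂⟩ : ∃ t, t = ub * x₀ + ud * x₁ - ue * x₃ := ⟨_, rfl⟩
  obtain ⟨b₃, hb₃⟩ : ∃ t, t = uc * x₀ + ue * x₂ := ⟨_, rfl⟩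
  have e11 : x₀ * a₀ + x₁ * a₁ + x₂ * a₂ + x₃ * a₃ = 1 := by
    subst ha₀ ha₁ ha₂ ha₃
    linear_combination hu + ua * ha + ub * hb + uc * hc + ud * hd + ue * he
  have e12 : x₀ * b₀ + x₁ * b₁ + x₂ * b₂ + x₃ * b₃ = 0 := by
    subst hb₀ hb₁ hb₂ hb₃; ring
  have e21 : y₀ * a₀ + y₁ * a₁ + y₂ * a₂ + y₃ * a₃ = 0 := by
    subst ha₀ ha₁ ha₂ ha₃; ring
  have e22 : y₀ * b₀ + y₁ * b₁ + y₂ * b₂ + y₃ * b₃ = 1 := by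
    subst hb₀ hb₁ hb₂ hb₃
    linear_combination hu + ua * ha + ub * hb + uc * hc + ud * hd + ue * he
  have es : x₀ * y₂ + x₁ * y₃ = x₂ * y₀ + x₃ * y₁ := by linear_combination hb + hb'
  clear ha₀ ha₁ ha₂ ha₃ hb₀ hb₁ hb₂ hb₃
  -- The two top rows need not be orthogonal for the symplectic form. Adding `k` times the bottom
  -- row `y` to the first one corrects this and preserves its pairings with the bottom rows.
  obtain ⟨k, hk⟩ : ∃ t, t = -(a₂ * b₀ + a₃ * b₁) + (a₀ * b₂ + a₁ * b₃) := ⟨_, rfl⟩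
  have h1 : !![a₂ + k * y₀, a₃ + k * y₁; b₂, b₃] * (!![x₂, x₃; y₂, y₃])ᵀ -
      !![-a₀ + k * y₂, -a₁ + k * y₃; -b₀, -b₁] * (!![x₀, x₁; y₀, y₁])ᵀ = 1 := by
    ext i j
    fin_cases i <;> fin_cases j <;>
      simp only [Fin.zero_eta, Fin.mk_one, Fin.isValue, Matrix.sub_apply, Matrix.mul_apply,
        Fin.sum_univ_two, Matrix.transpose_apply, Matrix.of_apply, Matrix.cons_val_zero,
        Matrix.cons_val_one, Matrix.one_apply_eq, Matrix.one_apply_ne, ne_eq, zero_ne_one,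
        one_ne_zero, not_false_eq_true]
    · linear_combination e11 - k * es
    · linear_combination e21
    · linear_combination e12
    · linear_combination e22
  have h2 : !![a₂ + k * y₀, a₃ + k * y₁; b₂, b₃] * (!![-a₀ + k * y₂, -a₁ + k * y₃; -b₀, -b₁])ᵀ =
      !![-a₀ + k * y₂, -a₁ + k * y₃; -b₀, -b₁] * (!![a₂ + k * y₀, a₃ + k * y₁; b₂, b₃])ᵀ := by
    ext i j
    fin_cases i <;> fin_cases j <;>
      simp only [Fin.zero_eta, Fin.mk_one, Fin.isValue, Matrix.mul_apply,
        Fin.sum_univ_two, Matrix.transpose_apply, Matrix.of_apply, Matrix.cons_val_zero,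
        Matrix.cons_val_one]
    · ring
    · linear_combination -hk - k * e22
    · linear_combination hk + k * e22
    · ring
  have h3 : !![x₀, x₁; y₀, y₁] * (!![x₂, x₃; y₂, y₃])ᵀ =
      !![x₂, x₃; y₂, y₃] * (!![x₀, x₁; y₀, y₁])ᵀ := by
    ext i j
    fin_cases i <;> fin_cases j <;>
      simp only [Fin.zero_eta, Fin.mk_one, Fin.isValue, Matrix.mul_apply,
        Fin.sum_univ_two, Matrix.transpose_apply, Matrix.of_apply, Matrix.cons_val_zero,
        Matrix.cons_val_one]
    · ring
    · linear_combination es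
    · linear_combination -es
    · ring
  refine ⟨ofBlocks _ _ _ _ h1 h2 h3, ?_⟩
  ext <;> simp [plucker, ← ha, ← hb, ← hc, ← hd, ← he]

lemma PVec.IsCusp.bezout {v : PVec} (hv : v.IsCusp) :
    ∃ ua ub uc ud ue : ℤ, v.a * ua + v.b * ub + v.c * uc + v.d * ud + v.e * ue = 1 := by
  have key : Int.gcd v.a (Int.gcd v.b (Int.gcd v.c (Int.gcd v.d v.e))) = 1 := by
    by_contra hne
    obtain ⟨p, hp, hpd⟩ := Nat.exists_prime_and_dvd hne
    have h0 : (p : ℤ) ∣ (Int.gcd v.a (Int.gcd v.b (Int.gcd v.c (Int.gcd v.d v.e))) : ℕ) := by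
      exact_mod_cast hpd
    have h1 := h0.trans (Int.gcd_dvd_right _ _)
    have h2 := h1.trans (Int.gcd_dvd_right _ _)
    have h3 := h2.trans (Int.gcd_dvd_right _ _)
    exact hv.primitive p hp ⟨h0.trans (Int.gcd_dvd_left _ _), h1.trans (Int.gcd_dvd_left _ _),
      h2.trans (Int.gcd_dvd_left _ _), h3.trans (Int.gcd_dvd_left _ _),
      h3.trans (Int.gcd_dvd_right _ _)⟩
  have e1 := Int.gcd_eq_gcd_ab v.a (Int.gcd v.b (Int.gcd v.c (Int.gcd v.d v.e)))
  have e2 := Int.gcd_eq_gcd_ab v.b (Int.gcd v.c (Int.gcd v.d v.e))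
  have e3 := Int.gcd_eq_gcd_ab v.c (Int.gcd v.d v.e)
  have e4 := Int.gcd_eq_gcd_ab v.d v.e
  rw [key] at e1
  set s₁ := Int.gcdA v.a (Int.gcd v.b (Int.gcd v.c (Int.gcd v.d v.e)))
  set t₁ := Int.gcdB v.a (Int.gcd v.b (Int.gcd v.c (Int.gcd v.d v.e)))
  set s₂ := Int.gcdA v.b (Int.gcd v.c (Int.gcd v.d v.e))
  set t₂ := Int.gcdB v.b (Int.gcd v.c (Int.gcd v.d v.e))
  set s₃ := Int.gcdA v.c (Int.gcd v.d v.e)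
  set t₃ := Int.gcdB v.c (Int.gcd v.d v.e)
  refine ⟨s₁, t₁ * s₂, t₁ * (t₂ * s₃), t₁ * t₂ * t₃ * Int.gcdA v.d v.e,
    t₁ * t₂ * t₃ * Int.gcdB v.d v.e, ?_⟩
  push_cast at e1
  linear_combination -e1 - t₁ * e2 - t₁ * t₂ * e3 - t₁ * t₂ * t₃ * e4

/-- `Sp₂(ℤ)` acts transitively on primitive isotropic vectors. -/
lemma exists_plucker_eq {v : PVec} (hv : v.IsCusp) : ∃ γ : Sp2Z, plucker γ = v := by
  obtain ⟨ua, ub, uc, ud, ue, hu⟩ := hv.bezout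
  by_cases h0 : v.a = 0 ∧ v.b = 0 ∧ v.c = 0
  · obtain ⟨ha, hb, hc⟩ := h0
    exact exists_plucker_of_rows v 0 0 1 0 0 (-v.d) 0 v.e (by simp [ha]) (by simp [hb])
      (by simp [hc]) (by simp) (by simp [hb]) (by simp) hu
  -- With second row `(0, y)` and first row `(g, x)`, where `g = gcd(a, b, c)`, the first three
  -- minors are `g y`.
  · obtain ⟨g, y₁, y₂, y₃, u₁, u₂, u₃, hg, ha, hb, hc, h1⟩ : ∃ g y₁ y₂ y₃ u₁ u₂ u₃ : ℤ, g ≠ 0 ∧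
        v.a = g * y₁ ∧ v.b = g * y₂ ∧ v.c = g * y₃ ∧ y₁ * u₁ + y₂ * u₂ + y₃ * u₃ = 1 := by
      have d1 := Int.gcd_dvd_left v.a (Int.gcd v.b v.c)
      have d0 := Int.gcd_dvd_right v.a (Int.gcd v.b v.c)
      obtain ⟨y₁, hy₁⟩ := d1
      obtain ⟨y₂, hy₂⟩ := d0.trans (Int.gcd_dvd_left v.b v.c)
      obtain ⟨y₃, hy₃⟩ := d0.trans (Int.gcd_dvd_right v.b v.c)
      have e1 := Int.gcd_eq_gcd_ab v.a (Int.gcd v.b v.c)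
      have e2 := Int.gcd_eq_gcd_ab v.b v.c
      have hg : (Int.gcd v.a (Int.gcd v.b v.c) : ℤ) ≠ 0 := by
        intro h
        rw [h, zero_mul] at hy₁ hy₂ hy₃
        exact h0 ⟨hy₁, hy₂, hy₃⟩
      set g : ℤ := (Int.gcd v.a (Int.gcd v.b v.c) : ℤ)
      set s := Int.gcdA v.a (Int.gcd v.b v.c)
      set t := Int.gcdB v.a (Int.gcd v.b v.c)
      refine ⟨g, y₁, y₂, y₃, s, t * Int.gcdA v.b v.c, t * Int.gcdB v.b v.c, hg, hy₁, hy₂, hy₃,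
        mul_left_cancel₀ hg ?_⟩
      linear_combination -s * hy₁ - t * Int.gcdA v.b v.c * hy₂ - t * Int.gcdB v.b v.c * hy₃ - e1 - t * e2
    have hn : y₁ * v.e + y₂ * v.b + y₃ * v.d = 0 := by
      apply mul_left_cancel₀ hg
      linear_combination hv.isotropic - v.e * ha - v.b * hb - v.d * hc
    -- The other minors ask for `x × y = (e, b, d)`. Isotropy makes `(e, b, d)` orthogonal to `y`,
    -- and since `u·y = 1` the vector `x = u × (e, b, d)` solves this equation.
    refine exists_plucker_of_rows v g (u₂ * v.d - u₃ * v.b) (u₃ * v.e - u₁ * v.d)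
      (u₁ * v.b - u₂ * v.e) 0 y₁ y₂ y₃ (by rw [ha]; ring) (by rw [hb]; ring) (by rw [hc]; ring)
      ?_ ?_ ?_ hu
    · linear_combination v.d * h1 - u₃ * hn
    · linear_combination -v.b * h1 + u₂ * hn
    · linear_combination v.e * h1 - u₁ * hn

/-- The set of primitive isotropic vectors. -/
abbrev Cusp : Type := {v : PVec // v.IsCusp}

/-- By transitivity `v` is the Plücker vector of some `g`, so the claim becomes one about the
product `g * γ`. The same reduction proves the other properties of `act`. -/
lemma PVec.IsCusp.act {v : PVec} (hv : v.IsCusp) (γ : Sp2Z) : (v.act γ).IsCusp := by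
  obtain ⟨g, rfl⟩ := exists_plucker_eq hv
  rw [← plucker_mul]
  exact plucker_isCusp _

/-- The permutation of the primitive isotropic vectors given by a symplectic matrix. -/
def cuspEquiv (γ : Sp2Z) : Cusp ≃ Cusp where
  toFun v := ⟨v.1.act γ, v.2.act γ⟩
  invFun v := ⟨v.1.act γ⁻¹, v.2.act γ⁻¹⟩
  left_inv := by
    rintro ⟨v, hv⟩
    obtain ⟨g, rfl⟩ := exists_plucker_eq hv
    simp [← plucker_mul]
  right_inv := by
    rintro ⟨v, hv⟩
    obtain ⟨g, rfl⟩ := exists_plucker_eq hv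
    simp [← plucker_mul]

/-- `(γ τ)` for a symplectic matrix `γ`. -/
def moebius (γ : Sp2Z) (τ : Matrix (Fin 2) (Fin 2) ℂ) : Matrix (Fin 2) (Fin 2) ℂ :=
  ((blockA γ).map (Int.cast : ℤ → ℂ) * τ + (blockB γ).map (Int.cast : ℤ → ℂ)) *
    ((blockC γ).map (Int.cast : ℤ → ℂ) * τ + (blockD γ).map (Int.cast : ℤ → ℂ))⁻¹

/-- This is the cocycle relation `j(gγ, τ) = j(g, γτ) j(γ, τ)`. Nonvanishing makes the inverse in
`moebius` a true inverse. -/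
lemma eval_act {v : PVec} (hv : v.IsCusp) (γ : Sp2Z) {τ : Matrix (Fin 2) (Fin 2) ℂ}
    (h : (plucker γ).eval τ ≠ 0) :
    (v.act γ).eval τ = v.eval (moebius γ τ) * (plucker γ).eval τ := by
  obtain ⟨g, rfl⟩ := exists_plucker_eq hv
  rw [← plucker_mul, eval_plucker, eval_plucker, eval_plucker, ← Matrix.det_mul]
  rw [eval_plucker] at h
  have hinv : (((blockC γ).map (Int.cast : ℤ → ℂ) * τ + (blockD γ).map (Int.cast : ℤ → ℂ)))⁻¹ *
      ((blockC γ).map (Int.cast : ℤ → ℂ) * τ + (blockD γ).map (Int.cast : ℤ → ℂ)) = 1 :=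
    Matrix.nonsing_inv_mul _ (Ne.isUnit h)
  have hmul : ∀ X Y : Matrix (Fin 2) (Fin 2) ℤ, (X * Y).map (Int.cast : ℤ → ℂ) =
      X.map (Int.cast : ℤ → ℂ) * Y.map (Int.cast : ℤ → ℂ) := fun X Y =>
    Matrix.map_mul (f := Int.castRingHom ℂ)
  have hadd : ∀ X Y : Matrix (Fin 2) (Fin 2) ℤ, (X + Y).map (Int.cast : ℤ → ℂ) =
      X.map (Int.cast : ℤ → ℂ) + Y.map (Int.cast : ℤ → ℂ) := fun X Y =>
    Matrix.map_add _ (by simp) X Y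
  congr 1
  rw [moebius, add_mul, mul_assoc, mul_assoc, hinv, mul_one, blockC_mul, blockD_mul, hadd, hadd,
    hmul, hmul, hmul, hmul]
  noncomm_ring

/-! ### Components of a Dirichlet character of square-free level -/

lemma intCast_dvd_of_forall_prime {m : ℕ} (hm : Squarefree m) {x : ℤ}
    (h : ∀ p ∈ m.primeFactors, (p : ℤ) ∣ x) : (m : ℤ) ∣ x := by
  rw [← Nat.prod_primeFactors_of_squarefree hm, Nat.cast_prod]
  refine Finset.prod_dvd_of_coprime (fun p hp r hr hpr => ?_) h
  exact Nat.isCoprime_iff_coprime.2 ((Nat.coprime_primes (Nat.prime_of_mem_primeFactors hp)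
    (Nat.prime_of_mem_primeFactors hr)).2 hpr)

lemma coprime_div_of_squarefree {N m : ℕ} (hN : Squarefree N) (hm : m ∣ N) :
    m * (N / m) = N ∧ m.Coprime (N / m) := by
  have h := Nat.mul_div_cancel' hm
  exact ⟨h, Nat.coprime_of_squarefree_mul (by rwa [h])⟩

lemma exists_int_congr {m n : ℕ} (h : m.Coprime n) (a : ℤ) :
    ∃ b : ℤ, (b : ZMod m) = a ∧ (b : ZMod n) = 1 := by
  obtain ⟨u, v, huv⟩ : IsCoprime (m : ℤ) (n : ℤ) := Nat.isCoprime_iff_coprime.2 h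
  refine ⟨v * n * a + u * m, ?_, ?_⟩
  · have := congrArg (Int.cast : ℤ → ZMod m) huv
    push_cast at this ⊢
    simp only [CharP.cast_eq_zero, mul_zero, zero_add, add_zero] at this ⊢
    rw [this, one_mul]
  · have := congrArg (Int.cast : ℤ → ZMod n) huv
    push_cast at this ⊢
    simp only [CharP.cast_eq_zero, mul_zero, zero_add, add_zero, zero_mul] at this ⊢
    exact this

/-- For a unit `a`, choose `b p ≡ a` modulo `p` and `b p ≡ 1` modulo `N / p`. The product of the `b
p` is `a` modulo `m` and `1` modulo `N / m`, hence computes the component at `m`. For a non-unit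
both sides vanish. -/
lemma component_eq_prod {N : ℕ} (hN : Squarefree N) (χ : DirichletCharacter ℂ N) {m : ℕ}
    (hm : m ∣ N) (a : ℤ) :
    component χ m a = ∏ p ∈ m.primeFactors, component χ p a := by
  have hm0 : m ≠ 0 := ne_zero_of_dvd_ne_zero hN.ne_zero hm
  have hsm : Squarefree m := hN.squarefree_of_dvd hm
  by_cases hu : IsUnit (a : ZMod m)
  · have hpN : ∀ p ∈ m.primeFactors, p ∣ N := fun p hp => (Nat.dvd_of_mem_primeFactors hp).trans hm
    have hex : ∀ p, ∃ b : ℤ, p ∈ m.primeFactors → (b : ZMod p) = a ∧ (b : ZMod (N / p)) = 1 := by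
      intro p
      by_cases hp : p ∈ m.primeFactors
      · obtain ⟨b, hb⟩ := exists_int_congr (coprime_div_of_squarefree hN (hpN p hp)).2 a
        exact ⟨b, fun _ => hb⟩
      · exact ⟨0, fun h => absurd h hp⟩
    choose b hb using hex
    have hcomp : ∀ p ∈ m.primeFactors, component χ p a = χ (b p) := by
      intro p hp
      refine component_apply_aux χ (coprime_div_of_squarefree hN (hpN p hp)).1
        (coprime_div_of_squarefree hN (hpN p hp)).2 ?_ (hb p hp).1 (hb p hp).2
      simpa using hu.map (ZMod.castHom (Nat.dvd_of_mem_primeFactors hp) (ZMod p))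
    rw [Finset.prod_congr rfl hcomp, ← map_prod, ← Int.cast_prod]
    refine component_apply_aux χ (coprime_div_of_squarefree hN hm).1
      (coprime_div_of_squarefree hN hm).2 hu ?_ ?_
    · rw [eq_comm, ZMod.intCast_eq_intCast_iff_dvd_sub]
      apply intCast_dvd_of_forall_prime hsm
      intro p hp
      rw [← ZMod.intCast_eq_intCast_iff_dvd_sub, ← Finset.mul_prod_erase _ _ hp, Int.cast_mul,
        (hb p hp).1, Int.cast_prod, Finset.prod_eq_one, mul_one]
      intro r hr
      obtain ⟨hrp, hr⟩ := Finset.mem_erase.1 hr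
      have hd : p ∣ N / r := by
        have hcop : p.Coprime r := (Nat.coprime_primes (Nat.prime_of_mem_primeFactors hp)
          (Nat.prime_of_mem_primeFactors hr)).2 hrp.symm
        refine hcop.dvd_of_dvd_mul_left ?_
        rw [(coprime_div_of_squarefree hN (hpN r hr)).1]
        exact hpN p hp
      simpa only [map_intCast, map_one] using congrArg (ZMod.castHom hd (ZMod p)) (hb r hr).2
    · rw [Int.cast_prod, Finset.prod_eq_one]
      intro p hp
      have hd : N / m ∣ N / p := Nat.div_dvd_div_left hm (Nat.dvd_of_mem_primeFactors hp)
      simpa only [map_intCast, map_one] using congrArg (ZMod.castHom hd (ZMod (N / m))) (hb p hp).2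
  · rw [MulChar.map_nonunit _ hu]
    rw [ZMod.coe_int_isUnit_iff_isCoprime] at hu
    have : ∃ p ∈ m.primeFactors, (p : ℤ) ∣ a := by
      by_contra! hno
      apply hu
      rw [Int.isCoprime_iff_gcd_eq_one]
      by_contra hg
      obtain ⟨p, hp, hpg⟩ := Nat.exists_prime_and_dvd hg
      have h1 : (p : ℤ) ∣ (Int.gcd m a : ℕ) := by exact_mod_cast hpg
      refine hno p (Nat.mem_primeFactors.2 ⟨hp, ?_, hm0⟩) (h1.trans (Int.gcd_dvd_right _ _))
      exact_mod_cast h1.trans (Int.gcd_dvd_left _ _)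
    obtain ⟨p, hp, hpa⟩ := this
    have : Fact p.Prime := ⟨Nat.prime_of_mem_primeFactors hp⟩
    rw [eq_comm]
    apply Finset.prod_eq_zero hp
    rw [(ZMod.intCast_zmod_eq_zero_iff_dvd a p).2 hpa, MulChar.map_zero]

lemma component_self {N : ℕ} (hN : N ≠ 0) (χ : DirichletCharacter ℂ N) (a : ℤ) :
    component χ N a = χ a := by
  have h := component_mul χ (mul_one N) hN (Nat.coprime_one_right N) a
  have h1 : ∀ x : ZMod 1, component χ 1 x = 1 := fun x => by
    rw [Subsingleton.elim x 1, map_one]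
  rw [h, h1, mul_one]

lemma apply_eq_prod_component {N : ℕ} (hN : Squarefree N) (χ : DirichletCharacter ℂ N) (a : ℤ) :
    χ a = ∏ p ∈ N.primeFactors, component χ p a := by
  rw [← component_eq_prod hN χ dvd_rfl, component_self hN.ne_zero]

/-- An integer that is 1 modulo `N / p` is also 1 modulo `N / m`, so at such integers the components
at `p` and at `m` both equal `χ`. -/
lemma component_sq_eq_one {N : ℕ} (hN : Squarefree N) (χ : DirichletCharacter ℂ N) {m p : ℕ}
    (hm : m ∣ N) (h : component χ m ^ 2 = 1) (hp : p ∣ m) : component χ p ^ 2 = 1 := by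
  have hpN := hp.trans hm
  ext u
  obtain ⟨a, ha⟩ := ZMod.intCast_surjective (u : ZMod p)
  obtain ⟨hp1, hp2⟩ := coprime_div_of_squarefree hN hpN
  obtain ⟨hm1, hm2⟩ := coprime_div_of_squarefree hN hm
  obtain ⟨b, hb1, hb2⟩ := exists_int_congr hp2 a
  have hau : IsUnit (a : ZMod p) := ha ▸ u.isUnit
  have hbu : IsUnit (b : ZMod N) := by
    rw [ZMod.coe_int_isUnit_iff_isCoprime, ← hp1, Nat.cast_mul]
    refine IsCoprime.mul_left ?_ ?_
    · rw [← ZMod.coe_int_isUnit_iff_isCoprime, hb1]; exact hau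
    · rw [← ZMod.coe_int_isUnit_iff_isCoprime, hb2]; exact isUnit_one
  have hbm : IsUnit (b : ZMod m) := by simpa using hbu.map (ZMod.castHom hm (ZMod m))
  have e1 := component_apply_aux χ hp1 hp2 hau hb1 hb2
  have hbm' : (b : ZMod (N / m)) = 1 := by
    simpa only [map_intCast, map_one] using
      congrArg (ZMod.castHom (Nat.div_dvd_div_left hm hp) (ZMod (N / m))) hb2
  have e2 := component_apply_aux χ hm1 hm2 hbm rfl hbm'
  rw [MulChar.pow_apply_coe, MulChar.one_apply_coe, ← ha, e1, ← e2, ← MulChar.pow_apply' _ two_ne_zero, h,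
    MulChar.one_apply hbm]

/-! ### Local weights -/

lemma blockC_inv_dvd {n : ℤ} {γ : Sp2Z} (hγ : ∀ i j, n ∣ blockC γ i j) (i j) :
    n ∣ blockC γ⁻¹ i j := by
  rw [blockC_inv]; simpa using hγ j i

lemma blockC_cast_eq_zero {p : ℕ} [NeZero p] {γ : Sp2Z} (hγ : ∀ i j, (p : ℤ) ∣ blockC γ i j)
    (i j) : (blockC γ i j : ZMod p) = 0 :=
  (ZMod.intCast_zmod_eq_zero_iff_dvd _ p).2 (hγ i j)

/-- Modulo `p` the block `C` vanishes, so `A Dᵀ = 1` and `D` is `det D` times the cofactor matrix of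
`A`. -/
lemma blockD_cast {p : ℕ} [NeZero p] {γ : Sp2Z} (hγ : ∀ i j, (p : ℤ) ∣ blockC γ i j) :
    ((blockA γ 0 0 : ZMod p) * blockA γ 1 1 - blockA γ 1 0 * blockA γ 0 1) *
      ((blockD γ).det : ℤ) = 1 ∧
    (blockD γ 0 0 : ZMod p) = ((blockD γ).det : ℤ) * blockA γ 1 1 ∧
    (blockD γ 0 1 : ZMod p) = -((blockD γ).det : ℤ) * blockA γ 1 0 ∧
    (blockD γ 1 0 : ZMod p) = -((blockD γ).det : ℤ) * blockA γ 0 1 ∧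
    (blockD γ 1 1 : ZMod p) = ((blockD γ).det : ℤ) * blockA γ 0 0 := by
  obtain ⟨h1, h2, h3, h4, -, -⟩ := row_relations γ
  apply_fun (Int.cast : ℤ → ZMod p) at h1 h2 h3 h4
  push_cast [blockC_cast_eq_zero hγ] at h1 h2 h3 h4
  rw [Matrix.det_fin_two]
  push_cast
  refine ⟨?_, ?_, ?_, ?_, ?_⟩
  · linear_combination ((blockA γ 1 0 : ZMod p) * blockD γ 1 0 + blockA γ 1 1 * blockD γ 1 1) * h1 +
      h4 - ((blockA γ 1 0 : ZMod p) * blockD γ 0 0 + blockA γ 1 1 * blockD γ 0 1) * h2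
  · linear_combination -(blockD γ 0 0 : ZMod p) * h4 + blockD γ 1 0 * h3
  · linear_combination -(blockD γ 0 1 : ZMod p) * h4 + blockD γ 1 1 * h3
  · linear_combination -(blockD γ 1 0 : ZMod p) * h1 + blockD γ 0 0 * h2
  · linear_combination -(blockD γ 1 1 : ZMod p) * h1 + blockD γ 0 1 * h2

section Local

variable {p : ℕ} [Fact p.Prime] {ψ : DirichletCharacter ℂ p}

lemma conj_apply_eq (ψ : DirichletCharacter ℂ p) (x : ZMod p) :
    (starRingEnd ℂ) (ψ x) = ψ x⁻¹ := by
  rw [← MulChar.inv_apply', ← MulChar.star_eq_inv]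
  rfl

lemma apply_mul_self_of_sq (h : ψ ^ 2 = 1) {x : ZMod p} (hx : x ≠ 0) : ψ x * ψ x = 1 := by
  rw [← sq, ← MulChar.pow_apply' _ two_ne_zero, h, MulChar.one_apply (Ne.isUnit hx)]

lemma conj_apply_of_sq (h : ψ ^ 2 = 1) (x : ZMod p) : (starRingEnd ℂ) (ψ x) = ψ x := by
  rw [conj_apply_eq]
  by_cases hx : x = 0
  · rw [hx, _root_.inv_zero]
  · have h1 := apply_mul_self_of_sq h hx
    have h2 : ψ x * ψ x⁻¹ = 1 := by rw [← map_mul, mul_inv_cancel₀ hx, map_one]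
    exact mul_left_cancel₀ (left_ne_zero_of_mul_eq_one h1) (h2.trans h1.symm)

/-- The value of a quadratic character on the values of a binary quadratic form
`c x² - 2 b x y - d y²` of rank at most one. -/
def rankOneValue (ψ : DirichletCharacter ℂ p) (c d : ZMod p) : ℂ :=
  if c = 0 then ψ (-d) else ψ c

/-- A form of discriminant zero satisfies `c Q = (c x - b y)²`, or is `-d y²` when `c = 0`. So its
nonzero values lie in one square class, on which a quadratic character is constant. -/
lemma apply_form_eq (h : ψ ^ 2 = 1) {b c d : ZMod p} (hb : b ^ 2 + c * d = 0) (x y : ZMod p)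
    (hQ : c * x ^ 2 - 2 * b * x * y - d * y ^ 2 ≠ 0) :
    ψ (c * x ^ 2 - 2 * b * x * y - d * y ^ 2) = rankOneValue ψ c d := by
  unfold rankOneValue
  split_ifs with hc
  · subst hc
    have hb0 : b = 0 := by simpa using hb
    subst hb0
    have hy : y ≠ 0 := by
      rintro rfl
      exact hQ (by ring)
    have : (0 : ZMod p) * x ^ 2 - 2 * 0 * x * y - d * y ^ 2 = -d * (y * y) := by ring
    rw [this, map_mul, map_mul, apply_mul_self_of_sq h hy, mul_one]
  · have e : c * (c * x ^ 2 - 2 * b * x * y - d * y ^ 2) = (c * x - b * y) * (c * x - b * y) := by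
      linear_combination (-y ^ 2) * hb
    have hne : c * x - b * y ≠ 0 := by
      intro h0
      rw [h0, zero_mul] at e
      exact (mul_ne_zero hc hQ) e
    have e2 := congrArg ψ e
    rw [map_mul, map_mul, apply_mul_self_of_sq h hne] at e2
    have e3 := apply_mul_self_of_sq h hc
    exact mul_left_cancel₀ (left_ne_zero_of_mul_eq_one e3) (e2.trans e3.symm)

/-- The new outer coefficients are `u` times the values of the form at two basis vectors. A nonzero
one has the old square class times `u`; if both vanish, invertibility of the change of variables
forces the old form to vanish. -/
lemma rankOneValue_transform (h : ψ ^ 2 = 1) {b c d : ZMod p} (hb : b ^ 2 + c * d = 0)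
    {x y z w u : ZMod p} (hu : (x * w - y * z) * u = 1) :
    rankOneValue ψ (u * (c * x ^ 2 - 2 * b * x * y - d * y ^ 2))
      (-(u * (c * z ^ 2 - 2 * b * z * w - d * w ^ 2))) = ψ u * rankOneValue ψ c d := by
  have hu0 : u ≠ 0 := right_ne_zero_of_mul_eq_one hu
  have hdet : x * w - y * z ≠ 0 := left_ne_zero_of_mul_eq_one hu
  rw [rankOneValue]
  split_ifs with h1
  · replace h1 := (mul_eq_zero.1 h1).resolve_left hu0
    rw [neg_neg, map_mul]
    by_cases h2 : c * z ^ 2 - 2 * b * z * w - d * w ^ 2 = 0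
    · rw [h2, MulChar.map_zero]
      have hc : c = 0 := by
        by_contra hc
        have e1 : (c * x - b * y) ^ 2 = 0 := by linear_combination c * h1 + y ^ 2 * hb
        have e2 : (c * z - b * w) ^ 2 = 0 := by linear_combination c * h2 + w ^ 2 * hb
        replace e1 := pow_eq_zero_iff two_ne_zero |>.1 e1
        replace e2 := pow_eq_zero_iff two_ne_zero |>.1 e2
        exact mul_ne_zero hc hdet (by linear_combination w * e1 - y * e2)
      subst hc
      have hb0 : b = 0 := by simpa using hb
      subst hb0
      have hd : d = 0 := by
        by_contra hd
        have e1 : d * y ^ 2 = 0 := by linear_combination -h1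
        have e2 : d * w ^ 2 = 0 := by linear_combination -h2
        have e1' : y = 0 := by simpa [hd] using e1
        have e2' : w = 0 := by simpa [hd] using e2
        exact hdet (by rw [e1', e2']; ring)
      rw [rankOneValue, if_pos rfl, hd, neg_zero, MulChar.map_zero, mul_zero]
    · rw [apply_form_eq h hb _ _ h2]
  · rw [map_mul, apply_form_eq h hb _ _ (right_ne_zero_of_mul h1)]

/-- The weight at `p` of a vector, when the rank of the cusp at `p` is `0`. -/
def weight₀ (p : ℕ) (ψ : DirichletCharacter ℂ p) (v : PVec) : ℂ :=
  if (v.a : ZMod p) = 0 ∧ (v.b : ZMod p) = 0 ∧ (v.c : ZMod p) = 0 ∧ (v.d : ZMod p) = 0 then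
    (starRingEnd ℂ) (ψ v.e) else 0

/-- The weight at `p` of a vector, when the rank of the cusp at `p` is `1`. -/
def weight₁ (p : ℕ) (ψ : DirichletCharacter ℂ p) (v : PVec) : ℂ :=
  if (v.a : ZMod p) = 0 then if (v.c : ZMod p) = 0 then ψ (-(v.d : ZMod p)) else ψ v.c else 0

/-- The weight at `p` of a vector, when the rank of the cusp at `p` is `2`. -/
def weight₂ (p : ℕ) (ψ : DirichletCharacter ℂ p) (v : PVec) : ℂ := ψ v.a

lemma PVec.act_act_inv {v : PVec} (hv : v.IsCusp) (γ : Sp2Z) : (v.act γ).act γ⁻¹ = v := by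
  obtain ⟨g, rfl⟩ := exists_plucker_eq hv
  simp [← plucker_mul]

lemma act_a_cast {γ : Sp2Z} (hγ : ∀ i j, (p : ℤ) ∣ blockC γ i j)
    (v : PVec) : ((v.act γ).a : ZMod p) =
    v.a * ((blockA γ 0 0 : ZMod p) * blockA γ 1 1 - blockA γ 1 0 * blockA γ 0 1) := by
  simp only [PVec.act, PVec.wedge]
  push_cast [blockC_cast_eq_zero hγ]
  ring

lemma weight₂_act {γ : Sp2Z} (hγ : ∀ i j, (p : ℤ) ∣ blockC γ i j)
    (v : PVec) :
    weight₂ p ψ (v.act γ) = (starRingEnd ℂ) (ψ ((blockD γ).det : ℤ)) * weight₂ p ψ v := by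
  obtain ⟨h, -⟩ := blockD_cast hγ
  rw [weight₂, act_a_cast hγ, map_mul, conj_apply_eq, weight₂, mul_comm, ← eq_inv_of_mul_eq_one_left h]

lemma act_cast_of_zero {γ : Sp2Z} (hγ : ∀ i j, (p : ℤ) ∣ blockC γ i j)
    {v : PVec} (hv : (v.a : ZMod p) = 0 ∧ (v.b : ZMod p) = 0 ∧
      (v.c : ZMod p) = 0 ∧ (v.d : ZMod p) = 0) :
    (((v.act γ).a : ZMod p) = 0 ∧ ((v.act γ).b : ZMod p) = 0 ∧ ((v.act γ).c : ZMod p) = 0 ∧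
      ((v.act γ).d : ZMod p) = 0) ∧ ((v.act γ).e : ZMod p) = v.e * ((blockD γ).det : ℤ) := by
  obtain ⟨ha, hb, hc, hd⟩ := hv
  refine ⟨⟨?_, ?_, ?_, ?_⟩, ?_⟩ <;> simp only [PVec.act, PVec.wedge, Matrix.det_fin_two] <;>
    push_cast [blockC_cast_eq_zero hγ, ha, hb, hc, hd] <;> ring

lemma weight₀_act {γ : Sp2Z} (hγ : ∀ i j, (p : ℤ) ∣ blockC γ i j)
    {v : PVec} (hv : v.IsCusp) :
    weight₀ p ψ (v.act γ) = (starRingEnd ℂ) (ψ ((blockD γ).det : ℤ)) * weight₀ p ψ v := by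
  unfold weight₀
  by_cases h : (v.a : ZMod p) = 0 ∧ (v.b : ZMod p) = 0 ∧ (v.c : ZMod p) = 0 ∧ (v.d : ZMod p) = 0
  · obtain ⟨h1, h2⟩ := act_cast_of_zero hγ h
    rw [if_pos h, if_pos h1, h2, map_mul, map_mul, mul_comm]
  · rw [if_neg h, if_neg, mul_zero]
    intro h'
    -- The vanishing condition is also reflected by `γ`, as one sees by applying `γ⁻¹`.
    obtain ⟨h1, -⟩ := act_cast_of_zero (blockC_inv_dvd hγ) h'
    rw [PVec.act_act_inv hv] at h1
    exact h h1

/-- On the locus `a = 0` the vector carries the form `c x² - 2 b x y - d y²`, and `γ` acts by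
substituting the columns of `A` and multiplying by `det D`. -/
lemma act_cd_cast {γ : Sp2Z} (hγ : ∀ i j, (p : ℤ) ∣ blockC γ i j)
    {v : PVec} (ha : (v.a : ZMod p) = 0) :
    ((v.act γ).c : ZMod p) = ((blockD γ).det : ℤ) * (v.c * (blockA γ 0 0 : ZMod p) ^ 2 -
      2 * v.b * blockA γ 0 0 * blockA γ 1 0 - v.d * (blockA γ 1 0 : ZMod p) ^ 2) ∧
    ((v.act γ).d : ZMod p) = -(((blockD γ).det : ℤ) * (v.c * (blockA γ 0 1 : ZMod p) ^ 2 -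
      2 * v.b * blockA γ 0 1 * blockA γ 1 1 - v.d * (blockA γ 1 1 : ZMod p) ^ 2)) := by
  obtain ⟨-, h2, h3, h4, h5⟩ := blockD_cast hγ
  constructor <;> simp only [PVec.act, PVec.wedge] <;>
    push_cast [blockC_cast_eq_zero hγ, ha, h2, h3, h4, h5] <;> ring

lemma weight₁_act {γ : Sp2Z} (hγ : ∀ i j, (p : ℤ) ∣ blockC γ i j)
    (hψ : ψ ^ 2 = 1) {v : PVec} (hv : v.IsCusp) :
    weight₁ p ψ (v.act γ) = (starRingEnd ℂ) (ψ ((blockD γ).det : ℤ)) * weight₁ p ψ v := by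
  obtain ⟨hdet, -⟩ := blockD_cast hγ
  have ha := act_a_cast hγ v
  unfold weight₁
  by_cases h : (v.a : ZMod p) = 0
  · rw [if_pos h, if_pos (by rw [ha, h, zero_mul])]
    obtain ⟨hc, hd⟩ := act_cd_cast hγ h
    have hi := congrArg (Int.cast : ℤ → ZMod p) hv.isotropic
    push_cast [h] at hi
    rw [zero_mul, zero_add] at hi
    rw [conj_apply_of_sq hψ, hc, hd]
    exact rankOneValue_transform hψ hi hdet
  · rw [if_neg h, if_neg, mul_zero]
    rw [ha]
    exact mul_ne_zero h (left_ne_zero_of_mul_eq_one hdet)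

end Local

/-! ### Eisenstein series as sums over primitive isotropic vectors -/

/-- The weight at `p` of a vector, for the cusp with partition `(S₀, S₁, *)`. -/
def localWeight (S₀ S₁ p : ℕ) (ψ : DirichletCharacter ℂ p) (v : PVec) : ℂ :=
  if p ∣ S₀ then weight₀ p ψ v else if p ∣ S₁ then weight₁ p ψ v else weight₂ p ψ v

/-- The coefficient of `v` in the Eisenstein series with partition `(S₀, S₁, *)`. -/
def weight {N : ℕ} (χ : DirichletCharacter ℂ N) (S₀ S₁ : ℕ) (v : PVec) : ℂ :=
  ∏ p ∈ N.primeFactors, localWeight S₀ S₁ p (component χ p) v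

lemma localWeight_act {S₀ S₁ p : ℕ} [Fact p.Prime] {ψ : DirichletCharacter ℂ p}
    (hψ : p ∣ S₁ → ψ ^ 2 = 1) {γ : Sp2Z} (hγ : ∀ i j, (p : ℤ) ∣ blockC γ i j) {v : PVec}
    (hv : v.IsCusp) : localWeight S₀ S₁ p ψ (v.act γ) =
      (starRingEnd ℂ) (ψ ((blockD γ).det : ℤ)) * localWeight S₀ S₁ p ψ v := by
  unfold localWeight
  split_ifs with h0 h1
  · exact weight₀_act hγ hv
  · exact weight₁_act hγ (hψ h1) hv
  · exact weight₂_act hγ v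

lemma weight_act {N S₀ S₁ : ℕ} (hN : Squarefree N) {χ : DirichletCharacter ℂ N}
    (hχ : ∀ p, p.Prime → p ∣ S₁ → component χ p ^ 2 = 1) {γ : Sp2Z} (hγ : γ ∈ Gamma0 N)
    {v : PVec} (hv : v.IsCusp) :
    weight χ S₀ S₁ (v.act γ) =
      (starRingEnd ℂ) (χ ((blockD γ).det : ℤ)) * weight χ S₀ S₁ v := by
  rw [apply_eq_prod_component hN, map_prod, weight, weight, ← Finset.prod_mul_distrib]
  refine Finset.prod_congr rfl fun p hp => ?_
  have : Fact p.Prime := ⟨Nat.prime_of_mem_primeFactors hp⟩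
  refine localWeight_act (hχ p this.out) (fun i j => ?_) hv
  exact (Int.natCast_dvd_natCast.2 (Nat.dvd_of_mem_primeFactors hp)).trans (hγ i j)

lemma cuspMatrix_zero_one (S₀ S₁ S₂ : ℕ) : cuspMatrix S₀ S₁ S₂ 0 1 = 0 := by simp [cuspMatrix]

lemma cuspMatrix_one_zero (S₀ S₁ S₂ : ℕ) : cuspMatrix S₀ S₁ S₂ 1 0 = 0 := by simp [cuspMatrix]

lemma cuspMatrix_cast {S₀ S₁ S₂ : ℕ} (h : Squarefree (S₀ * S₁ * S₂)) (p : ℕ) :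
    (p ∣ S₀ → (cuspMatrix S₀ S₁ S₂ 0 0 : ZMod p) = 0 ∧ (cuspMatrix S₀ S₁ S₂ 1 1 : ZMod p) = 0) ∧
    (p ∣ S₁ → (cuspMatrix S₀ S₁ S₂ 0 0 : ZMod p) = 1 ∧ (cuspMatrix S₀ S₁ S₂ 1 1 : ZMod p) = 0) ∧
    (p ∣ S₂ → (cuspMatrix S₀ S₁ S₂ 0 0 : ZMod p) = 1 ∧ (cuspMatrix S₀ S₁ S₂ 1 1 : ZMod p) = 1) := by
  obtain ⟨h0, h1, h2⟩ := cuspMatrix_spec h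
  refine ⟨fun hp => ?_, fun hp => ?_, fun hp => ?_⟩
  · have e0 := congrArg (ZMod.castHom hp (ZMod p)) (congrFun (congrFun h0 0) 0)
    have e1 := congrArg (ZMod.castHom hp (ZMod p)) (congrFun (congrFun h0 1) 1)
    simp only [Matrix.map_apply, map_intCast, Matrix.zero_apply, map_zero] at e0 e1
    exact ⟨e0, e1⟩
  · have e0 := congrArg (ZMod.castHom hp (ZMod p)) (congrFun (congrFun h1 0) 0)
    have e1 := congrArg (ZMod.castHom hp (ZMod p)) (congrFun (congrFun h1 1) 1)
    simp only [Matrix.map_apply, map_intCast, Matrix.diagonal_apply_eq, Matrix.cons_val_zero,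
      Matrix.cons_val_one, map_zero, map_one] at e0 e1
    exact ⟨e0, e1⟩
  · have e0 := congrArg (ZMod.castHom hp (ZMod p)) (congrFun (congrFun h2 0) 0)
    have e1 := congrArg (ZMod.castHom hp (ZMod p)) (congrFun (congrFun h2 1) 1)
    simp only [Matrix.map_apply, map_intCast, Matrix.one_apply_eq, map_one] at e0 e1
    exact ⟨e0, e1⟩

lemma blockA_cuspElement (S₀ S₁ S₂ : ℕ) : blockA (cuspElement S₀ S₁ S₂) = 1 := by
  simp [blockA, cuspElement]

lemma blockC_cuspElement (S₀ S₁ S₂ : ℕ) :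
    blockC (cuspElement S₀ S₁ S₂) = cuspMatrix S₀ S₁ S₂ := by
  simp [blockC, cuspElement]

lemma blockD_cuspElement (S₀ S₁ S₂ : ℕ) : blockD (cuspElement S₀ S₁ S₂) = 1 := by
  simp [blockD, cuspElement]

lemma plucker_cuspElement (S₀ S₁ S₂ : ℕ) : plucker (cuspElement S₀ S₁ S₂) =
    ⟨cuspMatrix S₀ S₁ S₂ 0 0 * cuspMatrix S₀ S₁ S₂ 1 1, 0, cuspMatrix S₀ S₁ S₂ 0 0,
      -cuspMatrix S₀ S₁ S₂ 1 1, 1⟩ := by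
  simp [plucker, blockC_cuspElement, blockD_cuspElement, cuspMatrix_zero_one, cuspMatrix_one_zero]

lemma dvd_third {N S₀ S₁ S₂ p : ℕ} (hS : S₀ * S₁ * S₂ = N) (hp : p ∈ N.primeFactors)
    (h0 : ¬p ∣ S₀) (h1 : ¬p ∣ S₁) : p ∣ S₂ := by
  have hpp := Nat.prime_of_mem_primeFactors hp
  have h := Nat.dvd_of_mem_primeFactors hp
  rw [← hS, hpp.dvd_mul, hpp.dvd_mul] at h
  tauto

/-- This normalisation, with `weight_act`, makes the weight at the vector of `γ_σ γ` equal to the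
Eisenstein coefficient `conj χ(det D_γ)`. -/
lemma weight_cuspElement {N S₀ S₁ S₂ : ℕ} (hN : Squarefree N) (hS : S₀ * S₁ * S₂ = N)
    (χ : DirichletCharacter ℂ N) :
    weight χ S₀ S₁ (plucker (cuspElement S₀ S₁ S₂)) = 1 := by
  refine Finset.prod_eq_one fun p hp => ?_
  have hpp := Nat.prime_of_mem_primeFactors hp
  have : Fact p.Prime := ⟨hpp⟩
  obtain ⟨e0, e1, e2⟩ := cuspMatrix_cast (by rwa [hS] : Squarefree (S₀ * S₁ * S₂)) p
  rw [localWeight, plucker_cuspElement]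
  split_ifs with h0 h1
  · obtain ⟨ea, eb⟩ := e0 h0
    simp [weight₀, ea, eb]
  · obtain ⟨ea, eb⟩ := e1 h1
    simp [weight₁, ea, eb]
  · obtain ⟨ea, eb⟩ := e2 (dvd_third hS hp h0 h1)
    simp [weight₂, ea, eb]

/-! ### Elements of the Siegel parabolic subgroup -/

/-- The block diagonal symplectic matrix whose `D`-block is `(s t; x y)`. -/
def diagElement (s t x y : ℤ) (h : s * y - t * x = 1) : Sp2Z :=
  ofBlocks !![y, -x; -t, s] 0 0 !![s, t; x, y]
    (by
      ext i j
      fin_cases i <;> fin_cases j <;>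
        simp only [Fin.zero_eta, Fin.mk_one, Fin.isValue, Matrix.sub_apply, Matrix.mul_apply,
          Fin.sum_univ_two, Matrix.transpose_apply, Matrix.of_apply, Matrix.cons_val_zero,
          Matrix.cons_val_one, Matrix.one_apply_eq, Matrix.one_apply_ne, ne_eq, zero_ne_one,
          one_ne_zero, not_false_eq_true, Matrix.zero_apply] <;> linarith)
    (by simp) (by simp)

/-- The translation by the symmetric matrix `(y₁ y₂; y₂ y₃)`. -/
def translation (y₁ y₂ y₃ : ℤ) : Sp2Z :=
  ofBlocks 1 !![y₁, y₂; y₂, y₃] 0 1 (by simp)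
    (by ext i j; fin_cases i <;> fin_cases j <;> simp) (by simp)

lemma diagElement_mem (s t x y : ℤ) (h : s * y - t * x = 1) :
    diagElement s t x y h ∈ GammaInfPlus := by
  refine ⟨by simp [diagElement], ?_⟩
  simp [diagElement, Matrix.det_fin_two, h]

lemma translation_mem (y₁ y₂ y₃ : ℤ) : translation y₁ y₂ y₃ ∈ GammaInfPlus :=
  ⟨by simp [translation], by simp [translation]⟩

lemma exists_int_forall_prime (s : Finset ℕ) (hs : ∀ p ∈ s, p.Prime) (f : ∀ p : ℕ, ZMod p) :
    ∃ x : ℤ, ∀ p ∈ s, (x : ZMod p) = f p := by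
  choose g hg using fun p => ZMod.intCast_surjective (f p)
  obtain ⟨r, hr⟩ := Ideal.exists_forall_sub_mem_ideal (ι := s)
    (I := fun p => Ideal.span {((p : ℕ) : ℤ)}) (fun p r hpr =>
      (Ideal.isCoprime_span_singleton_iff _ _).2 (Nat.isCoprime_iff_coprime.2
        ((Nat.coprime_primes (hs p p.2) (hs r r.2)).2 (Subtype.coe_injective.ne hpr))))
    (fun p => g p)
  refine ⟨r, fun p hp => ?_⟩
  have := Ideal.mem_span_singleton.1 (hr ⟨p, hp⟩)
  rw [← hg p, eq_comm, ZMod.intCast_eq_intCast_iff_dvd_sub]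
  exact this

/-- A coprime pair that annihilates the rows of an integral matrix modulo every prime at which
its rank is one. -/
lemma exists_coprime_kernel (s : Finset ℕ) (hs : ∀ p ∈ s, p.Prime) (C : Matrix (Fin 2) (Fin 2) ℤ)
    (hdet : ∀ p ∈ s, (p : ℤ) ∣ C.det)
    (hne : ∀ p ∈ s, ¬((C 0 0 : ZMod p) = 0 ∧ (C 0 1 : ZMod p) = 0 ∧ (C 1 0 : ZMod p) = 0 ∧
      (C 1 1 : ZMod p) = 0)) :
    ∃ x y : ℤ, IsCoprime x y ∧ ∀ p ∈ s, (p : ℤ) ∣ x * C 0 0 + y * C 1 0 ∧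
      (p : ℤ) ∣ x * C 0 1 + y * C 1 1 := by
  classical
  -- At rank one both `(C₁₀, -C₀₀)` and `(C₁₁, -C₀₁)` annihilate the matrix modulo `p`. The integers
  -- `α`, `β` select the first, unless it vanishes modulo `p`, and then the second.
  obtain ⟨α, hα⟩ := exists_int_forall_prime s hs
    (fun p => if (C 0 0 : ZMod p) = 0 ∧ (C 1 0 : ZMod p) = 0 then 0 else 1)
  obtain ⟨β, hβ⟩ := exists_int_forall_prime s hs
    (fun p => if (C 0 0 : ZMod p) = 0 ∧ (C 1 0 : ZMod p) = 0 then 1 else 0)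
  obtain ⟨x, hx⟩ : ∃ x, x = α * C 1 0 + β * C 1 1 := ⟨_, rfl⟩
  obtain ⟨y, hy⟩ : ∃ y, y = -(α * C 0 0) - β * C 0 1 := ⟨_, rfl⟩
  have hxy : ∀ p ∈ s, ¬((p : ℤ) ∣ x ∧ (p : ℤ) ∣ y) := by
    rintro p hp ⟨h1, h2⟩
    rw [← ZMod.intCast_zmod_eq_zero_iff_dvd, hx] at h1
    rw [← ZMod.intCast_zmod_eq_zero_iff_dvd, hy] at h2
    push_cast [hα p hp, hβ p hp] at h1 h2
    by_cases h : (C 0 0 : ZMod p) = 0 ∧ (C 1 0 : ZMod p) = 0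
    · simp only [if_pos h, zero_mul, zero_add, one_mul, neg_zero, zero_sub, neg_eq_zero] at h1 h2
      exact hne p hp ⟨h.1, h2, h.2, h1⟩
    · simp only [if_neg h, zero_mul, one_mul, add_zero, sub_zero, neg_eq_zero] at h1 h2
      exact h ⟨h2, h1⟩
  have hker : ∀ p ∈ s, (p : ℤ) ∣ x * C 0 0 + y * C 1 0 ∧ (p : ℤ) ∣ x * C 0 1 + y * C 1 1 := by
    intro p hp
    have h := hdet p hp
    rw [Matrix.det_fin_two] at h
    subst hx hy
    exact ⟨(h.mul_left β).trans (dvd_of_eq (by ring)), (h.mul_left (-α)).trans (dvd_of_eq (by ring))⟩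
  -- The zero vector can arise only when `s` is empty. Otherwise dividing by the gcd is harmless,
  -- since no prime of `s` divides it.
  by_cases h0 : x = 0 ∧ y = 0
  · refine ⟨0, 1, isCoprime_zero_left.2 isUnit_one, fun p hp => ?_⟩
    exact absurd ⟨h0.1 ▸ dvd_zero _, h0.2 ▸ dvd_zero _⟩ (hxy p hp)
  · have hg : Int.gcd x y ≠ 0 := fun h => h0 (Int.gcd_eq_zero_iff.1 h)
    have e1 := Int.mul_ediv_cancel' (Int.gcd_dvd_left x y)
    have e2 := Int.mul_ediv_cancel' (Int.gcd_dvd_right x y)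
    refine ⟨x / Int.gcd x y, y / Int.gcd x y, ?_, fun p hp => ?_⟩
    · exact Int.isCoprime_iff_gcd_eq_one.2 (Int.gcd_ediv_gcd_ediv_gcd (Nat.pos_of_ne_zero hg))
    · have hpr : Prime (p : ℤ) := Nat.prime_iff_prime_int.1 (hs p hp)
      have hpg : ¬(p : ℤ) ∣ Int.gcd x y := fun h => hxy p hp
        ⟨h.trans (Int.gcd_dvd_left _ _), h.trans (Int.gcd_dvd_right _ _)⟩
      obtain ⟨k1, k2⟩ := hker p hp
      refine ⟨(hpr.dvd_or_dvd ?_).resolve_left hpg, (hpr.dvd_or_dvd ?_).resolve_left hpg⟩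
      · exact k1.trans (dvd_of_eq (by linear_combination -C 0 0 * e1 - C 1 0 * e2))
      · exact k2.trans (dvd_of_eq (by linear_combination -C 0 1 * e1 - C 1 1 * e2))

lemma blockC_diagElement_mul (s t x y : ℤ) (h : s * y - t * x = 1) (g : Sp2Z) :
    blockC (diagElement s t x y h * g) = !![s, t; x, y] * blockC g := by
  rw [blockC_mul]
  simp [diagElement]

lemma blockC_translation_mul (y₁ y₂ y₃ : ℤ) (g : Sp2Z) :
    blockC (translation y₁ y₂ y₃ * g) = blockC g := by
  rw [blockC_mul]
  simp [translation]

lemma blockA_translation_mul (y₁ y₂ y₃ : ℤ) (g : Sp2Z) :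
    blockA (translation y₁ y₂ y₃ * g) = blockA g + !![y₁, y₂; y₂, y₃] * blockC g := by
  rw [blockA_mul]
  simp [translation]

section Orbit

variable {p : ℕ} [Fact p.Prime]

/-- Primitivity makes `det D` invertible modulo `p`; then the vanishing minors force `C = 0` as in
Cramer's rule. -/
lemma blockC_cast_of_rank_zero {g : Sp2Z} (h : ((plucker g).a : ZMod p) = 0 ∧
      ((plucker g).b : ZMod p) = 0 ∧ ((plucker g).c : ZMod p) = 0 ∧ ((plucker g).d : ZMod p) = 0)
    (i j) : (blockC g i j : ZMod p) = 0 := by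
  have he : ((plucker g).e : ZMod p) ≠ 0 := by
    intro he
    simp only [ZMod.intCast_zmod_eq_zero_iff_dvd] at h he
    exact (plucker_isCusp g).primitive p Fact.out ⟨h.1, h.2.1, h.2.2.1, h.2.2.2, he⟩
  obtain ⟨-, hb, hc, hd⟩ := h
  obtain ⟨-, -, -, -, hs, -⟩ := row_relations g
  apply_fun (Int.cast : ℤ → ZMod p) at hs
  simp only [plucker] at hb hc hd he
  push_cast at hb hc hd he hs
  apply mul_left_cancel₀ he
  rw [mul_zero]
  fin_cases i <;> fin_cases j <;> simp only [Fin.zero_eta, Fin.mk_one, Fin.isValue]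
  · linear_combination (blockD g 0 0 : ZMod p) * hc - (blockD g 0 1 : ZMod p) * hb
  · linear_combination (blockD g 0 0 : ZMod p) * (hs - hb) - (blockD g 0 1 : ZMod p) * hd
  · linear_combination (blockD g 1 0 : ZMod p) * hc - (blockD g 1 1 : ZMod p) * hb
  · linear_combination (blockD g 1 0 : ZMod p) * (hs - hb) - (blockD g 1 1 : ZMod p) * hd

/-- The translation that moves `g` modulo `p` to a cusp of rank one. -/
lemma exists_translation_rank_one {g : Sp2Z} (h10 : (blockC g 1 0 : ZMod p) = 0)
    (h11 : (blockC g 1 1 : ZMod p) = 0)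
    (hne : ¬(((plucker g).c : ZMod p) = 0 ∧ ((plucker g).d : ZMod p) = 0)) :
    ∃ y : ZMod p, (blockC g 0 0 : ZMod p) = blockA g 0 0 + y * blockC g 0 0 ∧
      (blockC g 0 1 : ZMod p) = blockA g 0 1 + y * blockC g 0 1 := by
  have hs := col_relation g
  apply_fun (Int.cast : ℤ → ZMod p) at hs
  push_cast [h10, h11] at hs
  by_cases h0 : (blockC g 0 0 : ZMod p) = 0
  · have h1 : (blockC g 0 1 : ZMod p) ≠ 0 := by
      intro h1
      apply hne
      simp only [plucker]
      push_cast [h10, h11, h0, h1]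
      simp
    refine ⟨(blockC g 0 1 - blockA g 0 1) / blockC g 0 1, ?_, ?_⟩
    · field_simp
      linear_combination -hs
    · field_simp
      ring
  · refine ⟨(blockC g 0 0 - blockA g 0 0) / blockC g 0 0, ?_, ?_⟩
    · field_simp
      ring
    · field_simp
      linear_combination hs

/-- The translation that moves `g` modulo `p` to a cusp of rank two. -/
lemma exists_translation_rank_two {g : Sp2Z} (ha : ((plucker g).a : ZMod p) ≠ 0) :
    ∃ y₁ y₂ y₃ : ZMod p,
      (blockC g 0 0 : ZMod p) = blockA g 0 0 + (y₁ * blockC g 0 0 + y₂ * blockC g 1 0) ∧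
      (blockC g 0 1 : ZMod p) = blockA g 0 1 + (y₁ * blockC g 0 1 + y₂ * blockC g 1 1) ∧
      (blockC g 1 0 : ZMod p) = blockA g 1 0 + (y₂ * blockC g 0 0 + y₃ * blockC g 1 0) ∧
      (blockC g 1 1 : ZMod p) = blockA g 1 1 + (y₂ * blockC g 0 1 + y₃ * blockC g 1 1) := by
  have hs := col_relation g
  apply_fun (Int.cast : ℤ → ZMod p) at hs
  simp only [plucker] at ha
  push_cast at hs ha
  obtain ⟨D, hD⟩ : ∃ D, D = ((blockC g 0 0 : ZMod p) * blockC g 1 1 -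
    blockC g 0 1 * blockC g 1 0)⁻¹ := ⟨_, rfl⟩
  have hD1 : ((blockC g 0 0 : ZMod p) * blockC g 1 1 - blockC g 0 1 * blockC g 1 0) * D = 1 := by
    rw [hD, mul_inv_cancel₀ ha]
  -- The matrix `Y = 1 - A C⁻¹` solves `C = A + Y C`. It is symmetric because `Aᵀ C = Cᵀ A`.
  refine ⟨1 - (blockA g 0 0 * blockC g 1 1 - blockA g 0 1 * blockC g 1 0) * D,
    (blockA g 0 0 * blockC g 0 1 - blockA g 0 1 * blockC g 0 0) * D,
    1 - (blockA g 1 1 * blockC g 0 0 - blockA g 1 0 * blockC g 0 1) * D, ?_, ?_, ?_, ?_⟩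
  · linear_combination (blockA g 0 0 : ZMod p) * hD1
  · linear_combination (blockA g 0 1 : ZMod p) * hD1
  · linear_combination (blockA g 1 0 : ZMod p) * hD1 - (blockC g 0 0 : ZMod p) * D * hs
  · linear_combination (blockA g 1 1 : ZMod p) * hD1 - (blockC g 0 1 : ZMod p) * D * hs

end Orbit

/-- The congruence `C ≡ M_σ A` says that `γ_σ⁻¹ g` lies in `Γ₀(N)`. Left multiplication by
`GammaInfPlus` keeps the Plücker vector: an element of `SL₂(ℤ)` kills the second row of `C` at all
primes of `S₁`, and a translation replaces `A` by `A + Y C`. The resulting conditions on the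
symmetric matrix `Y` are solved prime by prime and glued by the Chinese remainder theorem. -/
lemma exists_congr_cuspMatrix {N S₀ S₁ S₂ : ℕ} (hN : Squarefree N) (hS : S₀ * S₁ * S₂ = N)
    {χ : DirichletCharacter ℂ N} {v : PVec} (hv : v.IsCusp) (hw : weight χ S₀ S₁ v ≠ 0) :
    ∃ g : Sp2Z, plucker g = v ∧ ∀ i j, (N : ℤ) ∣
      blockC g i j - (cuspMatrix S₀ S₁ S₂ * blockA g) i j := by
  classical
  have hpos : S₁ ≠ 0 := by
    rintro rfl
    exact hN.ne_zero (by rw [← hS]; simp)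
  have hloc : ∀ p ∈ N.primeFactors, localWeight S₀ S₁ p (component χ p) v ≠ 0 :=
    fun p hp => Finset.prod_ne_zero_iff.1 hw p hp
  have hdisj : ∀ p, p.Prime → p ∣ S₁ → ¬p ∣ S₀ := by
    intro p hp h1 h0
    have hcop : S₀.Coprime S₁ := Nat.coprime_of_squarefree_mul
      (hN.squarefree_of_dvd ⟨S₂, hS.symm⟩)
    exact hp.one_lt.ne' (Nat.dvd_one.1 (hcop.symm.gcd_eq_one ▸ Nat.dvd_gcd h1 h0))
  have hmem : ∀ p ∈ S₁.primeFactors, p ∈ N.primeFactors := fun p hp =>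
    Nat.mem_primeFactors.2 ⟨Nat.prime_of_mem_primeFactors hp,
      (Nat.dvd_of_mem_primeFactors hp).trans ⟨S₀ * S₂, by rw [← hS]; ring⟩, hN.ne_zero⟩
  have hone : ∀ p ∈ S₁.primeFactors, (v.a : ZMod p) = 0 ∧
      ¬((v.c : ZMod p) = 0 ∧ (v.d : ZMod p) = 0) := by
    intro p hp
    have hpp := Nat.prime_of_mem_primeFactors hp
    have hd := Nat.dvd_of_mem_primeFactors hp
    have : Fact p.Prime := ⟨hpp⟩
    have h := hloc p (hmem p hp)
    rw [localWeight, if_neg (hdisj p hpp hd), if_pos hd, weight₁] at h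
    split_ifs at h with h1 h2
    · exact ⟨h1, fun h3 => h (by rw [h3.2, neg_zero, MulChar.map_zero])⟩
    · exact ⟨h1, fun h3 => h2 h3.1⟩
    · exact absurd rfl h
  obtain ⟨g₀, hg₀⟩ := exists_plucker_eq hv
  obtain ⟨x, y, ⟨m, n, hmn⟩, hker⟩ := exists_coprime_kernel S₁.primeFactors
    (fun p hp => Nat.prime_of_mem_primeFactors hp) (blockC g₀)
    (by
      intro p hp
      rw [← ZMod.intCast_zmod_eq_zero_iff_dvd, ← (hone p hp).1, ← hg₀, Matrix.det_fin_two, plucker])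
    (by
      rintro p hp ⟨h1, h2, h3, h4⟩
      apply (hone p hp).2
      rw [← hg₀]
      simp only [plucker]
      push_cast [h1, h2, h3, h4]
      simp)
  obtain ⟨g₁, hg₁, hrow⟩ : ∃ g₁ : Sp2Z, plucker g₁ = v ∧
      ∀ p ∈ S₁.primeFactors, (blockC g₁ 1 0 : ZMod p) = 0 ∧ (blockC g₁ 1 1 : ZMod p) = 0 := by
    refine ⟨diagElement n (-m) x y (by linear_combination hmn) * g₀, ?_, fun p hp => ?_⟩
    · rw [plucker_mul_left (diagElement_mem _ _ _ _ _), hg₀]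
    · obtain ⟨k1, k2⟩ := hker p hp
      rw [blockC_diagElement_mul, ZMod.intCast_zmod_eq_zero_iff_dvd,
        ZMod.intCast_zmod_eq_zero_iff_dvd]
      simpa [Matrix.mul_apply, Fin.sum_univ_two] using And.intro k1 k2
  have hex : ∀ p : ℕ, ∃ y₁ y₂ y₃ : ZMod p, p ∈ N.primeFactors →
      (blockC g₁ 0 0 : ZMod p) = cuspMatrix S₀ S₁ S₂ 0 0 *
        (blockA g₁ 0 0 + (y₁ * blockC g₁ 0 0 + y₂ * blockC g₁ 1 0)) ∧
      (blockC g₁ 0 1 : ZMod p) = cuspMatrix S₀ S₁ S₂ 0 0 *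
        (blockA g₁ 0 1 + (y₁ * blockC g₁ 0 1 + y₂ * blockC g₁ 1 1)) ∧
      (blockC g₁ 1 0 : ZMod p) = cuspMatrix S₀ S₁ S₂ 1 1 *
        (blockA g₁ 1 0 + (y₂ * blockC g₁ 0 0 + y₃ * blockC g₁ 1 0)) ∧
      (blockC g₁ 1 1 : ZMod p) = cuspMatrix S₀ S₁ S₂ 1 1 *
        (blockA g₁ 1 1 + (y₂ * blockC g₁ 0 1 + y₃ * blockC g₁ 1 1)) := by
    intro p
    by_cases hp : p ∈ N.primeFactors
    swap
    · exact ⟨0, 0, 0, fun h => absurd h hp⟩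
    have : Fact p.Prime := ⟨Nat.prime_of_mem_primeFactors hp⟩
    have h := hloc p hp
    obtain ⟨e0, e1, e2⟩ := cuspMatrix_cast (by rwa [hS] : Squarefree (S₀ * S₁ * S₂)) p
    rw [localWeight] at h
    split_ifs at h with h0 h1
    · obtain ⟨ea, eb⟩ := e0 h0
      rw [weight₀] at h
      split_ifs at h with hz
      · rw [← hg₁] at hz
        have hC := blockC_cast_of_rank_zero hz
        exact ⟨0, 0, 0, fun _ => by simp [hC, ea, eb]⟩
      · exact absurd rfl h
    · obtain ⟨ea, eb⟩ := e1 h1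
      have hp1 : p ∈ S₁.primeFactors := Nat.mem_primeFactors.2 ⟨this.out, h1, hpos⟩
      obtain ⟨h10, h11⟩ := hrow p hp1
      obtain ⟨t, ht0, ht1⟩ := exists_translation_rank_one h10 h11 (hg₁ ▸ (hone p hp1).2)
      refine ⟨t, 0, 0, fun _ => ?_⟩
      rw [ea, eb, h10, h11]
      simpa using And.intro ht0 ht1
    · obtain ⟨ea, eb⟩ := e2 (dvd_third hS hp h0 h1)
      have ha : ((plucker g₁).a : ZMod p) ≠ 0 := by
        intro ha
        apply h
        rw [weight₂, ← hg₁, ha, MulChar.map_zero]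
      obtain ⟨y₁, y₂, y₃, h1, h2, h3, h4⟩ := exists_translation_rank_two ha
      refine ⟨y₁, y₂, y₃, fun _ => ?_⟩
      rw [ea, eb, one_mul, one_mul, one_mul, one_mul]
      exact ⟨h1, h2, h3, h4⟩
  choose f₁ f₂ f₃ hf using hex
  have hprimes : ∀ p ∈ N.primeFactors, p.Prime := fun p hp => Nat.prime_of_mem_primeFactors hp
  obtain ⟨y₁, hy₁⟩ := exists_int_forall_prime _ hprimes f₁
  obtain ⟨y₂, hy₂⟩ := exists_int_forall_prime _ hprimes f₂
  obtain ⟨y₃, hy₃⟩ := exists_int_forall_prime _ hprimes f₃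
  refine ⟨translation y₁ y₂ y₃ * g₁, ?_, fun i j => ?_⟩
  · rw [plucker_mul_left (translation_mem _ _ _), hg₁]
  · apply intCast_dvd_of_forall_prime hN
    intro p hp
    rw [← ZMod.intCast_zmod_eq_zero_iff_dvd, blockC_translation_mul, blockA_translation_mul,
      Int.cast_sub, sub_eq_zero]
    obtain ⟨h1, h2, h3, h4⟩ := hf p hp
    rw [← hy₁ p hp, ← hy₂ p hp] at h1 h2
    rw [← hy₂ p hp, ← hy₃ p hp] at h3 h4
    fin_cases i <;> fin_cases j <;>
      simp only [Fin.zero_eta, Fin.mk_one, Fin.isValue, Matrix.mul_apply, Matrix.add_apply,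
        Fin.sum_univ_two, cuspMatrix_zero_one, cuspMatrix_one_zero, zero_mul, add_zero, zero_add,
        Matrix.of_apply, Matrix.cons_val_zero, Matrix.cons_val_one] <;>
      push_cast <;> assumption

/-- The vectors of non-zero weight form the orbit of the cusp under `Γ₀(N)`. -/
lemma exists_mem_gamma0_plucker {N S₀ S₁ S₂ : ℕ} (hN : Squarefree N) (hS : S₀ * S₁ * S₂ = N)
    {χ : DirichletCharacter ℂ N} {v : PVec} (hv : v.IsCusp) (hw : weight χ S₀ S₁ v ≠ 0) :
    ∃ γ ∈ Gamma0 N, plucker (cuspElement S₀ S₁ S₂ * γ) = v := by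
  obtain ⟨g, hg, h⟩ := exists_congr_cuspMatrix hN hS hv hw
  refine ⟨(cuspElement S₀ S₁ S₂)⁻¹ * g, fun i j => ?_, by rw [mul_inv_cancel_left, hg]⟩
  have ht : (cuspMatrix S₀ S₁ S₂)ᵀ = cuspMatrix S₀ S₁ S₂ := by simp [cuspMatrix]
  rw [blockC_mul, blockC_inv, blockD_inv, blockA_cuspElement, blockC_cuspElement, ht,
    Matrix.transpose_one, one_mul, Matrix.neg_mul, neg_add_eq_sub, Matrix.sub_apply]
  exact h i j

/-- The Eisenstein series as a sum over all primitive isotropic vectors. -/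
theorem eisenstein_eq_tsum {N S₀ S₁ S₂ : ℕ} (hN : Squarefree N) (hS : S₀ * S₁ * S₂ = N)
    {χ : DirichletCharacter ℂ N} (hχ : ∀ p, p.Prime → p ∣ S₁ → component χ p ^ 2 = 1) (k : ℕ)
    (τ : Matrix (Fin 2) (Fin 2) ℂ) :
    eisenstein k χ S₀ S₁ S₂ τ =
      (1 / 2 : ℂ) * ∑' v : Cusp, weight χ S₀ S₁ v.1 * (v.1.eval τ ^ k)⁻¹ := by
  have hrel : ∀ γ γ' : Gamma0 N, QuotientGroup.rightRel (cuspStabilizer N (cuspElement S₀ S₁ S₂))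
      γ γ' ↔ plucker (cuspElement S₀ S₁ S₂ * γ.1) = plucker (cuspElement S₀ S₁ S₂ * γ'.1) := by
    intro γ γ'
    rw [QuotientGroup.rightRel_apply, eq_comm, ← mul_inv_mem_gammaInfPlus_iff]
    have : cuspElement S₀ S₁ S₂ * γ'.1 * (cuspElement S₀ S₁ S₂ * γ.1)⁻¹ =
        cuspElement S₀ S₁ S₂ * (γ'.1 * γ.1⁻¹) * (cuspElement S₀ S₁ S₂)⁻¹ := by group
    rw [this]
    rfl
  let i : Quotient (QuotientGroup.rightRel (cuspStabilizer N (cuspElement S₀ S₁ S₂))) → Cusp :=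
    fun c => ⟨plucker (cuspElement S₀ S₁ S₂ * (c.out : Gamma0 N).1), plucker_isCusp _⟩
  have hi : Function.Injective i := by
    intro c c' h
    rw [← Quotient.out_eq c, ← Quotient.out_eq c']
    exact Quotient.sound ((hrel _ _).2 (congrArg Subtype.val h))
  rw [eisenstein, eisensteinAt]
  congr 1
  -- The cosets inject into the primitive isotropic vectors, and every vector outside the image has
  -- weight zero.
  rw [← hi.tsum_eq (f := fun v : Cusp => weight χ S₀ S₁ v.1 * (v.1.eval τ ^ k)⁻¹)]
  · refine tsum_congr fun c => ?_
    simp only [i]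
    rw [eval_plucker, plucker_mul, weight_act hN hχ c.out.2 (plucker_isCusp _),
      weight_cuspElement hN hS, mul_one]
  · rintro ⟨v, hv⟩ hne
    obtain ⟨γ, hγ, h⟩ := exists_mem_gamma0_plucker hN hS hv (left_ne_zero_of_mul hne)
    refine ⟨Quotient.mk _ ⟨γ, hγ⟩, Subtype.ext ?_⟩
    refine Eq.trans ?_ h
    exact (hrel _ _).1 (Quotient.mk_out (s := QuotientGroup.rightRel
      (cuspStabilizer N (cuspElement S₀ S₁ S₂))) (⟨γ, hγ⟩ : Gamma0 N))

/-! ### Absolute convergence -/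

/-- A divisor bound. -/
lemma card_divisors_pow_three_le (n : ℕ) : n.divisors.card ^ 3 ≤ 64 ^ 8 * n := by
  rcases eq_or_ne n 0 with rfl | hn
  · simp
  -- For `p ≥ 8` the bound `f + 1 ≤ 2 ^ f` gives `(f + 1)³ ≤ 8 ^ f ≤ p ^ f`. Smaller primes cost a
  -- factor 64 each, and there are at most eight of them.
  have hterm : ∀ p ∈ n.primeFactors, (n.factorization p + 1) ^ 3 ≤
      (if p < 8 then 64 else 1) * p ^ n.factorization p := by
    intro p hp
    have hp2 := (Nat.prime_of_mem_primeFactors hp).two_le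
    generalize n.factorization p = f
    split_ifs with h8
    · have h1 : (f + 1) ^ 3 ≤ 64 * 2 ^ f := by
        rcases lt_or_ge f 3 with hf | hf
        · interval_cases f <;> norm_num
        · induction f, hf using Nat.le_induction with
          | base => norm_num
          | succ m hm ih =>
            rw [pow_succ 2 m]
            nlinarith [Nat.pow_le_pow_left hm 2, mul_le_mul hm hm (by norm_num) (by omega),
              Nat.mul_le_mul_right (m ^ 2) hm, Nat.mul_le_mul_right m hm]
      exact h1.trans (Nat.mul_le_mul_left _ (Nat.pow_le_pow_left hp2 f))
    · rw [one_mul]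
      calc (f + 1) ^ 3 ≤ (2 ^ f) ^ 3 := Nat.pow_le_pow_left Nat.lt_two_pow_self 3
        _ = 8 ^ f := by rw [← pow_mul, mul_comm, pow_mul]; norm_num
        _ ≤ p ^ f := Nat.pow_le_pow_left (not_lt.1 h8) f
  rw [Nat.card_divisors hn, ← Finset.prod_pow]
  calc ∏ p ∈ n.primeFactors, (n.factorization p + 1) ^ 3
      ≤ ∏ p ∈ n.primeFactors, (if p < 8 then 64 else 1) * p ^ n.factorization p :=
        Finset.prod_le_prod' hterm
    _ = 64 ^ (n.primeFactors.filter (· < 8)).card * n := by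
        rw [Finset.prod_mul_distrib, Finset.prod_ite, Finset.prod_const, Finset.prod_const_one,
          mul_one]
        congr 1
        exact Nat.prod_factorization_pow_eq_self hn
    _ ≤ 64 ^ 8 * n := by
        refine Nat.mul_le_mul_right _ (Nat.pow_le_pow_right (by norm_num) ?_)
        calc _ ≤ (Finset.range 8).card := Finset.card_le_card fun p hp => by
              simpa using (Finset.mem_filter.1 hp).2
          _ = 8 := Finset.card_range 8

/-- The integral divisors of an integer. -/
def intDivisors (n : ℤ) : Finset ℤ :=
  n.natAbs.divisors.image (fun m : ℕ => (m : ℤ)) ∪ n.natAbs.divisors.image (fun m : ℕ => -(m : ℤ))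

lemma mem_intDivisors {n a : ℤ} (hn : n ≠ 0) (h : a ∣ n) : a ∈ intDivisors n := by
  have h1 : a.natAbs ∈ n.natAbs.divisors :=
    Nat.mem_divisors.2 ⟨Int.natAbs_dvd_natAbs.2 h, Int.natAbs_ne_zero.2 hn⟩
  rcases Int.natAbs_eq a with ha | ha
  · exact Finset.mem_union_left _ (Finset.mem_image.2 ⟨_, h1, ha.symm⟩)
  · exact Finset.mem_union_right _ (Finset.mem_image.2 ⟨_, h1, ha.symm⟩)

/-- The constant is the cube root `2 ^ 16` of `64 ^ 8`, doubled to account for signs. -/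
lemma card_intDivisors_le (n : ℤ) :
    ((intDivisors n).card : ℝ) ≤ 2 ^ 17 * (|n| : ℝ) ^ (1 / 3 : ℝ) := by
  have h1 : (intDivisors n).card ≤ 2 * n.natAbs.divisors.card := by
    refine (Finset.card_union_le _ _).trans ?_
    have := Finset.card_image_le (s := n.natAbs.divisors) (f := fun m : ℕ => (m : ℤ))
    have := Finset.card_image_le (s := n.natAbs.divisors) (f := fun m : ℕ => -(m : ℤ))
    omega
  have h2 : ((n.natAbs.divisors.card : ℝ)) ≤ 2 ^ 16 * (|n| : ℝ) ^ (1 / 3 : ℝ) := by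
    have h3 : (n.natAbs.divisors.card : ℝ) ^ 3 ≤ 64 ^ 8 * |(n : ℝ)| := by
      have := card_divisors_pow_three_le n.natAbs
      rw [← Int.cast_abs, ← Int.natCast_natAbs, Int.cast_natCast]
      exact_mod_cast this
    refine le_of_pow_le_pow_left₀ three_ne_zero (by positivity) (h3.trans (le_of_eq ?_))
    rw [mul_pow, ← Real.rpow_natCast (|(n : ℝ)| ^ (1 / 3 : ℝ)), ← Real.rpow_mul (abs_nonneg _)]
    norm_num
  calc ((intDivisors n).card : ℝ) ≤ 2 * n.natAbs.divisors.card := by exact_mod_cast h1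
    _ ≤ 2 * (2 ^ 16 * (|n| : ℝ) ^ (1 / 3 : ℝ)) := by gcongr
    _ = _ := by ring

/-- A height on triples of integers. -/
def tripleHeight (u : ℤ × ℤ × ℤ) : ℝ := 1 + |(u.1 : ℝ)| + |(u.2.1 : ℝ)| + |(u.2.2 : ℝ)|

lemma one_le_tripleHeight (u) : 1 ≤ tripleHeight u := by
  unfold tripleHeight
  have := abs_nonneg (u.1 : ℝ)
  have := abs_nonneg (u.2.1 : ℝ)
  have := abs_nonneg (u.2.2 : ℝ)
  linarith

lemma summable_one_add_abs_rpow {b : ℝ} (hb : 1 < b) :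
    Summable fun x : ℤ => (1 + |(x : ℝ)|) ^ (-b) := by
  have h : Summable fun n : ℕ => (1 + (n : ℝ)) ^ (-b) := by
    have := (summable_nat_add_iff 1).2 (Real.summable_nat_rpow.2 (neg_lt_neg hb))
    refine this.congr fun n => ?_
    push_cast
    rw [add_comm]
  refine Summable.of_nat_of_neg (h.congr fun n => ?_) (h.congr fun n => ?_) <;> simp

/-- The height dominates each `1 + |x|`, so its power `-s` is at most a product of three
one-variable terms of exponent `-s/3 < -1`. -/
lemma summable_tripleHeight_rpow {s : ℝ} (hs : 3 < s) :
    Summable fun u : ℤ × ℤ × ℤ => tripleHeight u ^ (-s) := by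
  have hb : 1 < s / 3 := by linarith
  have h1 := summable_one_add_abs_rpow hb
  have hnn : ∀ x : ℤ, 0 ≤ (1 + |(x : ℝ)|) ^ (-(s / 3)) := fun x => by positivity
  have h2 := h1.mul_of_nonneg (h1.mul_of_nonneg h1 hnn hnn) hnn
    (fun x => mul_nonneg (hnn _) (hnn _))
  refine Summable.of_nonneg_of_le (fun u => ?_) (fun u => ?_) h2
  · have := one_le_tripleHeight u
    positivity
  · have h0 := one_le_tripleHeight u
    have hle : ∀ x : ℤ, |(x : ℝ)| ≤ tripleHeight u - 1 →
        tripleHeight u ^ (-(s / 3)) ≤ (1 + |(x : ℝ)|) ^ (-(s / 3)) := fun x hx =>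
      Real.rpow_le_rpow_of_nonpos (by positivity) (by linarith) (by linarith)
    have e : tripleHeight u ^ (-s) = tripleHeight u ^ (-(s / 3)) *
        (tripleHeight u ^ (-(s / 3)) * tripleHeight u ^ (-(s / 3))) := by
      rw [← Real.rpow_add (by linarith), ← Real.rpow_add (by linarith)]
      congr 1
      ring
    rw [e]
    have a1 := abs_nonneg (u.1 : ℝ)
    have a2 := abs_nonneg (u.2.1 : ℝ)
    have a3 := abs_nonneg (u.2.2 : ℝ)
    have p0 : 0 ≤ tripleHeight u ^ (-(s / 3)) := by positivity
    exact mul_le_mul (hle _ (by unfold tripleHeight; linarith))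
      (mul_le_mul (hle _ (by unfold tripleHeight; linarith))
        (hle _ (by unfold tripleHeight; linarith)) p0 (hnn _)) (mul_nonneg p0 p0) (hnn _)

/-- Since `n u` is of order at most `H²`, it has `O(H^{2/3})` divisors. The sum over divisors is
therefore `O(H^{-10/3})`, which is summable over triples because `10/3 > 3`. -/
lemma summable_divisor_tripleHeight {n : ℤ × ℤ × ℤ → ℤ}
    (hn : ∀ u, |(n u : ℝ)| ≤ 2 * tripleHeight u ^ 2) :
    Summable fun x : (ℤ × ℤ × ℤ) × ℤ =>
      if n x.1 ≠ 0 ∧ x.2 ∣ n x.1 then (tripleHeight x.1 ^ 4)⁻¹ else 0 := by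
  have hpos : ∀ u, 0 < tripleHeight u := fun u => zero_lt_one.trans_le (one_le_tripleHeight u)
  have hsupp : ∀ u, ∀ a ∉ intDivisors (n u),
      (if n u ≠ 0 ∧ a ∣ n u then (tripleHeight u ^ 4)⁻¹ else 0) = 0 := fun u a ha =>
    if_neg fun h => ha (mem_intDivisors h.1 h.2)
  rw [summable_prod_of_nonneg (fun x => by dsimp only [Pi.zero_apply]; have := hpos x.1; split_ifs <;> positivity)]
  refine ⟨fun u => summable_of_ne_finset_zero (hsupp u), ?_⟩
  refine Summable.of_nonneg_of_le (fun u => tsum_nonneg fun a => ?_) (fun u => ?_)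
    ((summable_tripleHeight_rpow (by norm_num : (3 : ℝ) < 10 / 3)).mul_left (2 ^ 18))
  · have := hpos u
    dsimp only
    split_ifs <;> positivity
  · dsimp only
    rw [tsum_eq_sum (hsupp u)]
    have h1 : ∑ a ∈ intDivisors (n u), (if n u ≠ 0 ∧ a ∣ n u then (tripleHeight u ^ 4)⁻¹ else 0) ≤
        (intDivisors (n u)).card • (tripleHeight u ^ 4)⁻¹ := by
      refine Finset.sum_le_card_nsmul _ _ _ fun a _ => ?_
      have := hpos u
      split_ifs
      · exact le_rfl
      · positivity
    refine h1.trans ?_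
    rw [nsmul_eq_mul]
    have h2 : (|(n u : ℝ)|) ^ (1 / 3 : ℝ) ≤ 2 * tripleHeight u ^ (2 / 3 : ℝ) := by
      calc (|(n u : ℝ)|) ^ (1 / 3 : ℝ) ≤ (2 * tripleHeight u ^ 2) ^ (1 / 3 : ℝ) :=
            Real.rpow_le_rpow (abs_nonneg _) (hn u) (by norm_num)
        _ = 2 ^ (1 / 3 : ℝ) * tripleHeight u ^ (2 / 3 : ℝ) := by
            rw [Real.mul_rpow (by norm_num) (by have := hpos u; positivity),
              ← Real.rpow_natCast (tripleHeight u), ← Real.rpow_mul (hpos u).le]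
            norm_num
        _ ≤ 2 * tripleHeight u ^ (2 / 3 : ℝ) := by
            have := Real.rpow_le_self_of_one_le (x := 2) (y := 1 / 3) (by norm_num) (by norm_num)
            have h0 := Real.rpow_nonneg (hpos u).le (2 / 3)
            gcongr
    have h3 : (tripleHeight u ^ 4)⁻¹ = tripleHeight u ^ (-4 : ℝ) := by
      rw [Real.rpow_neg (hpos u).le]
      norm_cast
    have h4 : tripleHeight u ^ (2 / 3 : ℝ) * tripleHeight u ^ (-4 : ℝ) =
        tripleHeight u ^ (-(10 / 3) : ℝ) := by
      rw [← Real.rpow_add (hpos u)]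
      norm_num
    have h5 := Real.rpow_nonneg (hpos u).le (-4)
    calc ((intDivisors (n u)).card : ℝ) * (tripleHeight u ^ 4)⁻¹
        ≤ (2 ^ 17 * (2 * tripleHeight u ^ (2 / 3 : ℝ))) * tripleHeight u ^ (-4 : ℝ) := by
          rw [h3]
          refine mul_le_mul_of_nonneg_right ((card_intDivisors_le _).trans ?_) h5
          gcongr
      _ = 2 ^ 18 * (tripleHeight u ^ (2 / 3 : ℝ) * tripleHeight u ^ (-4 : ℝ)) := by ring
      _ = _ := by rw [h4]

/-- The sum of the absolute values of the coordinates. -/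
def PVec.size (v : PVec) : ℝ :=
  |(v.a : ℝ)| + |(v.b : ℝ)| + |(v.c : ℝ)| + |(v.d : ℝ)| + |(v.e : ℝ)|

lemma PVec.IsCusp.one_le_size {v : PVec} (hv : v.IsCusp) : 1 ≤ v.size := by
  have h : ∀ x : ℤ, x ≠ 0 → (1 : ℝ) ≤ |(x : ℝ)| := fun x hx => by
    rw [← Int.cast_abs]
    exact_mod_cast Int.one_le_abs hx
  have ha := abs_nonneg (v.a : ℝ)
  have hb := abs_nonneg (v.b : ℝ)
  have hc := abs_nonneg (v.c : ℝ)
  have hd := abs_nonneg (v.d : ℝ)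
  have he := abs_nonneg (v.e : ℝ)
  unfold PVec.size
  by_contra! hlt
  have z : ∀ x : ℤ, |(x : ℝ)| < 1 → x = 0 := fun x hx => by
    by_contra h0
    linarith [h x h0]
  apply hv.primitive 2 Nat.prime_two
  rw [z v.a (by linarith), z v.b (by linarith), z v.c (by linarith), z v.d (by linarith),
    z v.e (by linarith)]
  simp

/-- The tool for each stratum of isotropic vectors: a vector in `S` is recovered from a triple `u`
together with a divisor `t` of an integer depending on `u`. -/
lemma summable_indicator_size {S : Set Cusp} (u : PVec → ℤ × ℤ × ℤ) (t : PVec → ℤ)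
    (n : ℤ × ℤ × ℤ → ℤ) (hn : ∀ u, |(n u : ℝ)| ≤ 2 * tripleHeight u ^ 2)
    (hinj : ∀ v ∈ S, ∀ w ∈ S, u v.1 = u w.1 → t v.1 = t w.1 → v.1 = w.1)
    (hdvd : ∀ v ∈ S, n (u v.1) ≠ 0 ∧ t v.1 ∣ n (u v.1))
    (hle : ∀ v ∈ S, tripleHeight (u v.1) ≤ 1 + v.1.size) :
    Summable (S.indicator fun v : Cusp => ((1 + v.1.size) ^ 4)⁻¹) := by
  rw [← summable_subtype_iff_indicator]
  have hi : Function.Injective (fun v : S => (u v.1.1, t v.1.1)) := by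
    intro v w h
    obtain ⟨h1, h2⟩ := Prod.ext_iff.1 h
    exact Subtype.ext (Subtype.ext (hinj v.1 v.2 w.1 w.2 h1 h2))
  refine Summable.of_nonneg_of_le (fun v => ?_) (fun v => ?_)
    ((summable_divisor_tripleHeight hn).comp_injective hi)
  · exact inv_nonneg.2 (by positivity)
  · dsimp only [Function.comp_apply]
    rw [if_pos (hdvd v.1 v.2)]
    have h0 := one_le_tripleHeight (u v.1.1)
    have := hle v.1 v.2
    gcongr

lemma summable_indicator_union {α : Type*} {f : α → ℝ} (hf : ∀ x, 0 ≤ f x) {S T : Set α}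
    (hS : Summable (S.indicator f)) (hT : Summable (T.indicator f)) :
    Summable ((S ∪ T).indicator f) := by
  refine Summable.of_nonneg_of_le (fun x => Set.indicator_nonneg (fun x _ => hf x) x) (fun x => ?_)
    (hS.add hT)
  have h1 := Set.indicator_nonneg (s := S) (fun x _ => hf x) x
  have h2 := Set.indicator_nonneg (s := T) (fun x _ => hf x) x
  by_cases hx : x ∈ S
  · rw [Set.indicator_of_mem (Set.mem_union_left T hx), Set.indicator_of_mem hx]
    linarith
  · by_cases hx' : x ∈ T
    · rw [Set.indicator_of_mem (Set.mem_union_right S hx'), Set.indicator_of_mem hx']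
      linarith
    · rw [Set.indicator_of_notMem (by simp [hx, hx'])]
      linarith

/-- If `a e ≠ 0`, then `(b, c, d)` and the divisor `a` of `-(b² + c d)` determine `v`. If `a` or `e`
vanishes and `b ≠ 0`, then `c` divides `b²` and determines `d`. If `a e = b = 0`, then `c d = 0` and
only two coordinates remain free. These strata cover all cases. -/
lemma summable_inv_size_pow : Summable fun v : Cusp => ((1 + v.1.size) ^ 4)⁻¹ := by
  have hnn : ∀ v : Cusp, 0 ≤ ((1 + v.1.size) ^ 4)⁻¹ := fun v => by positivity
  have hb1 : ∀ u : ℤ × ℤ × ℤ, |((-(u.1 ^ 2 + u.2.1 * u.2.2) : ℤ) : ℝ)| ≤ 2 * tripleHeight u ^ 2 := by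
    rintro ⟨x, y, z⟩
    unfold tripleHeight
    push_cast
    rw [abs_neg]
    have a1 := abs_nonneg (x : ℝ)
    have a2 := abs_nonneg (y : ℝ)
    have a3 := abs_nonneg (z : ℝ)
    have h1 := abs_add_le ((x : ℝ) ^ 2) (y * z)
    rw [abs_mul, abs_pow] at h1
    refine h1.trans ?_
    nlinarith [mul_nonneg a1 a2, mul_nonneg a1 a3, mul_nonneg a2 a3]
  have hb2 : ∀ u : ℤ × ℤ × ℤ, |((u.1 ^ 2 : ℤ) : ℝ)| ≤ 2 * tripleHeight u ^ 2 := by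
    rintro ⟨x, y, z⟩
    unfold tripleHeight
    push_cast
    have a1 := abs_nonneg (x : ℝ)
    have a2 := abs_nonneg (y : ℝ)
    have a3 := abs_nonneg (z : ℝ)
    rw [abs_pow]
    nlinarith [mul_nonneg a1 a2, mul_nonneg a1 a3, mul_nonneg a2 a3]
  have hb3 : ∀ u : ℤ × ℤ × ℤ, |((1 : ℤ) : ℝ)| ≤ 2 * tripleHeight u ^ 2 := by
    intro u
    have := one_le_tripleHeight u
    simp only [Int.cast_one, abs_one]
    nlinarith
  have hM : ∀ v : PVec, 0 ≤ |(v.a : ℝ)| ∧ 0 ≤ |(v.b : ℝ)| ∧ 0 ≤ |(v.c : ℝ)| ∧ 0 ≤ |(v.d : ℝ)| ∧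
      0 ≤ |(v.e : ℝ)| := fun v => ⟨abs_nonneg _, abs_nonneg _, abs_nonneg _, abs_nonneg _,
    abs_nonneg _⟩
  have s1 := summable_indicator_size (S := {v | v.1.a * v.1.e ≠ 0}) (fun v => (v.b, v.c, v.d)) PVec.a
    (fun u => -(u.1 ^ 2 + u.2.1 * u.2.2)) hb1
    (by
      rintro ⟨v, hv⟩ h ⟨w, hw⟩ - h1 h2
      simp only [Prod.mk.injEq] at h1
      obtain ⟨hb, hc, hd⟩ := h1
      refine PVec.ext h2 hb hc hd (mul_left_cancel₀ (left_ne_zero_of_mul h) ?_)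
      have := hv.isotropic
      have := hw.isotropic
      dsimp only at h2 ⊢
      rw [hb, hc, hd] at *
      rw [h2] at *
      linarith)
    (by
      rintro ⟨v, hv⟩ h
      have e : -(v.b ^ 2 + v.c * v.d) = v.a * v.e := by linear_combination -hv.isotropic
      dsimp only
      rw [e]
      exact ⟨h, dvd_mul_right _ _⟩)
    (by
      rintro ⟨v, hv⟩ h
      obtain ⟨h1, h2, h3, h4, h5⟩ := hM v
      simp only [tripleHeight, PVec.size]
      linarith)
  have s2 := summable_indicator_size (S := {v | v.1.a = 0 ∧ v.1.b ≠ 0}) (fun v => (v.b, v.e, 0)) PVec.c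
    (fun u => u.1 ^ 2) hb2
    (by
      rintro ⟨v, hv⟩ ⟨ha, hb0⟩ ⟨w, hw⟩ ⟨ha', -⟩ h1 h2
      simp only [Prod.mk.injEq, and_true] at h1
      obtain ⟨hb, he⟩ := h1
      dsimp only at *
      have i1 := hv.isotropic
      have i2 := hw.isotropic
      rw [ha] at i1
      rw [ha'] at i2
      have hc : v.c ≠ 0 := by
        rintro h0
        rw [h0] at i1
        exact hb0 (by simpa using i1)
      refine PVec.ext (ha.trans ha'.symm) hb h2 (mul_left_cancel₀ hc ?_) he
      rw [hb] at i1
      rw [h2] at *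
      linarith)
    (by
      rintro ⟨v, hv⟩ ⟨ha, hb0⟩
      refine ⟨pow_ne_zero 2 hb0, ⟨-v.d, ?_⟩⟩
      have i1 := hv.isotropic
      dsimp only at *
      rw [ha] at i1
      linarith)
    (by
      rintro ⟨v, hv⟩ h
      obtain ⟨h1, h2, h3, h4, h5⟩ := hM v
      simp only [tripleHeight, PVec.size, Int.cast_zero, abs_zero]
      linarith)
  have s3 := summable_indicator_size (S := {v | v.1.e = 0 ∧ v.1.b ≠ 0}) (fun v => (v.b, v.a, 0)) PVec.c
    (fun u => u.1 ^ 2) hb2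
    (by
      rintro ⟨v, hv⟩ ⟨ha, hb0⟩ ⟨w, hw⟩ ⟨ha', -⟩ h1 h2
      simp only [Prod.mk.injEq, and_true] at h1
      obtain ⟨hb, he⟩ := h1
      dsimp only at *
      have i1 := hv.isotropic
      have i2 := hw.isotropic
      rw [ha] at i1
      rw [ha'] at i2
      have hc : v.c ≠ 0 := by
        rintro h0
        rw [h0] at i1
        exact hb0 (by simpa using i1)
      refine PVec.ext he hb h2 (mul_left_cancel₀ hc ?_) (ha.trans ha'.symm)
      rw [hb] at i1
      rw [h2] at *
      linarith)
    (by
      rintro ⟨v, hv⟩ ⟨ha, hb0⟩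
      refine ⟨pow_ne_zero 2 hb0, ⟨-v.d, ?_⟩⟩
      have i1 := hv.isotropic
      dsimp only at *
      rw [ha] at i1
      linarith)
    (by
      rintro ⟨v, hv⟩ h
      obtain ⟨h1, h2, h3, h4, h5⟩ := hM v
      simp only [tripleHeight, PVec.size, Int.cast_zero, abs_zero]
      linarith)
  have s4 : ∀ (x y x' y' : PVec → ℤ), (∀ v : PVec, 1 + |(x v : ℝ)| + |(y v : ℝ)| ≤ 1 + v.size) →
      (∀ v w : PVec, x v = x w → y v = y w → x' v = x' w → y' v = y' w → v.b = w.b → v = w) →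
      Summable ({v : Cusp | v.1.b = 0 ∧ x' v.1 = 0 ∧ y' v.1 = 0}.indicator
        fun v : Cusp => ((1 + v.1.size) ^ 4)⁻¹) := by
    intro x y x' y' hxy hext
    refine summable_indicator_size (fun v => (x v, y v, 0)) (fun _ => 1) (fun _ => 1) hb3 ?_
      (fun v _ => ⟨one_ne_zero, dvd_rfl⟩) (fun v _ => ?_)
    · rintro ⟨v, hv⟩ ⟨h1, h2, h3⟩ ⟨w, hw⟩ ⟨h4, h5, h6⟩ h -
      simp only [Prod.mk.injEq, and_true] at h
      exact hext v w h.1 h.2 (h2.trans h5.symm) (h3.trans h6.symm) (h1.trans h4.symm)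
    · simpa [tripleHeight] using hxy v.1
  have hsz : ∀ v : PVec, v.size = |(v.a : ℝ)| + |(v.b : ℝ)| + |(v.c : ℝ)| + |(v.d : ℝ)| + |(v.e : ℝ)| :=
    fun _ => rfl
  have t1 := s4 PVec.a PVec.c PVec.e PVec.d
    (fun v => by obtain ⟨h1, h2, h3, h4, h5⟩ := hM v; rw [hsz]; linarith)
    (fun v w h1 h2 h3 h4 h5 => PVec.ext h1 h5 h2 h4 h3)
  have t2 := s4 PVec.a PVec.d PVec.e PVec.c
    (fun v => by obtain ⟨h1, h2, h3, h4, h5⟩ := hM v; rw [hsz]; linarith)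
    (fun v w h1 h2 h3 h4 h5 => PVec.ext h1 h5 h4 h2 h3)
  have t3 := s4 PVec.e PVec.c PVec.a PVec.d
    (fun v => by obtain ⟨h1, h2, h3, h4, h5⟩ := hM v; rw [hsz]; linarith)
    (fun v w h1 h2 h3 h4 h5 => PVec.ext h3 h5 h2 h4 h1)
  have t4 := s4 PVec.e PVec.d PVec.a PVec.c
    (fun v => by obtain ⟨h1, h2, h3, h4, h5⟩ := hM v; rw [hsz]; linarith)
    (fun v w h1 h2 h3 h4 h5 => PVec.ext h3 h5 h4 h2 h1)
  have hall := summable_indicator_union hnn (summable_indicator_union hnn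
    (summable_indicator_union hnn s1 s2) s3) (summable_indicator_union hnn
      (summable_indicator_union hnn t1 t2) (summable_indicator_union hnn t3 t4))
  refine hall.congr fun v => Set.indicator_of_mem ?_ _
  have hi := v.2.isotropic
  simp only [Set.mem_union, Set.mem_ofPred_eq]
  by_cases hae : v.1.a * v.1.e = 0
  · by_cases hb : v.1.b = 0
    · rw [hae, hb] at hi
      have hcd : v.1.c * v.1.d = 0 := by linarith
      rcases mul_eq_zero.1 hae with h | h <;> rcases mul_eq_zero.1 hcd with h' | h' <;> tauto
    · rcases mul_eq_zero.1 hae with h | h <;> tauto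
  · tauto

/-- The function `g` of isotropic vectors is bounded by a multiple of the automorphy factor. -/
def BoundedByEval (τ : Matrix (Fin 2) (Fin 2) ℂ) (g : PVec → ℝ) : Prop :=
  ∃ K, 0 ≤ K ∧ ∀ v : PVec, v.IsCusp → |g v| ≤ K * ‖v.eval τ‖

namespace BoundedByEval

variable {τ : Matrix (Fin 2) (Fin 2) ℂ} {g h : PVec → ℝ}

lemma add (hg : BoundedByEval τ g) (hh : BoundedByEval τ h) :
    BoundedByEval τ (fun v => g v + h v) := by
  obtain ⟨K, hK0, hK⟩ := hg
  obtain ⟨M, hM0, hM⟩ := hh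
  refine ⟨K + M, add_nonneg hK0 hM0, fun v hv => (abs_add_le _ _).trans ?_⟩
  rw [add_mul]
  exact add_le_add (hK v hv) (hM v hv)

lemma const_mul (hg : BoundedByEval τ g) (x : ℝ) : BoundedByEval τ (fun v => x * g v) := by
  obtain ⟨K, hK0, hK⟩ := hg
  refine ⟨|x| * K, by positivity, fun v hv => ?_⟩
  rw [abs_mul, mul_assoc]
  exact mul_le_mul_of_nonneg_left (hK v hv) (abs_nonneg x)

lemma congr (hg : BoundedByEval τ g) (e : ∀ v, h v = g v) : BoundedByEval τ h := by
  obtain rfl : h = g := funext e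
  exact hg

lemma abs (hg : BoundedByEval τ g) : BoundedByEval τ (fun v => |g v|) := by
  obtain ⟨K, hK0, hK⟩ := hg
  exact ⟨K, hK0, fun v hv => by rw [abs_abs]; exact hK v hv⟩

lemma of_sq {x : ℝ} (hx : 0 < x) (hg : ∀ v : PVec, v.IsCusp → x * g v ^ 2 ≤ ‖v.eval τ‖ ^ 2) :
    BoundedByEval τ g := by
  refine ⟨(√x)⁻¹, by positivity, fun v hv => ?_⟩
  rw [inv_mul_eq_div, le_div_iff₀ (Real.sqrt_pos.2 hx)]
  refine abs_le_of_sq_le_sq' ?_ (norm_nonneg _) |>.2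
  rw [mul_pow, sq_abs, Real.sq_sqrt hx.le, mul_comm]
  exact hg v hv

end BoundedByEval

/-- On isotropic vectors, `|v.eval τ|²` agrees with a positive definite quadratic form in the
coordinates, a majorant of the isotropic form; this bounds every coordinate. -/
lemma boundedByEval_size {τ : Matrix (Fin 2) (Fin 2) ℂ} (hτ : τ ∈ upperHalfSpace) :
    BoundedByEval τ PVec.size := by
  obtain ⟨hsymm, hpos⟩ := hτ
  have h10 : τ 1 0 = τ 0 1 := hsymm.apply 0 1
  obtain ⟨x₁, hx₁⟩ : ∃ x, x = (τ 0 0).re := ⟨_, rfl⟩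
  obtain ⟨x₂, hx₂⟩ : ∃ x, x = (τ 0 1).re := ⟨_, rfl⟩
  obtain ⟨x₃, hx₃⟩ : ∃ x, x = (τ 1 1).re := ⟨_, rfl⟩
  obtain ⟨y₁, hy₁⟩ : ∃ x, x = (τ 0 0).im := ⟨_, rfl⟩
  obtain ⟨y₂, hy₂⟩ : ∃ x, x = (τ 0 1).im := ⟨_, rfl⟩
  obtain ⟨y₃, hy₃⟩ : ∃ x, x = (τ 1 1).im := ⟨_, rfl⟩
  have hy : 0 < y₁ := by
    have := hpos.diag_pos (i := 0)
    rwa [Matrix.map_apply, ← hy₁] at this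
  have hΔ : 0 < y₁ * y₃ - y₂ ^ 2 := by
    have := hpos.det_pos
    rw [Matrix.det_fin_two] at this
    simp only [Matrix.map_apply, h10, ← hy₁, ← hy₂, ← hy₃] at this
    linarith
  obtain ⟨Δ, hΔ'⟩ : ∃ Δ, Δ = y₁ * y₃ - y₂ ^ 2 := ⟨_, rfl⟩
  rw [← hΔ'] at hΔ
  -- These are the coordinates after translation by the real part of `τ`, which leaves the purely
  -- imaginary point `iY` with `det Y = Δ`.
  let a : PVec → ℝ := fun v => v.a
  let b : PVec → ℝ := fun v => v.b + v.a * x₂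
  let c : PVec → ℝ := fun v => v.c + v.a * x₃
  let d : PVec → ℝ := fun v => v.d - v.a * x₁
  let e : PVec → ℝ := fun v =>
    v.a * (x₁ * x₃ - x₂ ^ 2) - 2 * v.b * x₂ + v.c * x₁ - v.d * x₃ + v.e
  have key : ∀ v : PVec, v.IsCusp → ‖v.eval τ‖ ^ 2 = e v ^ 2 + Δ ^ 2 * a v ^ 2 +
      (y₁ * c v - 2 * y₂ * b v - y₂ ^ 2 / y₁ * d v) ^ 2 +
      2 * Δ * (b v + y₂ / y₁ * d v) ^ 2 + (Δ / y₁) ^ 2 * d v ^ 2 := by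
    intro v hv
    have hre : (v.eval τ).re = e v - Δ * a v := by
      simp only [PVec.eval, Matrix.det_fin_two, h10, Complex.add_re, Complex.sub_re,
        Complex.mul_re, Complex.intCast_re, Complex.intCast_im, Complex.sub_im, Complex.mul_im,
        Complex.add_im, ← hx₁, ← hx₂, ← hx₃, ← hy₁, ← hy₂, ← hy₃, a, e, hΔ']
      ring
    have him : (v.eval τ).im = y₁ * c v - y₃ * d v - 2 * y₂ * b v := by
      simp only [PVec.eval, Matrix.det_fin_two, h10, Complex.add_re, Complex.sub_re,
        Complex.mul_re, Complex.intCast_re, Complex.intCast_im, Complex.sub_im, Complex.mul_im,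
        Complex.add_im, ← hx₁, ← hx₂, ← hx₃, ← hy₁, ← hy₂, ← hy₃, b, c, d]
      ring
    have hiso : a v * e v + b v ^ 2 + c v * d v = 0 := by
      have := congrArg (Int.cast : ℤ → ℝ) hv.isotropic
      push_cast at this
      simp only [a, b, c, d, e]
      linear_combination this
    rw [← Complex.normSq_eq_norm_sq, Complex.normSq_apply, hre, him]
    have e3 : y₃ = (Δ + y₂ ^ 2) / y₁ := by
      rw [hΔ']
      field_simp
      ring
    rw [e3]
    field_simp
    -- The indefinite term `-2 Δ a e` in the square of the real part becomes `2 Δ (b² + c d)` by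
    -- isotropy; completing squares does the rest.
    linear_combination (-2 * Δ * y₁ ^ 2) * hiso
  have Be : BoundedByEval τ e := .of_sq one_pos fun v hv => by
    rw [key v hv]
    have := hΔ.le
    have : 0 ≤ Δ ^ 2 * a v ^ 2 + (y₁ * c v - 2 * y₂ * b v - y₂ ^ 2 / y₁ * d v) ^ 2 +
      2 * Δ * (b v + y₂ / y₁ * d v) ^ 2 + (Δ / y₁) ^ 2 * d v ^ 2 := by positivity
    linarith
  have Ba : BoundedByEval τ a := .of_sq (pow_pos hΔ 2) fun v hv => by
    rw [key v hv]
    have := hΔ.le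
    have : 0 ≤ e v ^ 2 + (y₁ * c v - 2 * y₂ * b v - y₂ ^ 2 / y₁ * d v) ^ 2 +
      2 * Δ * (b v + y₂ / y₁ * d v) ^ 2 + (Δ / y₁) ^ 2 * d v ^ 2 := by positivity
    linarith
  have Bd : BoundedByEval τ d := .of_sq (pow_pos (div_pos hΔ hy) 2) fun v hv => by
    rw [key v hv]
    have := hΔ.le
    have : 0 ≤ e v ^ 2 + Δ ^ 2 * a v ^ 2 + (y₁ * c v - 2 * y₂ * b v - y₂ ^ 2 / y₁ * d v) ^ 2 +
      2 * Δ * (b v + y₂ / y₁ * d v) ^ 2 := by positivity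
    linarith
  have Bb : BoundedByEval τ b := by
    have h1 : BoundedByEval τ (fun v => b v + y₂ / y₁ * d v) :=
      .of_sq (mul_pos two_pos hΔ) fun v hv => by
        rw [key v hv]
        have : 0 ≤ e v ^ 2 + Δ ^ 2 * a v ^ 2 +
          (y₁ * c v - 2 * y₂ * b v - y₂ ^ 2 / y₁ * d v) ^ 2 + (Δ / y₁) ^ 2 * d v ^ 2 := by positivity
        linarith
    exact (h1.add (Bd.const_mul (-(y₂ / y₁)))).congr fun v => by ring
  have Bc : BoundedByEval τ c := by
    have h1 : BoundedByEval τ (fun v => y₁ * c v - 2 * y₂ * b v - y₂ ^ 2 / y₁ * d v) :=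
      .of_sq one_pos fun v hv => by
        rw [key v hv]
        have := hΔ.le
        have : 0 ≤ e v ^ 2 + Δ ^ 2 * a v ^ 2 + 2 * Δ * (b v + y₂ / y₁ * d v) ^ 2 +
          (Δ / y₁) ^ 2 * d v ^ 2 := by positivity
        linarith
    exact (((h1.add (Bb.const_mul (2 * y₂))).add (Bd.const_mul (y₂ ^ 2 / y₁))).const_mul y₁⁻¹).congr
      fun v => by field_simp; ring
  have Bb' : BoundedByEval τ (fun v => (v.b : ℝ)) :=
    (Bb.add (Ba.const_mul (-x₂))).congr fun v => by simp only [a, b]; ring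
  have Bc' : BoundedByEval τ (fun v => (v.c : ℝ)) :=
    (Bc.add (Ba.const_mul (-x₃))).congr fun v => by simp only [a, c]; ring
  have Bd' : BoundedByEval τ (fun v => (v.d : ℝ)) :=
    (Bd.add (Ba.const_mul x₁)).congr fun v => by simp only [a, d]; ring
  have Be' : BoundedByEval τ (fun v => (v.e : ℝ)) :=
    (Be.add ((Ba.const_mul (-(x₁ * x₃ - x₂ ^ 2))).add ((Bb'.const_mul (2 * x₂)).add
      ((Bc'.const_mul (-x₁)).add (Bd'.const_mul x₃))))).congr fun v => by simp only [a, e]; ring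
  exact (((Ba.abs.add Bb'.abs).add Bc'.abs).add Bd'.abs).add Be'.abs

/-- The automorphy factors do not vanish on the upper half space. -/
lemma eval_ne_zero {v : PVec} (hv : v.IsCusp) {τ : Matrix (Fin 2) (Fin 2) ℂ}
    (hτ : τ ∈ upperHalfSpace) : v.eval τ ≠ 0 := by
  obtain ⟨K, -, hK⟩ := boundedByEval_size hτ
  intro h
  have h1 := hK v hv
  rw [h, norm_zero, mul_zero] at h1
  linarith [hv.one_le_size, le_abs_self v.size]

/-- The Siegel Eisenstein series of degree two and weight at least four converges absolutely. -/
theorem summable_inv_norm_eval_pow {τ : Matrix (Fin 2) (Fin 2) ℂ} (hτ : τ ∈ upperHalfSpace)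
    {k : ℕ} (hk : 4 ≤ k) : Summable fun v : Cusp => (‖v.1.eval τ‖ ^ k)⁻¹ := by
  obtain ⟨K, hK0, hK⟩ := boundedByEval_size hτ
  refine Summable.of_nonneg_of_le (fun v => by positivity) (fun v => ?_)
    (summable_inv_size_pow.mul_left ((2 * K) ^ k))
  have hs := v.2.one_le_size
  have hl := norm_pos_iff.2 (eval_ne_zero v.2 hτ)
  have h1 : 1 + v.1.size ≤ 2 * K * ‖v.1.eval τ‖ := by
    have := hK v.1 v.2
    rw [abs_of_nonneg (by linarith)] at this
    linarith
  have h2 : (1 + v.1.size) ^ 4 ≤ (2 * K) ^ k * ‖v.1.eval τ‖ ^ k := by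
    rw [← mul_pow]
    exact (pow_le_pow_right₀ (by linarith) hk).trans (pow_le_pow_left₀ (by linarith) h1 k)
  rw [← div_eq_mul_inv, le_div_iff₀ (by positivity), inv_mul_le_iff₀ (by positivity)]
  linarith

/-! ### The slash operator -/

/-- Only the denominator of the right-hand factor must be invertible: the rule for the inverse of a
matrix product holds without any assumption on the other one. -/
lemma slash_mul (k : ℕ) (f : Matrix (Fin 2) (Fin 2) ℂ → ℂ)
    {M₁ M₂ : Matrix (Fin 2 ⊕ Fin 2) (Fin 2 ⊕ Fin 2) ℝ} (h₁ : M₁.det = 1) (h₂ : M₂.det = 1)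
    {τ : Matrix (Fin 2) (Fin 2) ℂ}
    (hτ : (M₂.toBlocks₂₁.map Complex.ofReal * τ + M₂.toBlocks₂₂.map Complex.ofReal).det ≠ 0) :
    slash k f (M₁ * M₂) τ = slash k (slash k f M₁) M₂ τ := by
  have hmul : ∀ X Y : Matrix (Fin 2) (Fin 2) ℝ, (X * Y).map Complex.ofReal =
      X.map Complex.ofReal * Y.map Complex.ofReal := fun X Y =>
    Matrix.map_mul (f := Complex.ofRealHom)
  have hadd : ∀ X Y : Matrix (Fin 2) (Fin 2) ℝ, (X + Y).map Complex.ofReal =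
      X.map Complex.ofReal + Y.map Complex.ofReal := fun X Y =>
    Matrix.map_add _ (by simp) X Y
  have hblocks : M₁ * M₂ = fromBlocks (M₁.toBlocks₁₁ * M₂.toBlocks₁₁ + M₁.toBlocks₁₂ * M₂.toBlocks₂₁)
      (M₁.toBlocks₁₁ * M₂.toBlocks₁₂ + M₁.toBlocks₁₂ * M₂.toBlocks₂₂)
      (M₁.toBlocks₂₁ * M₂.toBlocks₁₁ + M₁.toBlocks₂₂ * M₂.toBlocks₂₁)
      (M₁.toBlocks₂₁ * M₂.toBlocks₁₂ + M₁.toBlocks₂₂ * M₂.toBlocks₂₂) := by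
    conv_lhs => rw [← Matrix.fromBlocks_toBlocks M₁, ← Matrix.fromBlocks_toBlocks M₂,
      Matrix.fromBlocks_multiply]
  unfold slash
  simp only [Matrix.det_mul, h₁, h₂, mul_one, Real.one_rpow, Complex.ofReal_one, one_mul]
  rw [hblocks]
  simp only [Matrix.toBlocks_fromBlocks₁₁, Matrix.toBlocks_fromBlocks₁₂,
    Matrix.toBlocks_fromBlocks₂₁, Matrix.toBlocks_fromBlocks₂₂, hmul, hadd]
  obtain ⟨A, hA⟩ : ∃ A, A = M₂.toBlocks₁₁.map Complex.ofReal * τ +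
    M₂.toBlocks₁₂.map Complex.ofReal := ⟨_, rfl⟩
  obtain ⟨Z, hZ⟩ : ∃ Z, Z = M₂.toBlocks₂₁.map Complex.ofReal * τ +
    M₂.toBlocks₂₂.map Complex.ofReal := ⟨_, rfl⟩
  rw [← hA, ← hZ]
  rw [← hZ] at hτ
  have hinv : Z⁻¹ * Z = 1 := Matrix.nonsing_inv_mul _ (Ne.isUnit hτ)
  have hinv' : Z * Z⁻¹ = 1 := Matrix.mul_nonsing_inv _ (Ne.isUnit hτ)
  have hfac : ∀ P Q : Matrix (Fin 2) (Fin 2) ℂ,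
      (P * M₂.toBlocks₁₁.map Complex.ofReal + Q * M₂.toBlocks₂₁.map Complex.ofReal) * τ +
      (P * M₂.toBlocks₁₂.map Complex.ofReal + Q * M₂.toBlocks₂₂.map Complex.ofReal) =
      (P * (A * Z⁻¹) + Q) * Z := by
    intro P Q
    have e : (P * (A * Z⁻¹) + Q) * Z = P * A + Q * Z := by
      rw [add_mul, mul_assoc, mul_assoc, hinv, mul_one]
    rw [e, hA, hZ]
    noncomm_ring
  rw [hfac, hfac, Matrix.det_mul, Matrix.mul_inv_rev, mul_pow, mul_inv]
  have : (M₁.toBlocks₁₁.map Complex.ofReal * (A * Z⁻¹) + M₁.toBlocks₁₂.map Complex.ofReal) * Z *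
      (Z⁻¹ * (M₁.toBlocks₂₁.map Complex.ofReal * (A * Z⁻¹) +
        M₁.toBlocks₂₂.map Complex.ofReal)⁻¹) =
      (M₁.toBlocks₁₁.map Complex.ofReal * (A * Z⁻¹) + M₁.toBlocks₁₂.map Complex.ofReal) *
      (M₁.toBlocks₂₁.map Complex.ofReal * (A * Z⁻¹) +
        M₁.toBlocks₂₂.map Complex.ofReal)⁻¹ := by
    rw [mul_assoc, ← mul_assoc Z, hinv', one_mul]
  rw [this]
  ring

lemma toReal_eq_fromBlocks (γ : Sp2Z) : toReal γ =
    fromBlocks ((blockA γ).map (Int.cast : ℤ → ℝ)) ((blockB γ).map (Int.cast : ℤ → ℝ))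
      ((blockC γ).map (Int.cast : ℤ → ℝ)) ((blockD γ).map (Int.cast : ℤ → ℝ)) := by
  rw [toReal, ← Matrix.fromBlocks_map, Matrix.fromBlocks_toBlocks]

lemma det_toReal (γ : Sp2Z) : (toReal γ).det = 1 := by
  have h := SymplecticGroup.det_eq_one γ.2
  have h' := (Int.castRingHom ℝ).map_det γ.1
  rw [h, map_one] at h'
  exact h'.symm

lemma map_intCast_ofReal (M : Matrix (Fin 2) (Fin 2) ℤ) :
    (M.map (Int.cast : ℤ → ℝ)).map Complex.ofReal = M.map (Int.cast : ℤ → ℂ) := by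
  ext i j; simp

lemma toReal_denominator (γ : Sp2Z) (τ : Matrix (Fin 2) (Fin 2) ℂ) :
    ((toReal γ).toBlocks₂₁.map Complex.ofReal * τ +
      (toReal γ).toBlocks₂₂.map Complex.ofReal).det = (plucker γ).eval τ := by
  rw [eval_plucker, toReal_eq_fromBlocks, Matrix.toBlocks_fromBlocks₂₁,
    Matrix.toBlocks_fromBlocks₂₂, map_intCast_ofReal, map_intCast_ofReal]

lemma slash_toReal (k : ℕ) (f : Matrix (Fin 2) (Fin 2) ℂ → ℂ) (γ : Sp2Z)
    (τ : Matrix (Fin 2) (Fin 2) ℂ) :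
    slash k f (toReal γ) τ = ((plucker γ).eval τ ^ k)⁻¹ * f (moebius γ τ) := by
  have h := toReal_denominator γ τ
  unfold slash
  simp only [det_toReal, Real.one_rpow, Complex.ofReal_one, one_mul]
  rw [h, moebius, toReal_eq_fromBlocks]
  simp only [Matrix.toBlocks_fromBlocks₁₁, Matrix.toBlocks_fromBlocks₁₂,
    Matrix.toBlocks_fromBlocks₂₁, Matrix.toBlocks_fromBlocks₂₂, map_intCast_ofReal]

lemma heckeDelta_eq {q : ℕ} (hq : q ≠ 0) : heckeDelta q =
    fromBlocks !![(q : ℝ), 0; 0, 1] 0 0 !![(q : ℝ)⁻¹, 0; 0, 1] := by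
  have hq' : (q : ℝ) ≠ 0 := Nat.cast_ne_zero.2 hq
  have h1 : (Matrix.diagonal ![(q : ℝ), 1]) = !![(q : ℝ), 0; 0, 1] := by
    ext i j; fin_cases i <;> fin_cases j <;> simp
  have h2 : (!![(q : ℝ), 0; 0, 1] : Matrix (Fin 2) (Fin 2) ℝ)⁻¹ = !![(q : ℝ)⁻¹, 0; 0, 1] := by
    apply Matrix.inv_eq_right_inv
    ext i j; fin_cases i <;> fin_cases j <;> simp [hq']
  rw [heckeDelta, h1, h2]

lemma heckeDelta_inv {q : ℕ} (hq : q ≠ 0) : (heckeDelta q)⁻¹ =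
    fromBlocks !![(q : ℝ)⁻¹, 0; 0, 1] 0 0 !![(q : ℝ), 0; 0, 1] := by
  have hq' : (q : ℝ) ≠ 0 := Nat.cast_ne_zero.2 hq
  apply Matrix.inv_eq_right_inv
  rw [heckeDelta_eq hq, Matrix.fromBlocks_multiply, ← Matrix.fromBlocks_one]
  congr 1
  · ext i j; fin_cases i <;> fin_cases j <;> simp [hq']
  · simp
  · simp
  · ext i j; fin_cases i <;> fin_cases j <;> simp [hq']

lemma det_heckeDelta {q : ℕ} (hq : q ≠ 0) : (heckeDelta q).det = 1 := by
  have hq' : (q : ℝ) ≠ 0 := Nat.cast_ne_zero.2 hq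
  rw [heckeDelta_eq hq, Matrix.det_fromBlocks_zero₂₁, Matrix.det_fin_two_of, Matrix.det_fin_two_of]
  simp [hq']

lemma det_heckeDelta_inv {q : ℕ} (hq : q ≠ 0) : ((heckeDelta q)⁻¹).det = 1 := by
  rw [Matrix.det_nonsing_inv, det_heckeDelta hq, Ring.inverse_one]

/-- The action of `δ₁⁻¹` on the upper half space. -/
def contract (q : ℕ) (τ : Matrix (Fin 2) (Fin 2) ℂ) : Matrix (Fin 2) (Fin 2) ℂ :=
  !![τ 0 0 / (q : ℂ) ^ 2, τ 0 1 / q; τ 1 0 / q, τ 1 1]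

lemma slash_heckeDelta_inv {q : ℕ} (hq : q ≠ 0) (k : ℕ) (f : Matrix (Fin 2) (Fin 2) ℂ → ℂ)
    (τ : Matrix (Fin 2) (Fin 2) ℂ) :
    slash k f (heckeDelta q)⁻¹ τ = ((q : ℂ) ^ k)⁻¹ * f (contract q τ) := by
  have hq' : (q : ℂ) ≠ 0 := Nat.cast_ne_zero.2 hq
  unfold slash
  simp only [det_heckeDelta_inv hq, Real.one_rpow, Complex.ofReal_one, one_mul]
  rw [heckeDelta_inv hq]
  simp only [Matrix.toBlocks_fromBlocks₁₁, Matrix.toBlocks_fromBlocks₁₂,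
    Matrix.toBlocks_fromBlocks₂₁, Matrix.toBlocks_fromBlocks₂₂]
  have h0 : (0 : Matrix (Fin 2) (Fin 2) ℝ).map Complex.ofReal = 0 := by ext i j; simp
  have h1 : (!![(q : ℝ), 0; 0, 1] : Matrix (Fin 2) (Fin 2) ℝ).map Complex.ofReal =
      !![(q : ℂ), 0; 0, 1] := by
    ext i j; fin_cases i <;> fin_cases j <;> simp
  have h2 : (!![(q : ℝ)⁻¹, 0; 0, 1] : Matrix (Fin 2) (Fin 2) ℝ).map Complex.ofReal =
      !![(q : ℂ)⁻¹, 0; 0, 1] := by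
    ext i j; fin_cases i <;> fin_cases j <;> simp
  have h3 : (!![(q : ℂ), 0; 0, 1] : Matrix (Fin 2) (Fin 2) ℂ)⁻¹ = !![(q : ℂ)⁻¹, 0; 0, 1] := by
    apply Matrix.inv_eq_right_inv
    ext i j; fin_cases i <;> fin_cases j <;> simp [hq']
  rw [h0, h1, h2, zero_mul, zero_add, add_zero, h3, Matrix.det_fin_two_of]
  congr 2
  · ring
  · ext i j
    fin_cases i <;> fin_cases j <;>
      simp [contract, Matrix.mul_apply, Fin.sum_univ_two, Matrix.vecMul, vecHead, vecTail] <;>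
      field_simp

lemma heckeDelta_mul_eq_iff {q : ℕ} (hq : q ≠ 0) (g γ : Sp2Z) :
    heckeDelta q * toReal g = toReal γ * heckeDelta q ↔
      (blockA g 0 0 = blockA γ 0 0 ∧ q * blockA g 0 1 = blockA γ 0 1 ∧
        blockA g 1 0 = q * blockA γ 1 0 ∧ blockA g 1 1 = blockA γ 1 1) ∧
      (q ^ 2 * blockB g 0 0 = blockB γ 0 0 ∧ q * blockB g 0 1 = blockB γ 0 1 ∧
        q * blockB g 1 0 = blockB γ 1 0 ∧ blockB g 1 1 = blockB γ 1 1) ∧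
      (blockC g 0 0 = q ^ 2 * blockC γ 0 0 ∧ blockC g 0 1 = q * blockC γ 0 1 ∧
        blockC g 1 0 = q * blockC γ 1 0 ∧ blockC g 1 1 = blockC γ 1 1) ∧
      (blockD g 0 0 = blockD γ 0 0 ∧ blockD g 0 1 = q * blockD γ 0 1 ∧
        q * blockD g 1 0 = blockD γ 1 0 ∧ blockD g 1 1 = blockD γ 1 1) := by
  have hq' : (q : ℝ) ≠ 0 := Nat.cast_ne_zero.2 hq
  rw [heckeDelta_eq hq, toReal_eq_fromBlocks, toReal_eq_fromBlocks, Matrix.fromBlocks_multiply,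
    Matrix.fromBlocks_multiply, Matrix.fromBlocks_inj]
  simp only [Matrix.zero_mul, Matrix.mul_zero, add_zero, zero_add]
  have e : ∀ x y : ℤ, x = y ↔ (x : ℝ) = y := fun x y => Int.cast_inj.symm
  refine and_congr ?_ (and_congr ?_ (and_congr ?_ ?_)) <;>
    rw [← Matrix.ext_iff] <;>
    simp only [Fin.forall_fin_two, Matrix.mul_apply, Fin.sum_univ_two, Matrix.map_apply,
      Matrix.of_apply, Matrix.cons_val_zero, Matrix.cons_val_one, e, zero_mul, mul_zero, add_zero,
      zero_add, one_mul, mul_one, and_assoc] <;>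
    push_cast <;>
    refine and_congr ?_ (and_congr ?_ (and_congr ?_ ?_)) <;>
    first
      | exact Iff.rfl
      | (constructor <;> intro h <;> linarith)
      | (constructor <;> intro h <;> (try field_simp at h) <;> (try field_simp) <;> linarith)

/-! ### Representatives for the Hecke operator -/

section Reps

variable {N q : ℕ}

lemma blockC_dvd_of_mem (hqN : q ∣ N) {γ : Sp2Z} (hγ : γ ∈ Gamma0 N) (i j) :
    (q : ℤ) ∣ blockC γ i j := (Int.natCast_dvd_natCast.2 hqN).trans (hγ i j)

lemma apply_det_mul_conj [NeZero N] (χ : DirichletCharacter ℂ N) {γ : Sp2Z} (hγ : γ ∈ Gamma0 N) :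
    χ ((blockD γ).det : ℤ) * (starRingEnd ℂ) (χ ((blockD γ).det : ℤ)) = 1 := by
  obtain ⟨h, -⟩ := blockD_cast hγ
  have hu : IsUnit (((blockD γ).det : ℤ) : ZMod N) := IsUnit.of_mul_eq_one_right _ h
  obtain ⟨u, hu⟩ := hu
  rw [Complex.mul_conj, Complex.normSq_eq_norm_sq, ← hu, DirichletCharacter.unit_norm_eq_one]
  simp

/-- Conjugation by `δ₁` scales entries by powers of `q`, so membership is an integrality condition.
The divisibility of `B₁₀` and `D₁₀` follows from the three listed conditions and the symplectic
relations, since `A₀₀` is prime to `q`. -/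
lemma mem_heckeSubgroup_iff [Fact q.Prime] (hqN : q ∣ N) (γ : Gamma0 N) :
    γ ∈ heckeSubgroup N q ↔ (q : ℤ) ∣ blockA γ.1 0 1 ∧ (q : ℤ) ^ 2 ∣ blockB γ.1 0 0 ∧
      (q : ℤ) ∣ blockB γ.1 0 1 := by
  have hq0 : q ≠ 0 := (Fact.out : q.Prime).ne_zero
  have hqz : (q : ℤ) ≠ 0 := by exact_mod_cast hq0
  have hpr : Prime (q : ℤ) := Nat.prime_iff_prime_int.1 Fact.out
  constructor
  · rintro ⟨g, -, h⟩
    obtain ⟨⟨-, h1, -, -⟩, ⟨h2, h3, -, -⟩, -⟩ := (heckeDelta_mul_eq_iff hq0 g γ.1).1 h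
    exact ⟨⟨_, h1.symm⟩, ⟨_, h2.symm⟩, ⟨_, h3.symm⟩⟩
  · rintro ⟨⟨a, ha⟩, ⟨b₀, hb₀⟩, ⟨b₁, hb₁⟩⟩
    obtain ⟨γ, hγ⟩ := γ
    dsimp only at ha hb₀ hb₁ ⊢
    obtain ⟨r1, r2, r3, r4, r5, r6⟩ := row_relations γ
    have hC := blockC_dvd_of_mem hqN hγ
    obtain ⟨c₀, hc₀⟩ := hC 0 0
    obtain ⟨c₁, hc₁⟩ := hC 0 1
    obtain ⟨c₂, hc₂⟩ := hC 1 0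
    obtain ⟨c₃, hc₃⟩ := hC 1 1
    have hA : ¬(q : ℤ) ∣ blockA γ 0 0 := by
      rintro ⟨t, ht⟩
      refine hpr.not_isUnit (isUnit_of_dvd_one ⟨t * blockD γ 0 0 + a * blockD γ 0 1 -
        (blockB γ 0 0 * c₀ + blockB γ 0 1 * c₁), ?_⟩)
      rw [ht, ha, hc₀, hc₁] at r1
      linear_combination -r1
    obtain ⟨d, hd⟩ : (q : ℤ) ∣ blockD γ 1 0 := by
      refine (hpr.dvd_or_dvd (a := blockA γ 0 0) ⟨blockB γ 0 0 * c₂ + blockB γ 0 1 * c₃ -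
        a * blockD γ 1 1, ?_⟩).resolve_left hA
      rw [ha, hc₂, hc₃] at r2
      linear_combination r2
    obtain ⟨b₂, hb₂⟩ : (q : ℤ) ∣ blockB γ 1 0 := by
      refine (hpr.dvd_or_dvd (a := blockA γ 0 0) ⟨q * b₀ * blockA γ 1 0 + b₁ * blockA γ 1 1 -
        a * blockB γ 1 1, ?_⟩).resolve_left hA
      rw [ha, hb₀, hb₁] at r6
      linear_combination r6
    have e1 : !![blockA γ 0 0, a; q * blockA γ 1 0, blockA γ 1 1] *
        (!![blockD γ 0 0, q * blockD γ 0 1; d, blockD γ 1 1])ᵀ -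
        !![b₀, b₁; b₂, blockB γ 1 1] *
        (!![(q : ℤ) ^ 2 * blockC γ 0 0, q * blockC γ 0 1; q * blockC γ 1 0, blockC γ 1 1])ᵀ = 1 := by
      rw [ha, hb₀, hb₁] at r1
      rw [ha, hb₀, hb₁, hd] at r2
      rw [hb₂] at r3
      rw [hb₂, hd] at r4
      ext i j
      fin_cases i <;> fin_cases j <;>
        simp only [Fin.zero_eta, Fin.mk_one, Fin.isValue, Matrix.sub_apply, Matrix.mul_apply,
          Fin.sum_univ_two, Matrix.transpose_apply, Matrix.of_apply, Matrix.cons_val_zero,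
          Matrix.cons_val_one, Matrix.one_apply_eq, Matrix.one_apply_ne, ne_eq, zero_ne_one,
          one_ne_zero, not_false_eq_true]
      · linear_combination r1
      · exact mul_left_cancel₀ hqz (by linear_combination r2)
      · linear_combination (q : ℤ) * r3
      · linear_combination r4
    have e2 : !![blockA γ 0 0, a; q * blockA γ 1 0, blockA γ 1 1] *
        (!![b₀, b₁; b₂, blockB γ 1 1])ᵀ = !![b₀, b₁; b₂, blockB γ 1 1] *
        (!![blockA γ 0 0, a; q * blockA γ 1 0, blockA γ 1 1])ᵀ := by
      rw [ha, hb₀, hb₁, hb₂] at r6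
      have key : blockA γ 0 0 * b₂ + a * blockB γ 1 1 =
          b₀ * (q * blockA γ 1 0) + b₁ * blockA γ 1 1 :=
        mul_left_cancel₀ hqz (by linear_combination r6)
      ext i j
      fin_cases i <;> fin_cases j <;>
        simp only [Fin.zero_eta, Fin.mk_one, Fin.isValue, Matrix.mul_apply,
          Fin.sum_univ_two, Matrix.transpose_apply, Matrix.of_apply, Matrix.cons_val_zero,
          Matrix.cons_val_one]
      · ring
      · linear_combination key
      · linear_combination -key
      · ring
    have e3 : !![(q : ℤ) ^ 2 * blockC γ 0 0, q * blockC γ 0 1; q * blockC γ 1 0, blockC γ 1 1] *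
        (!![blockD γ 0 0, q * blockD γ 0 1; d, blockD γ 1 1])ᵀ =
        !![blockD γ 0 0, q * blockD γ 0 1; d, blockD γ 1 1] *
        (!![(q : ℤ) ^ 2 * blockC γ 0 0, q * blockC γ 0 1; q * blockC γ 1 0, blockC γ 1 1])ᵀ := by
      rw [hd] at r5
      ext i j
      fin_cases i <;> fin_cases j <;>
        simp only [Fin.zero_eta, Fin.mk_one, Fin.isValue, Matrix.mul_apply,
          Fin.sum_univ_two, Matrix.transpose_apply, Matrix.of_apply, Matrix.cons_val_zero,
          Matrix.cons_val_one]
      · ring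
      · linear_combination (q : ℤ) * r5
      · linear_combination -(q : ℤ) * r5
      · ring
    refine ⟨ofBlocks _ _ _ _ e1 e2 e3, ?_, (heckeDelta_mul_eq_iff hq0 _ γ).2 ?_⟩
    · intro i j
      rw [blockC_ofBlocks]
      fin_cases i <;> fin_cases j
      · exact (hγ 0 0).mul_left _
      · exact (hγ 0 1).mul_left _
      · exact (hγ 1 0).mul_left _
      · exact hγ 1 1
    · simp [ha, hb₀, hb₁, hb₂, hd]

/-- Block diagonal representatives, one for every line in the plane over the field with `q`
elements. -/
def lineElement (q : ℕ) : Option (ZMod q) → Sp2Z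
  | none => diagElement 0 1 (-1) 0 (by ring)
  | some j => diagElement 1 0 (-(j.val : ℤ)) 1 (by ring)

/-- The index set for the representatives of the Hecke operator `T₁(q²)`. -/
abbrev HeckeIndex (q : ℕ) : Type := Option (ZMod q) × ZMod (q ^ 2) × ZMod q

/-- Representatives for the Hecke operator `T₁(q²)`. -/
def heckeRep (q : ℕ) (i : HeckeIndex q) : Sp2Z :=
  translation i.2.1.val i.2.2.val 0 * lineElement q i.1

lemma lineElement_blocks (q : ℕ) (t : Option (ZMod q)) :
    blockB (lineElement q t) = 0 ∧ blockC (lineElement q t) = 0 := by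
  cases t <;> simp [lineElement, diagElement]

lemma blockA_lineElement_none : blockA (lineElement q none) = !![0, 1; -1, 0] := by
  simp [lineElement, diagElement]

lemma blockA_lineElement_some (j : ZMod q) :
    blockA (lineElement q (some j)) = !![1, (j.val : ℤ); 0, 1] := by
  simp [lineElement, diagElement]

lemma blockD_lineElement_none : blockD (lineElement q none) = !![0, 1; -1, 0] := by
  simp [lineElement, diagElement]

lemma blockD_lineElement_some (j : ZMod q) :
    blockD (lineElement q (some j)) = !![1, 0; -(j.val : ℤ), 1] := by
  simp [lineElement, diagElement]

lemma blockA_translation (y₁ y₂ y₃ : ℤ) : blockA (translation y₁ y₂ y₃) = 1 := by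
  simp [translation]

lemma blockB_translation (y₁ y₂ y₃ : ℤ) :
    blockB (translation y₁ y₂ y₃) = !![y₁, y₂; y₂, y₃] := by simp [translation]

lemma blockC_translation (y₁ y₂ y₃ : ℤ) : blockC (translation y₁ y₂ y₃) = 0 := by
  simp [translation]

lemma blockD_translation (y₁ y₂ y₃ : ℤ) : blockD (translation y₁ y₂ y₃) = 1 := by
  simp [translation]

lemma lineElement_mem_gammaInfPlus (t : Option (ZMod q)) : lineElement q t ∈ GammaInfPlus := by
  cases t with
  | none => exact diagElement_mem 0 1 (-1) 0 (by ring)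
  | some j => exact diagElement_mem 1 0 (-(j.val : ℤ)) 1 (by ring)

lemma heckeRep_mem_gammaInfPlus (i : HeckeIndex q) : heckeRep q i ∈ GammaInfPlus :=
  mul_mem (translation_mem _ _ _) (lineElement_mem_gammaInfPlus _)

lemma gammaInfPlus_le_gamma0 : GammaInfPlus ≤ Gamma0 N := by
  intro γ hγ i j
  rw [hγ.1]
  exact dvd_zero _

lemma heckeRep_mem (i : HeckeIndex q) : heckeRep q i ∈ Gamma0 N :=
  gammaInfPlus_le_gamma0 (heckeRep_mem_gammaInfPlus i)

lemma natCast_val_dvd_sub {m : ℕ} [NeZero m] {x y : ZMod m}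
    (h : (m : ℤ) ∣ (x.val : ℤ) - (y.val : ℤ)) : x = y := by
  rw [← ZMod.intCast_eq_intCast_iff_dvd_sub] at h
  simpa using h.symm

/-- The entry `A₀₁` of the quotient separates the lines. For equal lines the quotient is a
translation, and its entries `B₀₀` modulo `q²` and `B₀₁` modulo `q` separate the rest. -/
lemma heckeRep_injective [Fact q.Prime] (hqN : q ∣ N) {i i' : HeckeIndex q}
    (h : (⟨heckeRep q i' * (heckeRep q i)⁻¹, mul_mem (heckeRep_mem i') (inv_mem (heckeRep_mem i))⟩ :
      Gamma0 N) ∈ heckeSubgroup N q) : i = i' := by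
  have hpr : Prime (q : ℤ) := Nat.prime_iff_prime_int.1 Fact.out
  rw [mem_heckeSubgroup_iff hqN] at h
  obtain ⟨t, y₁, y₂⟩ := i
  obtain ⟨t', y₁', y₂'⟩ := i'
  have e : heckeRep q (t', y₁', y₂') * (heckeRep q (t, y₁, y₂))⁻¹ =
      translation y₁'.val y₂'.val 0 * (lineElement q t' * (lineElement q t)⁻¹) *
        (translation y₁.val y₂.val 0)⁻¹ := by
    simp only [heckeRep]
    group
  dsimp only at h
  rw [e] at h
  obtain ⟨h1, h2, h3⟩ := h
  have ht : t = t' := by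
    rw [blockA_mul, blockA_mul, blockA_mul, blockA_inv, blockC_inv, blockC_inv, blockA_inv,
      blockA_translation, blockC_translation, blockD_translation, blockC_mul, blockC_inv,
      (lineElement_blocks q t).2, (lineElement_blocks q t').2] at h1
    simp only [Matrix.transpose_zero, neg_zero, Matrix.mul_zero, add_zero, Matrix.one_mul,
      Matrix.transpose_one, Matrix.mul_one, Matrix.zero_mul] at h1
    cases t with
    | none =>
      cases t' with
      | none => rfl
      | some j' =>
        rw [blockA_lineElement_some, blockD_lineElement_none] at h1
        exact absurd (isUnit_of_dvd_one (by simpa [Matrix.mul_apply, Fin.sum_univ_two] using h1))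
          hpr.not_isUnit
    | some j =>
      cases t' with
      | none =>
        rw [blockA_lineElement_none, blockD_lineElement_some] at h1
        exact absurd (isUnit_of_dvd_one (by simpa [Matrix.mul_apply, Fin.sum_univ_two] using h1))
          hpr.not_isUnit
      | some j' =>
        rw [blockA_lineElement_some, blockD_lineElement_some] at h1
        simp only [Matrix.mul_apply, Fin.sum_univ_two, Matrix.transpose_apply, Matrix.of_apply,
          Matrix.cons_val_zero, Matrix.cons_val_one] at h1
        have := natCast_val_dvd_sub (x := j') (y := j) (by convert h1 using 1; ring)
        rw [this]
  subst ht
  rw [mul_inv_cancel, mul_one, blockB_mul, blockA_translation, blockB_inv, blockB_translation,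
    blockB_translation, blockD_inv, blockA_translation] at h2 h3
  have h2' : ((q ^ 2 : ℕ) : ℤ) ∣ (y₁'.val : ℤ) - y₁.val := by
    push_cast
    simpa [Matrix.mul_apply, Fin.sum_univ_two, neg_add_eq_sub] using h2
  have h3' : (q : ℤ) ∣ (y₂'.val : ℤ) - y₂.val := by
    simpa [Matrix.mul_apply, Fin.sum_univ_two, neg_add_eq_sub] using h3
  have : NeZero (q ^ 2) := ⟨pow_ne_zero 2 (Fact.out : q.Prime).ne_zero⟩
  rw [natCast_val_dvd_sub h2', natCast_val_dvd_sub h3']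

/-- The required line is determined by the ratio of the two entries of the first row of `A` modulo
`q`, with `none` for infinite ratio. -/
lemma exists_mul_lineElement_inv [Fact q.Prime] (γ : Sp2Z) :
    ∃ t, (q : ℤ) ∣ blockA (γ * (lineElement q t)⁻¹) 0 1 := by
  have e : ∀ t, blockA (γ * (lineElement q t)⁻¹) = blockA γ * (blockD (lineElement q t))ᵀ := by
    intro t
    rw [blockA_mul, blockA_inv, blockC_inv, (lineElement_blocks q t).2]
    simp
  by_cases h : (blockA γ 0 0 : ZMod q) = 0
  · refine ⟨none, ?_⟩
    rw [e, blockD_lineElement_none, ← ZMod.intCast_zmod_eq_zero_iff_dvd]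
    simp [Matrix.mul_apply, Fin.sum_univ_two, h]
  · refine ⟨some (blockA γ 0 1 / blockA γ 0 0), ?_⟩
    rw [e, blockD_lineElement_some, ← ZMod.intCast_zmod_eq_zero_iff_dvd]
    simp only [Matrix.mul_apply, Fin.sum_univ_two, Matrix.transpose_apply, Matrix.of_apply,
      Matrix.cons_val_zero, Matrix.cons_val_one]
    push_cast
    rw [ZMod.natCast_zmod_val]
    field_simp
    ring

/-- Both conditions are linear with leading coefficient `A₀₀`, a unit modulo `q` and `q²`. The value
`y₂` comes first, because the condition on `y₁` modulo `q²` involves `A₀₁ y₂`. -/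
lemma exists_mul_translation_inv [Fact q.Prime] (hqN : q ∣ N) {γ : Sp2Z} (hγ : γ ∈ Gamma0 N)
    (h : (q : ℤ) ∣ blockA γ 0 1) : ∃ (y₁ : ZMod (q ^ 2)) (y₂ : ZMod q),
      (q : ℤ) ∣ blockA (γ * (translation y₁.val y₂.val 0)⁻¹) 0 1 ∧
      (q : ℤ) ^ 2 ∣ blockB (γ * (translation y₁.val y₂.val 0)⁻¹) 0 0 ∧
      (q : ℤ) ∣ blockB (γ * (translation y₁.val y₂.val 0)⁻¹) 0 1 := by
  have hpr : Prime (q : ℤ) := Nat.prime_iff_prime_int.1 Fact.out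
  have eA : ∀ y₁ y₂, blockA (γ * (translation y₁ y₂ 0)⁻¹) = blockA γ := by
    intro y₁ y₂
    rw [blockA_mul, blockA_inv, blockC_inv, blockC_translation, blockD_translation]
    simp
  have eB : ∀ y₁ y₂, blockB (γ * (translation y₁ y₂ 0)⁻¹) =
      blockB γ - blockA γ * !![y₁, y₂; y₂, 0]ᵀ := by
    intro y₁ y₂
    rw [blockB_mul, blockB_inv, blockD_inv, blockB_translation, blockA_translation]
    simp [sub_eq_neg_add]
  obtain ⟨r1, -⟩ := row_relations γ
  obtain ⟨a, ha⟩ := h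
  obtain ⟨c₀, hc₀⟩ := blockC_dvd_of_mem hqN hγ 0 0
  obtain ⟨c₁, hc₁⟩ := blockC_dvd_of_mem hqN hγ 0 1
  have hcop : IsCoprime (blockA γ 0 0) (q : ℤ) := by
    refine ⟨blockD γ 0 0, a * blockD γ 0 1 - (blockB γ 0 0 * c₀ + blockB γ 0 1 * c₁), ?_⟩
    rw [ha, hc₀, hc₁] at r1
    linear_combination r1
  have hcop2 : IsCoprime (blockA γ 0 0) ((q : ℤ) ^ 2) := hcop.pow_right
  obtain ⟨s₁, t₁, hs₁⟩ := hcop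
  obtain ⟨s₂, t₂, hs₂⟩ := hcop2
  have : NeZero (q ^ 2) := ⟨pow_ne_zero 2 (Fact.out : q.Prime).ne_zero⟩
  obtain ⟨y₂, hy₂⟩ : ∃ y : ZMod q, (q : ℤ) ∣ y.val - s₁ * blockB γ 0 1 :=
    ⟨((s₁ * blockB γ 0 1 : ℤ) : ZMod q), by
      rw [← ZMod.intCast_eq_intCast_iff_dvd_sub]
      simp⟩
  obtain ⟨y₁, hy₁⟩ : ∃ y : ZMod (q ^ 2),
      ((q ^ 2 : ℕ) : ℤ) ∣ y.val - s₂ * (blockB γ 0 0 - blockA γ 0 1 * y₂.val) :=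
    ⟨((s₂ * (blockB γ 0 0 - blockA γ 0 1 * y₂.val) : ℤ) : ZMod (q ^ 2)), by
      rw [← ZMod.intCast_eq_intCast_iff_dvd_sub]
      simp⟩
  obtain ⟨z₁, hz₁⟩ := hy₁
  obtain ⟨z₂, hz₂⟩ := hy₂
  refine ⟨y₁, y₂, by rw [eA]; exact ⟨a, ha⟩, ?_, ?_⟩
  · rw [eB]
    simp only [Matrix.sub_apply, Matrix.mul_apply, Fin.sum_univ_two, Matrix.transpose_apply,
      Matrix.of_apply, Matrix.cons_val_zero, Matrix.cons_val_one]
    refine ⟨t₂ * (blockB γ 0 0 - blockA γ 0 1 * y₂.val) - blockA γ 0 0 * z₁, ?_⟩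
    push_cast at hz₁
    linear_combination (-blockA γ 0 0) * hz₁ - (blockB γ 0 0 - blockA γ 0 1 * y₂.val) * hs₂
  · rw [eB]
    simp only [Matrix.sub_apply, Matrix.mul_apply, Fin.sum_univ_two, Matrix.transpose_apply,
      Matrix.of_apply, Matrix.cons_val_zero, Matrix.cons_val_one]
    refine ⟨t₁ * blockB γ 0 1 - blockA γ 0 0 * z₂, ?_⟩
    linear_combination (-blockA γ 0 0) * hz₂ - (blockB γ 0 1) * hs₁

/-- The representatives of the Hecke operator, as cosets. -/
def heckeCoset (N q : ℕ) (i : HeckeIndex q) :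
    Quotient (QuotientGroup.rightRel (heckeSubgroup N q)) :=
  Quotient.mk _ ⟨heckeRep q i, heckeRep_mem i⟩

lemma heckeCoset_bijective [Fact q.Prime] (hqN : q ∣ N) :
    Function.Bijective (heckeCoset N q) := by
  constructor
  · intro i i' h
    have := QuotientGroup.rightRel_apply.1 (Quotient.exact h)
    exact heckeRep_injective hqN this
  · intro c
    induction c using Quotient.inductionOn with
    | h γ =>
      obtain ⟨t, ht⟩ := exists_mul_lineElement_inv (q := q) γ.1
      obtain ⟨y₁, y₂, hy⟩ := exists_mul_translation_inv hqN (mul_mem γ.2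
        (inv_mem (gammaInfPlus_le_gamma0 (lineElement_mem_gammaInfPlus t)))) ht
      refine ⟨(t, y₁, y₂), Quotient.sound (QuotientGroup.rightRel_apply.2 ?_)⟩
      rw [mem_heckeSubgroup_iff hqN]
      have e : (γ * (⟨heckeRep q (t, y₁, y₂), heckeRep_mem _⟩ : Gamma0 N)⁻¹).1 =
          γ.1 * (lineElement q t)⁻¹ * (translation y₁.val y₂.val 0)⁻¹ := by
        simp only [Subgroup.coe_mul, Subgroup.coe_inv, heckeRep]
        group
      rw [e]
      exact hy

end Reps

/-! ### Modularity and the Hecke operator -/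

/-- The transformation law of modular forms of level `N` and character `χ`. -/
def IsModular (k : ℕ) {N : ℕ} (χ : DirichletCharacter ℂ N)
    (f : Matrix (Fin 2) (Fin 2) ℂ → ℂ) : Prop :=
  ∀ γ ∈ Gamma0 N, ∀ τ, (plucker γ).eval τ ≠ 0 →
    slash k f (toReal γ) τ = χ ((blockD γ).det : ℤ) * f τ

/-- Reindexing the sum by the permutation `v ↦ v.act γ` matches the cocycle relation with the
transformation law of the weight. -/
theorem eisenstein_isModular {N S₀ S₁ S₂ : ℕ} (hN : Squarefree N) (hS : S₀ * S₁ * S₂ = N)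
    {χ : DirichletCharacter ℂ N} (hχ : ∀ p, p.Prime → p ∣ S₁ → component χ p ^ 2 = 1) (k : ℕ) :
    IsModular k χ (eisenstein k χ S₀ S₁ S₂) := by
  intro γ hγ τ hτ
  have : NeZero N := ⟨hN.ne_zero⟩
  rw [slash_toReal, eisenstein_eq_tsum hN hS hχ, eisenstein_eq_tsum hN hS hχ, mul_left_comm,
    mul_left_comm (χ _)]
  congr 1
  rw [← tsum_mul_left, ← tsum_mul_left, ← (cuspEquiv γ).tsum_eq
    (fun v : Cusp => χ ((blockD γ).det : ℤ) * (weight χ S₀ S₁ v.1 * (v.1.eval τ ^ k)⁻¹))]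
  refine tsum_congr fun v => ?_
  have hact : ((cuspEquiv γ v).1) = v.1.act γ := rfl
  rw [hact, eval_act v.2 γ hτ, weight_act hN hχ hγ v.2, mul_pow, mul_inv]
  linear_combination (-weight χ S₀ S₁ v.1 * (v.1.eval (moebius γ τ) ^ k)⁻¹ *
    ((plucker γ).eval τ ^ k)⁻¹) * apply_det_mul_conj χ hγ

lemma det_blockD_mul_cast {N : ℕ} [NeZero N] {h : Sp2Z} (hh : h ∈ Gamma0 N) (γ : Sp2Z) :
    (((blockD (h * γ)).det : ℤ) : ZMod N) = ((blockD h).det : ℤ) * ((blockD γ).det : ℤ) := by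
  rw [blockD_mul, Matrix.det_fin_two, Matrix.det_fin_two, Matrix.det_fin_two]
  simp only [Matrix.add_apply, Matrix.mul_apply, Fin.sum_univ_two]
  push_cast [blockC_cast_eq_zero hh]
  ring

lemma eval_contract {q : ℕ} (hq : q ≠ 0) (v : PVec) (τ : Matrix (Fin 2) (Fin 2) ℂ) :
    (⟨q ^ 2 * v.a, q * v.b, q ^ 2 * v.c, v.d, v.e⟩ : PVec).eval (contract q τ) = v.eval τ := by
  have hq' : (q : ℂ) ≠ 0 := Nat.cast_ne_zero.2 hq
  simp only [PVec.eval, contract, Matrix.det_fin_two, Matrix.of_apply, Matrix.cons_val_zero,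
    Matrix.cons_val_one]
  push_cast
  field_simp

lemma plucker_of_heckeDelta {q : ℕ} (hq : q ≠ 0) {g h : Sp2Z}
    (e : heckeDelta q * toReal g = toReal h * heckeDelta q) :
    plucker g = ⟨q ^ 2 * (plucker h).a, q * (plucker h).b, q ^ 2 * (plucker h).c,
      (plucker h).d, (plucker h).e⟩ := by
  obtain ⟨-, -, ⟨h1, h2, h3, h4⟩, ⟨h5, h6, h7, h8⟩⟩ := (heckeDelta_mul_eq_iff hq g h).1 e
  ext <;> simp only [plucker, h1, h2, h3, h4, h5, h6, h8, ← h7] <;> ring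

lemma slash_heckeDelta_inv_mul {q : ℕ} (hq : q ≠ 0) (k : ℕ) (f : Matrix (Fin 2) (Fin 2) ℂ → ℂ)
    (γ : Sp2Z) {τ : Matrix (Fin 2) (Fin 2) ℂ} (hτ : (plucker γ).eval τ ≠ 0) :
    slash k f ((heckeDelta q)⁻¹ * toReal γ) τ = ((plucker γ).eval τ ^ k)⁻¹ *
      (((q : ℂ) ^ k)⁻¹ * f (contract q (moebius γ τ))) := by
  rw [slash_mul k f (det_heckeDelta_inv hq) (det_toReal γ)
    (by rw [toReal_denominator]; exact hτ), slash_toReal, slash_heckeDelta_inv hq]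

lemma heckeDelta_inv_denominator {q : ℕ} (hq : q ≠ 0) (γ : Sp2Z)
    (τ : Matrix (Fin 2) (Fin 2) ℂ) :
    (((heckeDelta q)⁻¹ * toReal γ).toBlocks₂₁.map Complex.ofReal * τ +
      ((heckeDelta q)⁻¹ * toReal γ).toBlocks₂₂.map Complex.ofReal).det =
      q * (plucker γ).eval τ := by
  have hmul : ∀ X Y : Matrix (Fin 2) (Fin 2) ℝ, (X * Y).map Complex.ofReal =
      X.map Complex.ofReal * Y.map Complex.ofReal := fun X Y =>
    Matrix.map_mul (f := Complex.ofRealHom)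
  have h1 : (!![(q : ℝ), 0; 0, 1] : Matrix (Fin 2) (Fin 2) ℝ).map Complex.ofReal =
      !![(q : ℂ), 0; 0, 1] := by
    ext i j; fin_cases i <;> fin_cases j <;> simp
  rw [heckeDelta_inv hq, toReal_eq_fromBlocks, Matrix.fromBlocks_multiply,
    Matrix.toBlocks_fromBlocks₂₁, Matrix.toBlocks_fromBlocks₂₂, Matrix.zero_mul, zero_add,
    Matrix.zero_mul, zero_add, hmul, hmul, mul_assoc, ← mul_add, Matrix.det_mul, h1,
    map_intCast_ofReal, map_intCast_ofReal, ← eval_plucker, Matrix.det_fin_two_of]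
  ring

/-- The Hecke summand depends only on the coset: `δ₁⁻¹ h = g δ₁⁻¹` with `g` in `Γ₀(N)` and `det D_g
= det D_h`, so the character from modularity under `g` cancels the conjugate character of `h`. -/
lemma slash_heckeSubgroup_mul {k N q : ℕ} [NeZero N] (hq : q ≠ 0) {χ : DirichletCharacter ℂ N}
    {f : Matrix (Fin 2) (Fin 2) ℂ → ℂ} (hf : IsModular k χ f) {h : Gamma0 N}
    (hh : h ∈ heckeSubgroup N q) (γ : Sp2Z) {τ : Matrix (Fin 2) (Fin 2) ℂ}
    (hτ : τ ∈ upperHalfSpace) :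
    (starRingEnd ℂ) (χ ((blockD (h.1 * γ)).det : ℤ)) *
        slash k f ((heckeDelta q)⁻¹ * toReal (h.1 * γ)) τ =
      (starRingEnd ℂ) (χ ((blockD γ).det : ℤ)) * slash k f ((heckeDelta q)⁻¹ * toReal γ) τ := by
  obtain ⟨g, hg, hgh⟩ := hh
  have hγ : (plucker γ).eval τ ≠ 0 := eval_ne_zero (plucker_isCusp γ) hτ
  have hq' : (q : ℂ) ≠ 0 := Nat.cast_ne_zero.2 hq
  have hunit : IsUnit (heckeDelta q).det := by rw [det_heckeDelta hq]; exact isUnit_one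
  have e1 : (heckeDelta q)⁻¹ * toReal (h.1 * γ) = toReal g * ((heckeDelta q)⁻¹ * toReal γ) := by
    calc (heckeDelta q)⁻¹ * toReal (h.1 * γ)
        = (heckeDelta q)⁻¹ * (toReal h.1 * heckeDelta q) * (heckeDelta q)⁻¹ * toReal γ := by
          rw [toReal_mul]
          simp only [mul_assoc]
          rw [← mul_assoc (heckeDelta q) (heckeDelta q)⁻¹, Matrix.mul_nonsing_inv _ hunit, one_mul]
      _ = _ := by
          rw [← hgh, ← mul_assoc, Matrix.nonsing_inv_mul _ hunit, one_mul, mul_assoc]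
  have hdet : (blockD g).det = (blockD h.1).det := by
    have := congrArg PVec.e (plucker_of_heckeDelta hq hgh)
    simpa only [Matrix.det_fin_two, plucker] using this
  have hne : (plucker g).eval (contract q (moebius γ τ)) ≠ 0 := by
    rw [plucker_of_heckeDelta hq hgh, eval_contract hq]
    intro h0
    apply eval_ne_zero (plucker_isCusp (h.1 * γ)) hτ
    rw [plucker_mul, eval_act (plucker_isCusp _) γ hγ, h0, zero_mul]
  rw [e1, slash_mul k f (det_toReal g)
    (by rw [Matrix.det_mul, det_heckeDelta_inv hq, det_toReal, one_mul])
    (by rw [heckeDelta_inv_denominator hq]; exact mul_ne_zero hq' hγ),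
    slash_heckeDelta_inv_mul hq k _ γ hγ, slash_heckeDelta_inv_mul hq k _ γ hγ,
    hf g hg _ hne, hdet, det_blockD_mul_cast h.2, map_mul, map_mul]
  linear_combination ((starRingEnd ℂ) (χ ((blockD γ).det : ℤ)) * (((plucker γ).eval τ ^ k)⁻¹ *
    (((q : ℂ) ^ k)⁻¹ * f (contract q (moebius γ τ))))) * apply_det_mul_conj χ h.2

/-- The Hecke operator in terms of the explicit representatives. -/
theorem heckeT1_eq_sum {k N q : ℕ} [NeZero N] [Fact q.Prime] (hqN : q ∣ N)
    {χ : DirichletCharacter ℂ N} {f : Matrix (Fin 2) (Fin 2) ℂ → ℂ} (hf : IsModular k χ f)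
    {τ : Matrix (Fin 2) (Fin 2) ℂ} (hτ : τ ∈ upperHalfSpace) [Fintype (HeckeIndex q)] :
    heckeT1 k χ q f τ = (q : ℂ) ^ ((k : ℤ) - 3) * ∑ i : HeckeIndex q,
      (((plucker (heckeRep q i)).eval τ) ^ k)⁻¹ *
        (((q : ℂ) ^ k)⁻¹ * f (contract q (moebius (heckeRep q i) τ))) := by
  have hq : q ≠ 0 := (Fact.out : q.Prime).ne_zero
  rw [heckeT1, ← finsum_eq_sum_of_fintype]
  congr 1
  symm
  refine finsum_eq_of_bijective _ (heckeCoset_bijective hqN) fun i => ?_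
  have hrel := Quotient.mk_out (s := QuotientGroup.rightRel (heckeSubgroup N q))
    (⟨heckeRep q i, heckeRep_mem i⟩ : Gamma0 N)
  -- The chosen element `out` of the coset differs from the explicit representative by an element of
  -- the Hecke subgroup; the representative itself has `det D = 1`, so its character factor is
  -- trivial.
  have hmem := inv_mem (QuotientGroup.rightRel_apply.1 hrel)
  rw [_root_.mul_inv_rev, inv_inv] at hmem
  have h := slash_heckeSubgroup_mul hq hf hmem (heckeRep q i) hτ
  rw [Subgroup.coe_mul, Subgroup.coe_inv, inv_mul_cancel_right, (heckeRep_mem_gammaInfPlus i).2,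
    Int.cast_one, map_one, map_one, one_mul,
    slash_heckeDelta_inv_mul hq k f (heckeRep q i) (eval_ne_zero (plucker_isCusp _) hτ)] at h
  exact h.symm

/-! ### Contraction of series over primitive isotropic vectors -/

/-- The vector whose value at `contract q τ` is proportional to the value of `u` at `τ`. -/
def PVec.expand (q : ℕ) (u : PVec) : PVec :=
  -- Evaluation at `contract q τ` divides `a`, `c` by `q²` and `b` by `q`. If `v.c` is not divisible
  -- by `q²`, one multiplies by `q` to restore integrality, so that `u.d` and `u.e` become multiples
  -- of `q`; this is the first branch.
  if (q : ℤ) ∣ u.e then ⟨q * u.a, u.b, q * u.c, u.d / q, u.e / q⟩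
  else ⟨q ^ 2 * u.a, q * u.b, q ^ 2 * u.c, u.d, u.e⟩

/-- The coefficients of the contraction by `q` of a series over primitive isotropic vectors
with coefficients `w`. -/
def contractWeight (q k : ℕ) (w : PVec → ℂ) (u : PVec) : ℂ :=
  if (q : ℤ) ∣ u.e then if (q : ℤ) ∣ u.d then w (u.expand q) else 0
  else ((q : ℂ) ^ k)⁻¹ * w (u.expand q)

section Contraction

variable {q : ℕ} [Fact q.Prime] {k : ℕ} {w : PVec → ℂ}

lemma contractWeight_mul {u : PVec} (h : (q : ℤ) ∣ u.e → (q : ℤ) ∣ u.d)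
    (τ : Matrix (Fin 2) (Fin 2) ℂ) :
    contractWeight q k w u * (u.eval τ ^ k)⁻¹ = ((q : ℂ) ^ k)⁻¹ *
      (w (u.expand q) * ((u.expand q).eval (contract q τ) ^ k)⁻¹) := by
  have hq : q ≠ 0 := (Fact.out : q.Prime).ne_zero
  have hq' : (q : ℂ) ≠ 0 := Nat.cast_ne_zero.2 hq
  by_cases he : (q : ℤ) ∣ u.e
  · have hd := h he
    have hev : u.eval τ = q * (u.expand q).eval (contract q τ) := by
      obtain ⟨a, b, c, d, e⟩ := u
      obtain ⟨d', rfl⟩ := hd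
      obtain ⟨e', rfl⟩ := he
      have hqz : (q : ℤ) ≠ 0 := by exact_mod_cast hq
      simp only [PVec.expand, if_pos (Dvd.intro _ rfl), Int.mul_ediv_cancel_left _ hqz, PVec.eval,
        contract, Matrix.det_fin_two, Matrix.of_apply, Matrix.cons_val_zero, Matrix.cons_val_one]
      push_cast
      field_simp
    rw [contractWeight, if_pos he, if_pos hd, hev, mul_pow, mul_inv]
    ring
  · rw [contractWeight, if_neg he, PVec.expand, if_neg he, eval_contract hq]
    ring

lemma not_dvd_of_dvd_ne {p : ℕ} (hp : p.Prime) {x y : ℤ} (h : (p : ℤ) ∣ y)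
    (hx : (p : ℤ) ∣ q * x) (hy : ¬(q : ℤ) ∣ y) : (p : ℤ) ∣ x := by
  refine ((Nat.prime_iff_prime_int.1 hp).dvd_or_dvd hx).resolve_left fun h1 => hy ?_
  rwa [← (Nat.prime_dvd_prime_iff_eq hp (Fact.out : q.Prime)).1 (Int.natCast_dvd_natCast.1 h1)]

lemma expand_isCusp {u : PVec} (hu : u.IsCusp) (h : (q : ℤ) ∣ u.e → (q : ℤ) ∣ u.d)
    (he : ¬(q : ℤ) ∣ (u.expand q).e) : (u.expand q).IsCusp := by
  have hq : q ≠ 0 := (Fact.out : q.Prime).ne_zero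
  have hqz : (q : ℤ) ≠ 0 := by exact_mod_cast hq
  obtain ⟨a, b, c, d, e⟩ := u
  have hi := hu.isotropic
  by_cases hqe : (q : ℤ) ∣ e
  · obtain ⟨d', rfl⟩ := h hqe
    obtain ⟨e', rfl⟩ := hqe
    simp only [PVec.expand, if_pos (Dvd.intro _ rfl), Int.mul_ediv_cancel_left _ hqz] at he hi ⊢
    refine ⟨by linear_combination hi, fun p hp ⟨h1, h2, h3, h4, h5⟩ => ?_⟩
    exact hu.primitive p hp ⟨not_dvd_of_dvd_ne hp h5 h1 he, h2, not_dvd_of_dvd_ne hp h5 h3 he,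
      h4.mul_left _, h5.mul_left _⟩
  · simp only [PVec.expand, if_neg hqe] at he hi ⊢
    refine ⟨by linear_combination (q : ℤ) ^ 2 * hi, fun p hp ⟨h1, h2, h3, h4, h5⟩ => ?_⟩
    simp only [sq, mul_assoc] at h1 h3
    exact hu.primitive p hp ⟨not_dvd_of_dvd_ne hp h5 (not_dvd_of_dvd_ne hp h5 h1 he) he,
      not_dvd_of_dvd_ne hp h5 h2 he,
      not_dvd_of_dvd_ne hp h5 (not_dvd_of_dvd_ne hp h5 h3 he) he, h4, h5⟩

/-- Equality of vectors from the two branches would make all coordinates of `u'` divisible by `q`.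
-/
lemma expand_ne {u u' : PVec} (hu' : u'.IsCusp) (hd' : (q : ℤ) ∣ u'.d)
    (he : ¬(q : ℤ) ∣ u.e) (he' : (q : ℤ) ∣ u'.e) : u.expand q ≠ u'.expand q := by
  have hqz : (q : ℤ) ≠ 0 := by exact_mod_cast (Fact.out : q.Prime).ne_zero
  intro heq
  obtain ⟨a', b', c', d', e'⟩ := u'
  obtain ⟨d'', rfl⟩ := hd'
  obtain ⟨e'', rfl⟩ := he'
  rw [PVec.expand, PVec.expand, if_neg he, if_pos (Dvd.intro _ rfl), PVec.mk.injEq] at heq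
  obtain ⟨h1, h2, h3, -, -⟩ := heq
  refine hu'.primitive q Fact.out ⟨⟨u.a, mul_left_cancel₀ hqz ?_⟩, ⟨u.b, h2.symm⟩,
    ⟨u.c, mul_left_cancel₀ hqz ?_⟩, Dvd.intro _ rfl, Dvd.intro _ rfl⟩
  · linear_combination -h1
  · linear_combination -h3

lemma expand_injective {u u' : PVec} (hu : u.IsCusp) (hu' : u'.IsCusp)
    (hd : (q : ℤ) ∣ u.e → (q : ℤ) ∣ u.d) (hd' : (q : ℤ) ∣ u'.e → (q : ℤ) ∣ u'.d)
    (h : u.expand q = u'.expand q) : u = u' := by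
  have hqz : (q : ℤ) ≠ 0 := by exact_mod_cast (Fact.out : q.Prime).ne_zero
  by_cases he : (q : ℤ) ∣ u.e <;> by_cases he' : (q : ℤ) ∣ u'.e
  · have h1 := hd he
    have h2 := hd' he'
    rw [PVec.expand, PVec.expand, if_pos he, if_pos he', PVec.mk.injEq] at h
    exact PVec.ext (mul_left_cancel₀ hqz h.1) h.2.1 (mul_left_cancel₀ hqz h.2.2.1)
      (Int.ediv_left_inj h1 h2 |>.1 h.2.2.2.1) (Int.ediv_left_inj he he' |>.1 h.2.2.2.2)
  · exact absurd h.symm (expand_ne hu (hd he) he' he)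
  · exact absurd h (expand_ne hu' (hd' he') he he')
  · rw [PVec.expand, PVec.expand, if_neg he, if_neg he', PVec.mk.injEq] at h
    exact PVec.ext (mul_left_cancel₀ (pow_ne_zero 2 hqz) h.1) (mul_left_cancel₀ hqz h.2.1)
      (mul_left_cancel₀ (pow_ne_zero 2 hqz) h.2.2.1) h.2.2.2.1 h.2.2.2.2

/-- Isotropy gives `q² ∣ a e`, hence `q² ∣ a` because `q ∤ e`. The branch is then decided by whether
`q²` divides `c`. -/
lemma exists_expand_eq {v : PVec} (hv : v.IsCusp) (ha : (q : ℤ) ∣ v.a) (hb : (q : ℤ) ∣ v.b)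
    (hc : (q : ℤ) ∣ v.c) (hd : (q : ℤ) ∣ v.d) (he : ¬(q : ℤ) ∣ v.e) :
    ∃ u : PVec, u.IsCusp ∧ ((q : ℤ) ∣ u.e → (q : ℤ) ∣ u.d) ∧ u.expand q = v := by
  have hpr : Prime (q : ℤ) := Nat.prime_iff_prime_int.1 Fact.out
  have hqz := hpr.ne_zero
  obtain ⟨a, b, c, d, e⟩ := v
  obtain ⟨A, rfl⟩ := ha
  obtain ⟨b, rfl⟩ := hb
  obtain ⟨c, rfl⟩ := hc
  obtain ⟨d, rfl⟩ := hd
  simp only at he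
  have hi := hv.isotropic
  simp only at hi
  have h1 : (q : ℤ) ∣ A * e := ⟨-(b ^ 2 + c * d), mul_left_cancel₀ hqz (by linear_combination hi)⟩
  obtain ⟨a, rfl⟩ := (hpr.dvd_or_dvd h1).resolve_right he
  have h2 : a * e + b ^ 2 + c * d = 0 :=
    (mul_eq_zero.1 (by linear_combination hi : (q : ℤ) ^ 2 * _ = 0)).resolve_left
      (pow_ne_zero 2 hqz)
  by_cases hc : (q : ℤ) ∣ c
  · obtain ⟨c, rfl⟩ := hc
    refine ⟨⟨a, b, c, q * d, e⟩, ⟨by linear_combination h2, fun p hp ⟨g1, g2, g3, g4, g5⟩ =>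
      hv.primitive p hp ⟨(g1.mul_left _).mul_left _, g2.mul_left _, (g3.mul_left _).mul_left _,
        g4, g5⟩⟩, fun h => absurd h he, ?_⟩
    rw [PVec.expand, if_neg he]
    ext <;> simp only <;> ring
  · refine ⟨⟨q * a, q * b, c, q ^ 2 * d, q * e⟩, ⟨by linear_combination (q : ℤ) ^ 2 * h2,
      fun p hp ⟨g1, g2, g3, g4, g5⟩ => hv.primitive p hp ⟨g1.mul_left _, g2, g3.mul_left _,
        (not_dvd_of_dvd_ne hp g3 (by rwa [sq, mul_assoc] at g4) hc),
        not_dvd_of_dvd_ne hp g3 g5 hc⟩⟩,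
      fun _ => ⟨q * d, by ring⟩, ?_⟩
    have e1 : (q : ℤ) ^ 2 * d = q * (q * d) := by ring
    rw [PVec.expand, if_pos (Dvd.intro _ rfl)]
    simp only [e1, Int.mul_ediv_cancel_left _ hqz]

/-- The map `expand` is a bijection between the supports of the two series. No convergence is
needed. -/
theorem tsum_contract (hw : ∀ v : PVec, w v ≠ 0 → (q : ℤ) ∣ v.a ∧ (q : ℤ) ∣ v.b ∧ (q : ℤ) ∣ v.c ∧
    (q : ℤ) ∣ v.d ∧ ¬(q : ℤ) ∣ v.e) (τ : Matrix (Fin 2) (Fin 2) ℂ) :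
    ((q : ℂ) ^ k)⁻¹ * ∑' v : Cusp, w v.1 * (v.1.eval (contract q τ) ^ k)⁻¹ =
      ∑' u : Cusp, contractWeight q k w u.1 * (u.1.eval τ ^ k)⁻¹ := by
  rw [← tsum_mul_left]
  have hsupp : ∀ u : Function.support
      (fun u : Cusp => contractWeight q k w u.1 * (u.1.eval τ ^ k)⁻¹),
      ((q : ℤ) ∣ u.1.1.e → (q : ℤ) ∣ u.1.1.d) ∧ w (u.1.1.expand q) ≠ 0 := by
    rintro ⟨u, hu⟩
    have h1 := left_ne_zero_of_mul (Function.mem_support.1 hu)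
    unfold contractWeight at h1
    split_ifs at h1 with g1 g2
    · exact ⟨fun _ => g2, h1⟩
    · exact absurd rfl h1
    · exact ⟨fun h => absurd h g1, right_ne_zero_of_mul h1⟩
  refine tsum_eq_tsum_of_ne_zero_bij (fun u => ⟨u.1.1.expand q, expand_isCusp u.1.2 (hsupp u).1
    (hw _ (hsupp u).2).2.2.2.2⟩) ?_ ?_ ?_
  · intro u u' h
    exact Subtype.ext (Subtype.ext (expand_injective u.1.2 u'.1.2 (hsupp u).1 (hsupp u').1
      (congrArg Subtype.val h)))
  · intro v hv
    have h1 := right_ne_zero_of_mul (Function.mem_support.1 hv)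
    obtain ⟨g1, g2, g3, g4, g5⟩ := hw _ (left_ne_zero_of_mul h1)
    obtain ⟨u, hu, hd, huv⟩ := exists_expand_eq v.2 g1 g2 g3 g4 g5
    refine ⟨⟨⟨u, hu⟩, ?_⟩, Subtype.ext huv⟩
    rw [Function.mem_support, contractWeight_mul hd, huv]
    exact hv
  · intro u
    exact (contractWeight_mul (hsupp u).1 τ).symm

end Contraction

/-! ### The Hecke operator on coefficients -/

section Bounds

lemma norm_weight₀_le (p : ℕ) (ψ : DirichletCharacter ℂ p) (v : PVec) : ‖weight₀ p ψ v‖ ≤ 1 := by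
  unfold weight₀
  split_ifs
  · rw [RCLike.norm_conj]; exact ψ.norm_le_one _
  · simp

lemma norm_weight₁_le (p : ℕ) (ψ : DirichletCharacter ℂ p) (v : PVec) : ‖weight₁ p ψ v‖ ≤ 1 := by
  unfold weight₁
  split_ifs
  · exact ψ.norm_le_one _
  · exact ψ.norm_le_one _
  · simp

lemma norm_localWeight_le (S₀ S₁ p : ℕ) (ψ : DirichletCharacter ℂ p) (v : PVec) :
    ‖localWeight S₀ S₁ p ψ v‖ ≤ 1 := by
  unfold localWeight
  split_ifs
  · exact norm_weight₀_le _ _ _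
  · exact norm_weight₁_le _ _ _
  · exact ψ.norm_le_one _

lemma norm_weight_le {N : ℕ} (χ : DirichletCharacter ℂ N) (S₀ S₁ : ℕ) (v : PVec) :
    ‖weight χ S₀ S₁ v‖ ≤ 1 := by
  rw [weight, norm_prod]
  exact Finset.prod_le_one (fun p _ => norm_nonneg _) fun p _ => norm_localWeight_le S₀ S₁ p _ v

lemma norm_contractWeight_le {q : ℕ} [Fact q.Prime] (k : ℕ) {w : PVec → ℂ} (hw : ∀ v, ‖w v‖ ≤ 1)
    (u : PVec) : ‖contractWeight q k w u‖ ≤ 1 := by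
  have hq : (1 : ℝ) ≤ q := by exact_mod_cast (Fact.out : q.Prime).one_lt.le
  unfold contractWeight
  split_ifs
  · exact hw _
  · simp
  · rw [norm_mul, norm_inv, norm_pow, Complex.norm_natCast]
    exact mul_le_one₀ (inv_le_one_of_one_le₀ (one_le_pow₀ hq)) (norm_nonneg _) (hw _)

lemma summable_mul_inv_eval_pow {τ : Matrix (Fin 2) (Fin 2) ℂ} (hτ : τ ∈ upperHalfSpace) {k : ℕ}
    (hk : 4 ≤ k) {g : Cusp → ℂ} (hg : ∀ v, ‖g v‖ ≤ 1) :
    Summable fun v : Cusp => g v * (v.1.eval τ ^ k)⁻¹ := by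
  refine Summable.of_norm_bounded (summable_inv_norm_eval_pow hτ hk) fun v => ?_
  rw [norm_mul, norm_inv, norm_pow]
  exact mul_le_of_le_one_left (by positivity) (hg v)

end Bounds

lemma tsum_contract_moebius {q : ℕ} [Fact q.Prime] {k : ℕ} {w : PVec → ℂ}
    (hw : ∀ v : PVec, w v ≠ 0 → (q : ℤ) ∣ v.a ∧ (q : ℤ) ∣ v.b ∧ (q : ℤ) ∣ v.c ∧
      (q : ℤ) ∣ v.d ∧ ¬(q : ℤ) ∣ v.e) (γ : Sp2Z) {τ : Matrix (Fin 2) (Fin 2) ℂ}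
    (hγ : (plucker γ).eval τ ≠ 0) :
    ((plucker γ).eval τ ^ k)⁻¹ * (((q : ℂ) ^ k)⁻¹ *
      ∑' v : Cusp, w v.1 * (v.1.eval (contract q (moebius γ τ)) ^ k)⁻¹) =
      ∑' v : Cusp, contractWeight q k w (v.1.act γ⁻¹) * (v.1.eval τ ^ k)⁻¹ := by
  rw [tsum_contract hw, ← tsum_mul_left, ← (cuspEquiv γ).tsum_eq
    (fun v : Cusp => contractWeight q k w (v.1.act γ⁻¹) * (v.1.eval τ ^ k)⁻¹)]
  refine tsum_congr fun u => ?_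
  have hact : ((cuspEquiv γ u).1) = u.1.act γ := rfl
  rw [hact, PVec.act_act_inv u.2, eval_act u.2 γ hγ, mul_pow, mul_inv]
  ring

/-! ### Splitting the weight into its factor at `q` and its factors at the other primes. -/

section Level

variable {N N₀ N₁ N₂ q : ℕ}

/-- The product of the local weights away from `q`. -/
def weightAway (q : ℕ) (χ : DirichletCharacter ℂ N) (S₀ S₁ : ℕ) (v : PVec) : ℂ :=
  ∏ p ∈ N.primeFactors.erase q, localWeight S₀ S₁ p (component χ p) v

lemma norm_weightAway_le (χ : DirichletCharacter ℂ N) (S₀ S₁ : ℕ) (v : PVec) :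
    ‖weightAway q χ S₀ S₁ v‖ ≤ 1 := by
  rw [weightAway, norm_prod]
  exact Finset.prod_le_one (fun p _ => norm_nonneg _) fun p _ => norm_localWeight_le S₀ S₁ p _ v

lemma localWeight_mul_weightAway (χ : DirichletCharacter ℂ N) (hqN : q ∈ N.primeFactors)
    (S₀ S₁ : ℕ) (v : PVec) :
    weight χ S₀ S₁ v = localWeight S₀ S₁ q (component χ q) v * weightAway q χ S₀ S₁ v :=
  (Finset.mul_prod_erase _ _ hqN).symm

lemma weight_eq_weight₀ (χ : DirichletCharacter ℂ N) (hqN : q ∈ N.primeFactors) (hq : q ∣ N₀)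
    (N₁ : ℕ) (v : PVec) :
    weight χ N₀ N₁ v = weight₀ q (component χ q) v * weightAway q χ N₀ N₁ v := by
  rw [localWeight_mul_weightAway χ hqN, localWeight, if_pos hq]

lemma weightAway_act {χ : DirichletCharacter ℂ N}
    (hχ : ∀ p, p.Prime → p ∣ N₁ → component χ p ^ 2 = 1) {γ : Sp2Z} (hγ : γ ∈ GammaInfPlus)
    {v : PVec} (hv : v.IsCusp) : weightAway q χ N₀ N₁ (v.act γ) = weightAway q χ N₀ N₁ v := by
  refine Finset.prod_congr rfl fun p hp => ?_
  have hpp := Nat.prime_of_mem_primeFactors (Finset.mem_of_mem_erase hp)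
  have : Fact p.Prime := ⟨hpp⟩
  rw [localWeight_act (hχ p hpp) (fun i j => by rw [hγ.1]; exact dvd_zero _) hv, hγ.2,
    Int.cast_one, map_one, map_one, one_mul]

/-- In the branch `q ∤ e` the coordinates `d`, `e` are kept and `a`, `c` are multiplied by `q²`. The
factor is invisible at rank zero, trivial for a quadratic character at rank one, and `ψ(q²)` at rank
two. -/
lemma localWeight_expand₁ {S₀ S₁ p : ℕ} [Fact p.Prime] {ψ : DirichletCharacter ℂ p}
    (hψ : p ∣ S₁ → ψ ^ 2 = 1) (hpq : (q : ZMod p) ≠ 0) {u : PVec} (he : ¬(q : ℤ) ∣ u.e) :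
    localWeight S₀ S₁ p ψ (u.expand q) =
      (if p ∣ S₀ ∨ p ∣ S₁ then 1 else ψ ((q : ZMod p) ^ 2)) * localWeight S₀ S₁ p ψ u := by
  rw [PVec.expand, if_neg he]
  unfold localWeight
  by_cases h0 : p ∣ S₀
  · simp [h0, weight₀, hpq]
  by_cases h1 : p ∣ S₁
  · have h2 : ψ ((q : ZMod p) ^ 2) = 1 := by
      rw [sq, map_mul, apply_mul_self_of_sq (hψ h1) hpq]
    simp [h0, h1, weight₁, hpq, h2]
  · simp [h0, h1, weight₂]

variable [Fact q.Prime]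

lemma mem_primeFactors_of_dvd (hN : Squarefree N) (hρ : N₀ * N₁ * N₂ = N) (hq : q ∣ N₀) :
    q ∈ N.primeFactors :=
  Nat.mem_primeFactors.2 ⟨Fact.out, hρ ▸ (hq.mul_right N₁).mul_right N₂, hN.ne_zero⟩

lemma dvd_of_weight_ne_zero {χ : DirichletCharacter ℂ N} (hqN : q ∈ N.primeFactors) (hq : q ∣ N₀)
    {v : PVec} (h : weight χ N₀ N₁ v ≠ 0) : (q : ℤ) ∣ v.a ∧ (q : ℤ) ∣ v.b ∧ (q : ℤ) ∣ v.c ∧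
      (q : ℤ) ∣ v.d ∧ ¬(q : ℤ) ∣ v.e := by
  have h1 := Finset.prod_ne_zero_iff.1 h q hqN
  rw [localWeight, if_pos hq, weight₀] at h1
  split_ifs at h1 with h2
  · simp only [ZMod.intCast_zmod_eq_zero_iff_dvd] at h2
    refine ⟨h2.1, h2.2.1, h2.2.2.1, h2.2.2.2, fun h3 => h1 ?_⟩
    rw [(ZMod.intCast_zmod_eq_zero_iff_dvd _ q).2 h3, MulChar.map_zero, map_zero]
  · exact absurd rfl h1

/-- Absolute convergence allows the finite sum over representatives to be moved inside, so the Hecke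
operator acts on the coefficients. -/
theorem heckeT1_eisenstein [Fintype (HeckeIndex q)] (hN : Squarefree N) (hρ : N₀ * N₁ * N₂ = N)
    {χ : DirichletCharacter ℂ N} (hχ : ∀ p, p.Prime → p ∣ N₁ → component χ p ^ 2 = 1)
    (hq : q ∣ N₀) {k : ℕ} (hk : 4 ≤ k) {τ : Matrix (Fin 2) (Fin 2) ℂ} (hτ : τ ∈ upperHalfSpace) :
    heckeT1 k χ q (eisenstein k χ N₀ N₁ N₂) τ = (1 / 2 : ℂ) * ∑' v : Cusp,
      ((q : ℂ) ^ ((k : ℤ) - 3) * ∑ i : HeckeIndex q,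
        contractWeight q k (weight χ N₀ N₁) (v.1.act (heckeRep q i)⁻¹)) * (v.1.eval τ ^ k)⁻¹ := by
  have hqN := mem_primeFactors_of_dvd hN hρ hq
  have : NeZero N := ⟨hN.ne_zero⟩
  rw [heckeT1_eq_sum (Nat.dvd_of_mem_primeFactors hqN) (eisenstein_isModular hN hρ hχ k) hτ]
  have h1 : ∀ i : HeckeIndex q, ((plucker (heckeRep q i)).eval τ ^ k)⁻¹ * (((q : ℂ) ^ k)⁻¹ *
      eisenstein k χ N₀ N₁ N₂ (contract q (moebius (heckeRep q i) τ))) =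
      (1 / 2 : ℂ) * ∑' v : Cusp, contractWeight q k (weight χ N₀ N₁) (v.1.act (heckeRep q i)⁻¹) *
        (v.1.eval τ ^ k)⁻¹ := by
    intro i
    rw [eisenstein_eq_tsum hN hρ hχ, ← tsum_contract_moebius
      (fun v => dvd_of_weight_ne_zero hqN hq) _ (eval_ne_zero (plucker_isCusp _) hτ)]
    ring
  rw [Finset.sum_congr rfl fun i _ => h1 i, ← Finset.mul_sum, ← Summable.tsum_finsetSum,
    mul_left_comm, ← tsum_mul_left]
  · congr 1
    refine tsum_congr fun v => ?_
    rw [← Finset.sum_mul, mul_assoc]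
  · exact fun i _ => summable_mul_inv_eval_pow hτ hk fun v =>
      norm_contractWeight_le k (norm_weight_le χ N₀ N₁) _

lemma not_dvd_div (hN : Squarefree N) (hρ : N₀ * N₁ * N₂ = N) (hq : q ∣ N₀) : ¬q ∣ N₀ / q := by
  have h0 : Squarefree N₀ := hN.squarefree_of_dvd (hρ ▸ (dvd_mul_right N₀ N₁).mul_right N₂)
  obtain ⟨m, rfl⟩ := hq
  rw [Nat.mul_div_cancel_left m (Fact.out : q.Prime).pos]
  rintro ⟨l, rfl⟩
  exact (Fact.out : q.Prime).one_lt.ne' (Nat.isUnit_iff.1 (h0 q ⟨l, by ring⟩))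

lemma dvd_div_iff {p : ℕ} (hp : p.Prime) (hpq : p ≠ q) (hq : q ∣ N₀) : p ∣ N₀ / q ↔ p ∣ N₀ := by
  obtain ⟨m, rfl⟩ := hq
  rw [Nat.mul_div_cancel_left m (Fact.out : q.Prime).pos, hp.dvd_mul,
    Nat.prime_dvd_prime_iff_eq hp (Fact.out : q.Prime)]
  tauto

/-- Moving `q` from `N₀` to `N₁` changes only the factor at `q`, because `N₀` is square-free;
`weight_eq_weight₂` treats the move to `N₂` in the same way. -/
lemma weight_eq_weight₁ (hN : Squarefree N) (hρ : N₀ * N₁ * N₂ = N) (χ : DirichletCharacter ℂ N)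
    (hq : q ∣ N₀) (v : PVec) : weight χ (N₀ / q) (q * N₁) v =
      weight₁ q (component χ q) v * weightAway q χ N₀ N₁ v := by
  have hqN := mem_primeFactors_of_dvd hN hρ hq
  rw [localWeight_mul_weightAway χ hqN, localWeight, if_neg (not_dvd_div hN hρ hq),
    if_pos (dvd_mul_right q N₁)]
  congr 1
  refine Finset.prod_congr rfl fun p hp => ?_
  obtain ⟨hpq, hp⟩ := Finset.mem_erase.1 hp
  have hpp := Nat.prime_of_mem_primeFactors hp
  have h1 : p ∣ q * N₁ ↔ p ∣ N₁ := by
    rw [hpp.dvd_mul, Nat.prime_dvd_prime_iff_eq hpp Fact.out]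
    tauto
  simp only [localWeight, dvd_div_iff hpp hpq hq, h1]

lemma not_dvd_of_dvd_left (hN : Squarefree N) (hρ : N₀ * N₁ * N₂ = N) (hq : q ∣ N₀) :
    ¬q ∣ N₁ ∧ ¬q ∣ N₂ := by
  have hc1 : N₀.Coprime (N₁ * N₂) := Nat.coprime_of_squarefree_mul (by rwa [← mul_assoc, hρ])
  refine ⟨fun h => ?_, fun h => ?_⟩
  · exact Nat.not_coprime_of_dvd_of_dvd (Fact.out : q.Prime).one_lt hq (h.mul_right N₂) hc1
  · exact Nat.not_coprime_of_dvd_of_dvd (Fact.out : q.Prime).one_lt hq (h.mul_left N₁) hc1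

lemma weight_eq_weight₂ (hN : Squarefree N) (hρ : N₀ * N₁ * N₂ = N) (χ : DirichletCharacter ℂ N)
    (hq : q ∣ N₀) (v : PVec) : weight χ (N₀ / q) N₁ v =
      weight₂ q (component χ q) v * weightAway q χ N₀ N₁ v := by
  have hqN := mem_primeFactors_of_dvd hN hρ hq
  rw [localWeight_mul_weightAway χ hqN, localWeight, if_neg (not_dvd_div hN hρ hq),
    if_neg (not_dvd_of_dvd_left hN hρ hq).1]
  congr 1
  refine Finset.prod_congr rfl fun p hp => ?_
  obtain ⟨hpq, hp⟩ := Finset.mem_erase.1 hp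
  have hpp := Nat.prime_of_mem_primeFactors hp
  simp only [localWeight, dvd_div_iff hpp hpq hq]

/-- In the branch `q ∣ e` the coordinates `a`, `c` gain a factor `q` while `d`, `e` lose one.
Conjugation at rank zero, and `ψ² = 1` at rank one, turn the lost factor into `ψ(q)`, so every rank
contributes the same. -/
lemma localWeight_expand₂ {S₀ S₁ p : ℕ} [Fact p.Prime] {ψ : DirichletCharacter ℂ p}
    (hψ : p ∣ S₁ → ψ ^ 2 = 1) (hpq : (q : ZMod p) ≠ 0) {u : PVec} (he : (q : ℤ) ∣ u.e)
    (hd : (q : ℤ) ∣ u.d) : localWeight S₀ S₁ p ψ (u.expand q) =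
      ψ (q : ZMod p) * localWeight S₀ S₁ p ψ u := by
  have hqz : (q : ℤ) ≠ 0 := by exact_mod_cast (Fact.out : q.Prime).ne_zero
  obtain ⟨a, b, c, d, e⟩ := u
  obtain ⟨d', rfl⟩ := hd
  obtain ⟨e', rfl⟩ := he
  simp only [PVec.expand, if_pos (Dvd.intro _ rfl), Int.mul_ediv_cancel_left _ hqz]
  unfold localWeight
  by_cases h0 : p ∣ S₀
  · have h2 : ψ (q : ZMod p) * (starRingEnd ℂ) (ψ (q : ZMod p)) = 1 := by
      rw [conj_apply_eq, ← map_mul, mul_inv_cancel₀ hpq, map_one]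
    simp only [h0, if_true, weight₀, Int.cast_mul, Int.cast_natCast, mul_eq_zero, hpq, false_or]
    split_ifs
    · rw [map_mul, map_mul, ← mul_assoc, h2, one_mul]
    · rw [mul_zero]
  by_cases h1 : p ∣ S₁
  · have h2 := apply_mul_self_of_sq (hψ h1) hpq
    simp only [h0, h1, if_true, if_false, weight₁, Int.cast_mul, Int.cast_natCast, mul_eq_zero,
      hpq, false_or]
    split_ifs
    · rw [← mul_neg, map_mul, ← mul_assoc, h2, one_mul]
    · rw [map_mul]
    · rw [mul_zero]
  · simp [h0, h1, weight₂]

lemma natCast_ne_zero_of_ne {p : ℕ} (hp : p.Prime) (hpq : p ≠ q) : (q : ZMod p) ≠ 0 := by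
  rw [Ne, ZMod.natCast_eq_zero_iff, Nat.prime_dvd_prime_iff_eq hp Fact.out]
  exact hpq

lemma primeFactors_div (hN : Squarefree N) (hqN : q ∈ N.primeFactors) :
    (N / q).primeFactors = N.primeFactors.erase q := by
  have hdvd := Nat.dvd_of_mem_primeFactors hqN
  have hne : N / q ≠ 0 := (Nat.div_pos (Nat.le_of_dvd (Nat.pos_of_ne_zero hN.ne_zero) hdvd)
    (Fact.out : q.Prime).pos).ne'
  ext p
  rw [Finset.mem_erase, Nat.mem_primeFactors, Nat.mem_primeFactors]
  constructor
  · rintro ⟨hp, h, -⟩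
    refine ⟨?_, hp, h.trans (Nat.div_dvd_of_dvd hdvd), hN.ne_zero⟩
    rintro rfl
    exact not_dvd_div (N₁ := 1) (N₂ := 1) hN (by simp) hdvd h
  · rintro ⟨hpq, hp, h, -⟩
    exact ⟨hp, (dvd_div_iff hp hpq hdvd).2 h, hne⟩

lemma prod_ite_eq_component (hN : Squarefree N) (hρ : N₀ * N₁ * N₂ = N)
    (χ : DirichletCharacter ℂ N) (hq : q ∣ N₀) :
    ∏ p ∈ N.primeFactors.erase q,
      (if p ∣ N₀ ∨ p ∣ N₁ then 1 else component χ p ((q : ZMod p) ^ 2)) =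
      component χ N₂ ((q : ZMod N₂) ^ 2) := by
  have hN₂ : N₂ ∣ N := hρ ▸ dvd_mul_left N₂ _
  have hcop : (N₀ * N₁).Coprime N₂ := Nat.coprime_of_squarefree_mul (by rwa [hρ])
  have h := component_eq_prod hN χ hN₂ ((q : ℤ) ^ 2)
  push_cast at h
  rw [h]
  symm
  refine Finset.prod_subset_one_on_sdiff (fun p hp => ?_) (fun p hp => ?_) (fun p hp => ?_)
  · refine Finset.mem_erase.2 ⟨?_, Nat.primeFactors_mono hN₂ hN.ne_zero hp⟩
    rintro rfl
    exact (not_dvd_of_dvd_left hN hρ hq).2 (Nat.dvd_of_mem_primeFactors hp)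
  · obtain ⟨hp1, hp2⟩ := Finset.mem_sdiff.1 hp
    have hp3 := Finset.mem_of_mem_erase hp1
    refine if_pos ?_
    by_contra hcon
    rw [not_or] at hcon
    exact hp2 (Nat.mem_primeFactors.2 ⟨Nat.prime_of_mem_primeFactors hp3,
      dvd_third hρ hp3 hcon.1 hcon.2, ne_zero_of_dvd_ne_zero hN.ne_zero hN₂⟩)
  · refine (if_neg fun hcon => ?_).symm
    have hpp := Nat.prime_of_mem_primeFactors hp
    exact Nat.not_coprime_of_dvd_of_dvd hpp.one_lt (hcon.elim (fun h => h.mul_right N₁)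
      fun h => h.mul_left N₀) (Nat.dvd_of_mem_primeFactors hp) hcop

lemma weightAway_expand₁ (hN : Squarefree N) (hρ : N₀ * N₁ * N₂ = N)
    {χ : DirichletCharacter ℂ N} (hχ : ∀ p, p.Prime → p ∣ N₁ → component χ p ^ 2 = 1)
    (hq : q ∣ N₀) {u : PVec} (he : ¬(q : ℤ) ∣ u.e) :
    weightAway q χ N₀ N₁ (u.expand q) =
      component χ N₂ ((q : ZMod N₂) ^ 2) * weightAway q χ N₀ N₁ u := by
  rw [← prod_ite_eq_component hN hρ χ hq, weightAway,
    weightAway, ← Finset.prod_mul_distrib]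
  refine Finset.prod_congr rfl fun p hp => ?_
  obtain ⟨hpq, hp⟩ := Finset.mem_erase.1 hp
  have hpp := Nat.prime_of_mem_primeFactors hp
  have : Fact p.Prime := ⟨hpp⟩
  exact localWeight_expand₁ (hχ p hpp) (natCast_ne_zero_of_ne hpp hpq) he

lemma weightAway_expand₂ (hN : Squarefree N) (hqN : q ∈ N.primeFactors)
    {χ : DirichletCharacter ℂ N} (hχ : ∀ p, p.Prime → p ∣ N₁ → component χ p ^ 2 = 1)
    {u : PVec} (he : (q : ℤ) ∣ u.e) (hd : (q : ℤ) ∣ u.d) :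
    weightAway q χ N₀ N₁ (u.expand q) =
      component χ (N / q) (q : ZMod (N / q)) * weightAway q χ N₀ N₁ u := by
  have h := component_eq_prod hN χ (Nat.div_dvd_of_dvd (Nat.dvd_of_mem_primeFactors hqN)) (q : ℤ)
  push_cast at h
  rw [h, primeFactors_div hN hqN, weightAway, weightAway, ← Finset.prod_mul_distrib]
  refine Finset.prod_congr rfl fun p hp => ?_
  obtain ⟨hpq, hp⟩ := Finset.mem_erase.1 hp
  have hpp := Nat.prime_of_mem_primeFactors hp
  have : Fact p.Prime := ⟨hpp⟩
  exact localWeight_expand₂ (hχ p hpp) (natCast_ne_zero_of_ne hpp hpq) he hd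

/-- The local factor at `q` of the part of `contractWeight` with `q ∤ e`. -/
def unitPart (q : ℕ) (ψ : DirichletCharacter ℂ q) (u : PVec) : ℂ :=
  if (q : ℤ) ∣ u.d then (starRingEnd ℂ) (ψ u.e) else 0

/-- The local factor at `q` of the part of `contractWeight` with `q ∣ e`. -/
def divisiblePart (q : ℕ) (ψ : DirichletCharacter ℂ q) (u : PVec) : ℂ :=
  if (q : ℤ) ∣ u.e ∧ (q : ℤ) ^ 2 ∣ u.d then (starRingEnd ℂ) (ψ ((u.e / q : ℤ) : ZMod q)) else 0

/-- At most one branch of `contractWeight` is nonzero at `u`. Its scalars away from `q` are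
collected into character values, leaving a local function at `q` times the weight away from `q`. -/
lemma contractWeight_weight (hN : Squarefree N) (hρ : N₀ * N₁ * N₂ = N)
    {χ : DirichletCharacter ℂ N} (hχ : ∀ p, p.Prime → p ∣ N₁ → component χ p ^ 2 = 1)
    (hq : q ∣ N₀) (k : ℕ) {u : PVec} (hu : u.IsCusp) :
    contractWeight q k (weight χ N₀ N₁) u = weightAway q χ N₀ N₁ u *
      (((q : ℂ) ^ k)⁻¹ * component χ N₂ ((q : ZMod N₂) ^ 2) * unitPart q (component χ q) u +
        component χ (N / q) (q : ZMod (N / q)) * divisiblePart q (component χ q) u) := by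
  have hqN := mem_primeFactors_of_dvd hN hρ hq
  have hpr : Prime (q : ℤ) := Nat.prime_iff_prime_int.1 Fact.out
  have hdvd : ∀ x : ℤ, (x : ZMod q) = 0 ↔ (q : ℤ) ∣ x := fun x =>
    ZMod.intCast_zmod_eq_zero_iff_dvd x q
  unfold contractWeight
  rw [weight_eq_weight₀ χ hqN hq]
  split_ifs with he hd
  · have h0 : unitPart q (component χ q) u = 0 := by
      rw [unitPart, (hdvd _).2 he, MulChar.map_zero, map_zero, ite_self]
    have h1 : weight₀ q (component χ q) (u.expand q) = divisiblePart q (component χ q) u := by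
      have hi := hu.isotropic
      -- Divisibility of `b` is a condition in `weight₀` but not in `divisiblePart`: it follows from
      -- isotropy.
      have hb : (q : ℤ) ∣ u.b := by
        refine hpr.dvd_of_dvd_pow (n := 2) ?_
        rw [show u.b ^ 2 = -(u.a * u.e + u.c * u.d) by linear_combination hi]
        exact (dvd_add (he.mul_left _) (hd.mul_left _)).neg_right
      have hd2 : (q : ℤ) ∣ u.d / q ↔ (q : ℤ) ^ 2 ∣ u.d := by
        obtain ⟨d', hd'⟩ := hd
        rw [hd', Int.mul_ediv_cancel_left _ hpr.ne_zero, sq,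
          mul_dvd_mul_iff_left hpr.ne_zero]
      rw [PVec.expand, if_pos he, weight₀, divisiblePart]
      simp only [hdvd, hb, dvd_mul_right, hd2, true_and, he]
    rw [h0, h1, weightAway_expand₂ hN hqN hχ he hd]
    ring
  · have h0 : unitPart q (component χ q) u = 0 := by rw [unitPart, if_neg hd]
    have h1 : divisiblePart q (component χ q) u = 0 :=
      if_neg fun h => hd ((dvd_pow_self _ two_ne_zero).trans h.2)
    rw [h0, h1]
    ring
  · have h1 : divisiblePart q (component χ q) u = 0 := if_neg fun h => he h.1
    have h0 : weight₀ q (component χ q) (u.expand q) = unitPart q (component χ q) u := by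
      rw [PVec.expand, if_neg he, weight₀, unitPart]
      simp only [hdvd, dvd_mul_right, true_and, (dvd_pow_self (q : ℤ) two_ne_zero).mul_right]
    rw [h0, h1, weightAway_expand₁ hN hρ hχ hq he]
    ring

end Level

/-! ### Local sums over the Hecke representatives -/

section ResidueSums

lemma sum_zmod_val {M : Type*} [AddCommMonoid M] {n : ℕ} [NeZero n] (F : ℕ → M) :
    ∑ y : ZMod n, F y.val = ∑ i ∈ Finset.range n, F i := by
  obtain ⟨m, rfl⟩ := Nat.exists_eq_succ_of_ne_zero (NeZero.ne n)
  exact Fin.sum_univ_eq_sum_range F (m + 1)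

/-- Residues modulo `q²` are written with two digits in base `q`. -/
lemma sum_zmod_sq_val {M : Type*} [AddCommMonoid M] {q : ℕ} [NeZero q] [NeZero (q ^ 2)]
    (F : ℕ → M) :
    ∑ y : ZMod (q ^ 2), F y.val = ∑ x : ZMod q, ∑ j : ZMod q, F (x.val + q * j.val) := by
  have hq : 0 < q := Nat.pos_of_ne_zero (NeZero.ne q)
  have hj : ∀ x : ℕ, ∑ j : ZMod q, F (x + q * j.val) = ∑ j ∈ Finset.range q, F (x + q * j) :=
    fun x => sum_zmod_val (fun j => F (x + q * j))
  rw [sum_zmod_val, sum_zmod_val (fun x => ∑ j : ZMod q, F (x + q * j.val)),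
    Finset.sum_congr rfl fun x _ => hj x, ← Finset.sum_product']
  refine (Finset.sum_nbij' (fun p => p.1 + q * p.2) (fun n => (n % q, n / q)) ?_ ?_ ?_ ?_ ?_).symm
  · rintro ⟨x, j⟩ h
    simp only [Finset.mem_product, Finset.mem_range] at h ⊢
    nlinarith
  · intro n hn
    simp only [Finset.mem_product, Finset.mem_range] at hn ⊢
    exact ⟨Nat.mod_lt _ hq, Nat.div_lt_of_lt_mul (by rwa [← sq])⟩
  · rintro ⟨x, j⟩ h
    simp only [Finset.mem_product, Finset.mem_range] at h
    rw [Prod.mk.injEq]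
    exact ⟨by rw [Nat.add_mul_mod_self_left, Nat.mod_eq_of_lt h.1],
      by rw [Nat.add_mul_div_left _ _ hq, Nat.div_eq_of_lt h.1, zero_add]⟩
  · intro n _
    exact Nat.mod_add_div n q
  · intro p _
    rfl

lemma sum_zmod_affine {M : Type*} [AddCommMonoid M] {n : ℕ} [NeZero n] {r : ZMod n}
    (hr : IsUnit r) (s : ZMod n) (G : ZMod n → M) : ∑ y : ZMod n, G (r * y + s) = ∑ y, G y := by
  obtain ⟨r, rfl⟩ := hr
  exact Equiv.sum_comp ((Units.mulLeft r).trans (Equiv.addRight s)) G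

lemma sum_zmod_sq_cast {q : ℕ} [NeZero q] [NeZero (q ^ 2)] (G : ZMod q → ℂ) :
    ∑ y : ZMod (q ^ 2), G (y.val : ZMod q) = q * ∑ x : ZMod q, G x := by
  rw [sum_zmod_sq_val (fun y => G (y : ZMod q)), Finset.mul_sum]
  refine Finset.sum_congr rfl fun x _ => ?_
  simp [ZMod.card]

variable {q : ℕ} [Fact q.Prime] [NeZero (q ^ 2)]

lemma sum_zmod_sq_div (G : ZMod q → ℂ) :
    ∑ z : ZMod (q ^ 2), (if q ∣ z.val then G ((z.val / q : ℕ) : ZMod q) else 0) =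
      ∑ x : ZMod q, G x := by
  have hq : 0 < q := (Fact.out : q.Prime).pos
  rw [sum_zmod_sq_val (fun z => if q ∣ z then G ((z / q : ℕ) : ZMod q) else 0),
    Fintype.sum_eq_single (0 : ZMod q)]
  · refine Finset.sum_congr rfl fun j _ => ?_
    rw [ZMod.val_zero, zero_add, if_pos (dvd_mul_right _ _), Nat.mul_div_cancel_left _ hq,
      ZMod.natCast_zmod_val]
  · intro x hx
    refine Finset.sum_eq_zero fun j _ => if_neg fun h => hx ?_
    rw [Nat.dvd_add_left (dvd_mul_right _ _), ← ZMod.natCast_eq_zero_iff,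
      ZMod.natCast_zmod_val] at h
    exact h

/-- For `q ∣ x` the residue of `x / q` modulo `q` depends only on `x` modulo `q²`, so a sum over
`y₁` can be reparametrised modulo `q²`. -/
lemma ite_dvd_eq_val (G : ZMod q → ℂ) (x : ℤ) :
    (if (q : ℤ) ∣ x then G ((x / q : ℤ) : ZMod q) else 0) =
      if q ∣ (x : ZMod (q ^ 2)).val then G (((x : ZMod (q ^ 2)).val / q : ℕ) : ZMod q) else 0 := by
  have hqz : (q : ℤ) ≠ 0 := by exact_mod_cast (Fact.out : q.Prime).ne_zero
  have hv : (((x : ZMod (q ^ 2)).val : ℕ) : ℤ) = x % (q ^ 2 : ℕ) := ZMod.val_intCast x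
  have hx : x = ((x : ZMod (q ^ 2)).val : ℤ) + q * (q * (x / (q ^ 2 : ℕ))) := by
    rw [hv]
    conv_lhs => rw [← Int.emod_add_mul_ediv x (q ^ 2 : ℕ)]
    push_cast
    ring
  have hiff : (q : ℤ) ∣ x ↔ q ∣ (x : ZMod (q ^ 2)).val := by
    rw [← Int.natCast_dvd_natCast]
    conv_lhs => rw [hx]
    exact Int.dvd_add_left (dvd_mul_right _ _)
  by_cases h : (q : ℤ) ∣ x
  · have h' := hiff.1 h
    rw [if_pos h, if_pos h']
    congr 1
    have e : x / q = (((x : ZMod (q ^ 2)).val / q : ℕ) : ℤ) + q * (x / (q ^ 2 : ℕ)) := by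
      conv_lhs => rw [hx]
      rw [Int.add_mul_ediv_left _ _ hqz]
      push_cast
      ring
    rw [e, Int.cast_add, Int.cast_mul, Int.cast_natCast, Int.cast_natCast, ZMod.natCast_self,
      zero_mul, add_zero]
  · rw [if_neg h, if_neg fun h' => h (hiff.2 h')]

end ResidueSums

/-- The action of a unipotent representative of the Hecke operator. -/
def PVec.shift (u : PVec) (y₁ y₂ : ℤ) : PVec :=
  ⟨u.a, u.b - u.a * y₂, u.c, u.d + u.a * y₁, u.e - u.a * y₂ ^ 2 + 2 * u.b * y₂ - u.c * y₁⟩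

lemma act_translation_inv (u : PVec) (y₁ y₂ : ℤ) :
    u.act (translation y₁ y₂ 0)⁻¹ = u.shift y₁ y₂ := by
  simp only [PVec.act, PVec.wedge, PVec.shift, blockA_inv, blockB_inv, blockC_inv, blockD_inv,
    blockA_translation, blockB_translation, blockC_translation, blockD_translation]
  ext <;> simp <;> ring

lemma PVec.act_mul {v : PVec} (hv : v.IsCusp) (γ δ : Sp2Z) :
    v.act (γ * δ) = (v.act γ).act δ := by
  obtain ⟨g, rfl⟩ := exists_plucker_eq hv
  rw [← plucker_mul, ← plucker_mul, ← plucker_mul, mul_assoc]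

lemma PVec.IsCusp.shift {u : PVec} (hu : u.IsCusp) (y₁ y₂ : ℤ) : (u.shift y₁ y₂).IsCusp := by
  rw [← act_translation_inv]
  exact hu.act _

section LocalSums

variable {q : ℕ} {ψ : DirichletCharacter ℂ q}

lemma act_lineElement_none_inv (v : PVec) :
    v.act (lineElement q none)⁻¹ = ⟨v.a, -v.b, -v.d, -v.c, v.e⟩ := by
  obtain ⟨h1, h2⟩ := lineElement_blocks q none
  simp only [PVec.act, PVec.wedge, blockA_inv, blockB_inv, blockC_inv, blockD_inv, h1, h2,
    blockA_lineElement_none, blockD_lineElement_none]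
  ext <;> simp

lemma act_heckeRep_inv {v : PVec} (hv : v.IsCusp) (t : Option (ZMod q)) (y₁ : ZMod (q ^ 2))
    (y₂ : ZMod q) : v.act (heckeRep q (t, y₁, y₂))⁻¹ =
      (v.act (lineElement q t)⁻¹).shift y₁.val y₂.val := by
  rw [heckeRep, _root_.mul_inv_rev, PVec.act_mul hv, act_translation_inv]

lemma act_lineElement_some_inv (v : PVec) (j : ZMod q) :
    v.act (lineElement q (some j))⁻¹ = ⟨v.a, v.b + v.c * j.val, v.c,
      v.d - 2 * v.b * j.val - v.c * j.val ^ 2, v.e⟩ := by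
  obtain ⟨h1, h2⟩ := lineElement_blocks q (some j)
  simp only [PVec.act, PVec.wedge, blockA_inv, blockB_inv, blockC_inv, blockD_inv, h1, h2,
    blockA_lineElement_some, blockD_lineElement_some]
  ext <;> simp
  ring

lemma act_lineElement_inv_a_e (v : PVec) (t : Option (ZMod q)) :
    (v.act (lineElement q t)⁻¹).a = v.a ∧ (v.act (lineElement q t)⁻¹).e = v.e := by
  cases t with
  | none => rw [act_lineElement_none_inv]; exact ⟨rfl, rfl⟩
  | some j => rw [act_lineElement_some_inv]; exact ⟨rfl, rfl⟩

lemma parts_shift_eq_zero {u : PVec} (ha : (q : ℤ) ∣ u.a) (hd : ¬(q : ℤ) ∣ u.d) (y₁ y₂ : ℤ) :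
    unitPart q ψ (u.shift y₁ y₂) = 0 ∧ divisiblePart q ψ (u.shift y₁ y₂) = 0 := by
  have h : ¬(q : ℤ) ∣ (u.shift y₁ y₂).d := fun h => hd ((Int.dvd_add_left (ha.mul_right _)).1 h)
  exact ⟨if_neg h, if_neg fun h' => h ((dvd_pow_self _ two_ne_zero).trans h'.2)⟩

variable [Fact q.Prime]

lemma intCast_eq_zero_iff_dvd (x : ℤ) : (x : ZMod q) = 0 ↔ (q : ℤ) ∣ x :=
  ZMod.intCast_zmod_eq_zero_iff_dvd x q

lemma isotropic_cast {v : PVec} (hv : v.IsCusp) :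
    (v.a : ZMod q) * v.e + (v.b : ZMod q) ^ 2 + v.c * v.d = 0 := by
  have := congrArg (Int.cast : ℤ → ZMod q) hv.isotropic
  push_cast at this
  exact this

lemma dvd_b_of_dvd {v : PVec} (hv : v.IsCusp) (hae : (q : ℤ) ∣ v.a ∨ (q : ℤ) ∣ v.e)
    (hcd : (q : ℤ) ∣ v.c ∨ (q : ℤ) ∣ v.d) : (q : ℤ) ∣ v.b := by
  have h := isotropic_cast (q := q) hv
  simp only [← intCast_eq_zero_iff_dvd] at *
  have h1 : (v.a : ZMod q) * v.e = 0 := mul_eq_zero.2 hae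
  have h2 : (v.c : ZMod q) * v.d = 0 := mul_eq_zero.2 hcd
  rw [h1, h2, zero_add, add_zero] at h
  exact pow_eq_zero_iff two_ne_zero |>.1 h

/-- The conditions `q ∣ e` and `q² ∣ d` force `q ∣ b`, hence `q² ∣ a e` and `q² ∣ e`; then the
character is evaluated at zero. -/
lemma divisiblePart_of_not_dvd {u : PVec} (hu : u.IsCusp) (ha : ¬(q : ℤ) ∣ u.a) :
    divisiblePart q ψ u = 0 := by
  have hpr : Prime (q : ℤ) := Nat.prime_iff_prime_int.1 Fact.out
  unfold divisiblePart
  split_ifs with h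
  · obtain ⟨he, hd⟩ := h
    have hb := dvd_b_of_dvd hu (Or.inr he) (Or.inr ((dvd_pow_self _ two_ne_zero).trans hd))
    have h1 : (q : ℤ) ^ 2 ∣ u.a * u.e := by
      rw [show u.a * u.e = -(u.b ^ 2 + u.c * u.d) by linear_combination hu.isotropic]
      exact (dvd_add (pow_dvd_pow_of_dvd hb 2) (hd.mul_left _)).neg_right
    obtain ⟨e', he'⟩ := he
    rw [he', show u.a * (q * e') = q * (u.a * e') by ring, sq,
      mul_dvd_mul_iff_left hpr.ne_zero] at h1
    rw [he', Int.mul_ediv_cancel_left _ hpr.ne_zero,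
      (intCast_eq_zero_iff_dvd _).2 ((hpr.dvd_or_dvd h1).resolve_left ha), MulChar.map_zero,
      map_zero]
  · rfl

/-- When the shifted `d` vanishes modulo `q`, isotropy reads `a e' = -(b')²` with `b' = b - a y₂`,
so the value at `e'` becomes a value at `-a` times one at a square. -/
lemma unitPart_shift_of_not_dvd {u : PVec} (hu : u.IsCusp) (ha : ¬(q : ℤ) ∣ u.a) (y₁ y₂ : ℤ) :
    unitPart q ψ (u.shift y₁ y₂) = (if (u.a : ZMod q) * y₁ + u.d = 0 then 1 else 0) *
      (ψ (-(u.a : ZMod q)) * (starRingEnd ℂ) (ψ (((u.a : ZMod q) * y₂ + -(u.b : ZMod q)) ^ 2))) := by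
  have ha0 : (u.a : ZMod q) ≠ 0 := fun h => ha ((intCast_eq_zero_iff_dvd _).1 h)
  have hi := isotropic_cast (q := q) hu
  unfold unitPart
  simp only [← intCast_eq_zero_iff_dvd, PVec.shift]
  push_cast
  rw [add_comm (u.d : ZMod q)]
  split_ifs with h
  · rw [one_mul, conj_apply_eq, conj_apply_eq, ← map_mul]
    by_cases hz : (u.a : ZMod q) * y₂ + -(u.b : ZMod q) = 0
    · have : (u.a : ZMod q) * (u.e - u.a * y₂ ^ 2 + 2 * u.b * y₂ - u.c * y₁) = 0 := by
        linear_combination hi - u.c * h - ((u.a : ZMod q) * y₂ + -(u.b : ZMod q)) * hz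
      rw [(mul_eq_zero.1 this).resolve_left ha0, hz]
      simp
    · congr 1
      rw [inv_eq_iff_eq_inv, _root_.mul_inv_rev, inv_inv]
      field_simp
      linear_combination hi - u.c * h
  · rw [zero_mul]

lemma sum_unitPart_of_not_dvd [NeZero (q ^ 2)] {u : PVec} (hu : u.IsCusp)
    (ha : ¬(q : ℤ) ∣ u.a) :
    ∑ y₁ : ZMod (q ^ 2), ∑ y₂ : ZMod q, unitPart q ψ (u.shift y₁.val y₂.val) =
      q * (ψ (-(u.a : ZMod q)) * ∑ x : ZMod q, (starRingEnd ℂ) (ψ (x ^ 2))) := by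
  have ha0 : IsUnit (u.a : ZMod q) :=
    Ne.isUnit fun h => ha ((intCast_eq_zero_iff_dvd _).1 h)
  simp_rw [unitPart_shift_of_not_dvd hu ha, ← Finset.mul_sum]
  push_cast
  simp_rw [ZMod.natCast_zmod_val]
  rw [← Finset.sum_mul, sum_zmod_affine ha0 (-(u.b : ZMod q))
    (fun x => (starRingEnd ℂ) (ψ (x ^ 2))), sum_zmod_sq_cast
    (fun x : ZMod q => if (u.a : ZMod q) * x + u.d = 0 then (1 : ℂ) else 0),
    sum_zmod_affine ha0 (u.d : ZMod q) (fun x => if x = 0 then (1 : ℂ) else 0)]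
  simp

lemma unitPart_shift_of_dvd {u : PVec} (hu : u.IsCusp) (ha : (q : ℤ) ∣ u.a) (hd : (q : ℤ) ∣ u.d)
    (y₁ y₂ : ℤ) : unitPart q ψ (u.shift y₁ y₂) =
      (starRingEnd ℂ) (ψ (-(u.c : ZMod q) * y₁ + u.e)) := by
  have hb := dvd_b_of_dvd hu (Or.inl ha) (Or.inr hd)
  rw [unitPart, if_pos (show (q : ℤ) ∣ (u.shift y₁ y₂).d from dvd_add hd (ha.mul_right _))]
  simp only [PVec.shift]
  push_cast
  rw [(intCast_eq_zero_iff_dvd _).2 ha, (intCast_eq_zero_iff_dvd _).2 hb]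
  congr 2
  ring

/-- Modulo `q` the shifted `e` is `e - c y₁`, which takes each residue `q` times as `y₁` varies; the
free `y₂` gives the other factor `q`. -/
lemma sum_unitPart_of_dvd [NeZero (q ^ 2)] {u : PVec} (hu : u.IsCusp)
    (ha : (q : ℤ) ∣ u.a) (hd : (q : ℤ) ∣ u.d) (hc : ¬(q : ℤ) ∣ u.c) :
    ∑ y₁ : ZMod (q ^ 2), ∑ y₂ : ZMod q, unitPart q ψ (u.shift y₁.val y₂.val) =
      (q : ℂ) ^ 2 * ∑ x : ZMod q, (starRingEnd ℂ) (ψ x) := by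
  have hc0 : IsUnit (-(u.c : ZMod q)) :=
    Ne.isUnit (neg_ne_zero.2 fun h => hc ((intCast_eq_zero_iff_dvd _).1 h))
  simp_rw [unitPart_shift_of_dvd hu ha hd, Finset.sum_const, Finset.card_univ, ZMod.card,
    nsmul_eq_mul, ← Finset.mul_sum]
  push_cast
  rw [sum_zmod_sq_cast (fun x : ZMod q => (starRingEnd ℂ) (ψ (-(u.c : ZMod q) * x + u.e))),
    sum_zmod_affine hc0 (u.e : ZMod q) (fun x => (starRingEnd ℂ) (ψ x))]
  ring

lemma sum_unitPart_of_forall_dvd [NeZero (q ^ 2)] {u : PVec} (hu : u.IsCusp)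
    (ha : (q : ℤ) ∣ u.a) (hd : (q : ℤ) ∣ u.d) (hc : (q : ℤ) ∣ u.c) :
    ∑ y₁ : ZMod (q ^ 2), ∑ y₂ : ZMod q, unitPart q ψ (u.shift y₁.val y₂.val) =
      (q : ℂ) ^ 3 * (starRingEnd ℂ) (ψ u.e) := by
  simp_rw [unitPart_shift_of_dvd hu ha hd, (intCast_eq_zero_iff_dvd _).2 hc]
  simp only [neg_zero, zero_mul, zero_add, Finset.sum_const, Finset.card_univ, ZMod.card,
    nsmul_eq_mul]
  push_cast
  ring

/-- If `q` also divided the shifted `e`, it would divide all five coordinates of a primitive vector.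
-/
lemma divisiblePart_shift_of_forall_dvd {u : PVec} (hu : u.IsCusp)
    (ha : (q : ℤ) ∣ u.a) (hd : (q : ℤ) ∣ u.d) (hc : (q : ℤ) ∣ u.c) (y₁ y₂ : ℤ) :
    divisiblePart q ψ (u.shift y₁ y₂) = 0 := by
  have hb := dvd_b_of_dvd hu (Or.inl ha) (Or.inr hd)
  refine if_neg fun h => (hu.shift y₁ y₂).primitive q Fact.out ⟨ha, ?_, hc, ?_, h.1⟩
  · exact dvd_sub hb (ha.mul_right _)
  · exact dvd_add hd (ha.mul_right _)

/-- The condition `q² ∣ d` is automatic once `q ∣ e`: then `a e` and `b²` are divisible by `q²`,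
hence so is `c d`, while `c` is prime to `q`. -/
lemma divisiblePart_shift_of_dvd {u : PVec} (hu : u.IsCusp) (ha : (q : ℤ) ∣ u.a)
    (hd : (q : ℤ) ∣ u.d) (hc : ¬(q : ℤ) ∣ u.c) (y₁ y₂ : ℤ) :
    divisiblePart q ψ (u.shift y₁ y₂) = if (q : ℤ) ∣ (u.shift y₁ y₂).e then
      (starRingEnd ℂ) (ψ (((u.shift y₁ y₂).e / q : ℤ) : ZMod q)) else 0 := by
  have hpr : Prime (q : ℤ) := Nat.prime_iff_prime_int.1 Fact.out
  have hs := hu.shift y₁ y₂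
  have ha' : (q : ℤ) ∣ (u.shift y₁ y₂).a := ha
  have hd' : (q : ℤ) ∣ (u.shift y₁ y₂).d := dvd_add hd (ha.mul_right _)
  have hc' : ¬(q : ℤ) ∣ (u.shift y₁ y₂).c := hc
  have hb' := dvd_b_of_dvd hs (Or.inl ha') (Or.inr hd')
  generalize u.shift y₁ y₂ = w at *
  unfold divisiblePart
  refine if_congr (and_iff_left_of_imp fun he => ?_) rfl rfl
  have h1 : (q : ℤ) ^ 2 ∣ w.c * w.d := by
    rw [show w.c * w.d = -(w.a * w.e + w.b ^ 2) by linear_combination hs.isotropic, sq, sq]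
    exact (dvd_add (mul_dvd_mul ha' he) (mul_dvd_mul hb' hb')).neg_right
  exact ((hpr.coprime_iff_not_dvd.2 hc').pow_left).dvd_of_dvd_mul_left h1

/-- For fixed `y₂` the shifted `e` runs once through the residues modulo `q²`, since `c` is a unit.
Its multiples of `q`, divided by `q`, run once through the residues modulo `q`. -/
lemma sum_divisiblePart_of_dvd [NeZero (q ^ 2)] {u : PVec} (hu : u.IsCusp)
    (ha : (q : ℤ) ∣ u.a) (hd : (q : ℤ) ∣ u.d) (hc : ¬(q : ℤ) ∣ u.c) :
    ∑ y₁ : ZMod (q ^ 2), ∑ y₂ : ZMod q, divisiblePart q ψ (u.shift y₁.val y₂.val) =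
      q * ∑ x : ZMod q, (starRingEnd ℂ) (ψ x) := by
  have hpr : Prime (q : ℤ) := Nat.prime_iff_prime_int.1 Fact.out
  have hc0 : IsUnit (-(u.c : ZMod (q ^ 2))) := by
    refine IsUnit.neg ((ZMod.coe_int_isUnit_iff_isCoprime u.c (q ^ 2)).2 ?_)
    push_cast
    exact (hpr.coprime_iff_not_dvd.2 hc).pow_left
  rw [Finset.sum_comm]
  have h1 : ∀ y₂ : ZMod q, ∑ y₁ : ZMod (q ^ 2), divisiblePart q ψ (u.shift y₁.val y₂.val) =
      ∑ x : ZMod q, (starRingEnd ℂ) (ψ x) := by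
    intro y₂
    rw [← sum_zmod_sq_div (fun x : ZMod q => (starRingEnd ℂ) (ψ x)), ← sum_zmod_affine hc0
      ((u.e - u.a * y₂.val ^ 2 + 2 * u.b * y₂.val : ℤ) : ZMod (q ^ 2))
      (fun z : ZMod (q ^ 2) => if q ∣ z.val then
        (starRingEnd ℂ) (ψ ((z.val / q : ℕ) : ZMod q)) else 0)]
    refine Finset.sum_congr rfl fun y₁ _ => ?_
    rw [divisiblePart_shift_of_dvd hu ha hd hc,
      ite_dvd_eq_val (fun x : ZMod q => (starRingEnd ℂ) (ψ x))]
    have e : (((u.shift y₁.val y₂.val).e : ℤ) : ZMod (q ^ 2)) = -(u.c : ZMod (q ^ 2)) * y₁ +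
        ((u.e - u.a * y₂.val ^ 2 + 2 * u.b * y₂.val : ℤ) : ZMod (q ^ 2)) := by
      simp only [PVec.shift]
      push_cast
      rw [ZMod.natCast_zmod_val y₁]
      ring
    rw [e]
  rw [Finset.sum_congr rfl fun y₂ _ => h1 y₂, Finset.sum_const, Finset.card_univ, ZMod.card,
    nsmul_eq_mul]

end LocalSums

section HeckeSums

variable {q : ℕ} [Fact q.Prime] {ψ : DirichletCharacter ℂ q}

lemma forall_dvd_act_lineElement_inv {v : PVec} (hv : v.IsCusp) (ha : (q : ℤ) ∣ v.a)
    (hc : (q : ℤ) ∣ v.c) (hd : (q : ℤ) ∣ v.d) (t : Option (ZMod q)) :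
    (q : ℤ) ∣ (v.act (lineElement q t)⁻¹).c ∧ (q : ℤ) ∣ (v.act (lineElement q t)⁻¹).d := by
  have hb := dvd_b_of_dvd hv (Or.inl ha) (Or.inr hd)
  cases t with
  | none => rw [act_lineElement_none_inv]; exact ⟨hd.neg_right, hc.neg_right⟩
  | some j =>
    rw [act_lineElement_some_inv]
    exact ⟨hc, dvd_sub (dvd_sub hd ((hb.mul_left 2).mul_right _)) (hc.mul_right _)⟩

/-- Up to sign, the new `d` is the value at the line of the form `c x² - 2 b x y - d y²`. Modulo `q`
this form has rank one, hence exactly one zero on the projective line. -/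
lemma exists_unique_line {v : PVec} (hv : v.IsCusp) (ha : (q : ℤ) ∣ v.a)
    (hcd : ¬((q : ℤ) ∣ v.c ∧ (q : ℤ) ∣ v.d)) : ∃ t₀ : Option (ZMod q),
      (q : ℤ) ∣ (v.act (lineElement q t₀)⁻¹).d ∧ ¬(q : ℤ) ∣ (v.act (lineElement q t₀)⁻¹).c ∧
      ∀ t, t ≠ t₀ → ¬(q : ℤ) ∣ (v.act (lineElement q t)⁻¹).d := by
  by_cases hc : (q : ℤ) ∣ v.c
  · have hd : ¬(q : ℤ) ∣ v.d := fun hd => hcd ⟨hc, hd⟩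
    have hb := dvd_b_of_dvd hv (Or.inl ha) (Or.inl hc)
    refine ⟨none, ?_, ?_, fun t ht => ?_⟩
    · rw [act_lineElement_none_inv]; exact hc.neg_right
    · rw [act_lineElement_none_inv]; exact fun h => hd (by simpa using h)
    · obtain ⟨j, rfl⟩ := Option.ne_none_iff_exists'.1 ht
      rw [act_lineElement_some_inv]
      intro h
      rw [sub_sub] at h
      have h' := dvd_add h (dvd_add ((hb.mul_left 2).mul_right (j.val : ℤ))
        (hc.mul_right ((j.val : ℤ) ^ 2)))
      rw [sub_add_cancel] at h'
      exact hd h'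
  · have hi := isotropic_cast (q := q) hv
    have hc0 : (v.c : ZMod q) ≠ 0 := fun h => hc ((intCast_eq_zero_iff_dvd _).1 h)
    rw [(intCast_eq_zero_iff_dvd _).2 ha, zero_mul, zero_add] at hi
    have key : ∀ j : ZMod q, (q : ℤ) ∣ (v.act (lineElement q (some j))⁻¹).d ↔
        (v.b : ZMod q) + v.c * j = 0 := by
      intro j
      rw [act_lineElement_some_inv, ← intCast_eq_zero_iff_dvd]
      push_cast
      rw [ZMod.natCast_zmod_val]
      constructor
      · intro h
        refine pow_eq_zero_iff two_ne_zero |>.1 ?_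
        linear_combination hi - v.c * h
      · intro h
        refine (mul_eq_zero.1 (?_ : (v.c : ZMod q) * _ = 0)).resolve_left hc0
        linear_combination hi - (v.b + v.c * j) * h
    refine ⟨some (-(v.b : ZMod q) / v.c), (key _).2 ?_, ?_, fun t ht => ?_⟩
    · field_simp
      ring
    · rw [act_lineElement_some_inv]; exact hc
    · cases t with
      | none => rw [act_lineElement_none_inv]; exact fun h => hc (by simpa using h)
      | some j =>
        refine fun h => ht ?_
        rw [key] at h
        rw [Option.some_inj, eq_div_iff hc0]
        linear_combination h

lemma sum_heckeIndex [NeZero (q ^ 2)] {v : PVec} (hv : v.IsCusp) (F : PVec → ℂ) :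
    ∑ i : HeckeIndex q, F (v.act (heckeRep q i)⁻¹) = ∑ t : Option (ZMod q),
      ∑ y₁ : ZMod (q ^ 2), ∑ y₂ : ZMod q,
        F ((v.act (lineElement q t)⁻¹).shift y₁.val y₂.val) := by
  rw [Fintype.sum_prod_type]
  refine Finset.sum_congr rfl fun t _ => ?_
  rw [Fintype.sum_prod_type]
  simp_rw [act_heckeRep_inv hv]

/-! ### Evaluation of the local sums and of the character sums at `q`. -/

/-- The sum of the inverse of a character. -/
def conjSum (ψ : DirichletCharacter ℂ q) : ℂ := ∑ x : ZMod q, (starRingEnd ℂ) (ψ x)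

/-- The sum of the inverse of a character over squares. -/
def conjSqSum (ψ : DirichletCharacter ℂ q) : ℂ := ∑ x : ZMod q, (starRingEnd ℂ) (ψ (x ^ 2))

/-- The three weights are supported on disjoint strata. With all of `a`, `c`, `d` divisible by `q`,
every line contributes to the unit part equally; with only `a` divisible, exactly one line survives;
with `q ∤ a`, all lines contribute equally again. Here `weight₁ q 1` is the indicator of the middle
stratum, whatever `ψ` is. -/
lemma sum_parts [NeZero (q ^ 2)] {v : PVec} (hv : v.IsCusp) :
    ∑ i : HeckeIndex q, unitPart q ψ (v.act (heckeRep q i)⁻¹) =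
      (q + 1) * (q : ℂ) ^ 3 * weight₀ q ψ v + (q : ℂ) ^ 2 * conjSum ψ * weight₁ q 1 v +
        (q + 1) * (q : ℂ) * ψ (-1) * conjSqSum ψ * weight₂ q ψ v ∧
    ∑ i : HeckeIndex q, divisiblePart q ψ (v.act (heckeRep q i)⁻¹) =
      q * conjSum ψ * weight₁ q 1 v := by
  have hu : ∀ t : Option (ZMod q), (v.act (lineElement q t)⁻¹).IsCusp := fun t => hv.act _
  have hae := fun t => act_lineElement_inv_a_e v (q := q) t
  have hcard : Fintype.card (Option (ZMod q)) = q + 1 := by rw [Fintype.card_option, ZMod.card]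
  rw [sum_heckeIndex hv, sum_heckeIndex hv]
  by_cases ha : (q : ℤ) ∣ v.a
  · have ha0 := (intCast_eq_zero_iff_dvd v.a).2 ha
    have ha' : ∀ t : Option (ZMod q), (q : ℤ) ∣ (v.act (lineElement q t)⁻¹).a := fun t => by
      rwa [(hae t).1]
    by_cases hcd : (q : ℤ) ∣ v.c ∧ (q : ℤ) ∣ v.d
    · obtain ⟨hc, hd⟩ := hcd
      have hb := dvd_b_of_dvd hv (Or.inl ha) (Or.inr hd)
      have h := forall_dvd_act_lineElement_inv hv ha hc hd
      have hb0 := (intCast_eq_zero_iff_dvd v.b).2 hb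
      have hc0 := (intCast_eq_zero_iff_dvd v.c).2 hc
      have hd0 := (intCast_eq_zero_iff_dvd v.d).2 hd
      have hw0 : weight₀ q ψ v = (starRingEnd ℂ) (ψ v.e) := if_pos ⟨ha0, hb0, hc0, hd0⟩
      have hw1 : weight₁ q (1 : DirichletCharacter ℂ q) v = 0 := by
        rw [weight₁, if_pos ha0, if_pos hc0, hd0, neg_zero, MulChar.map_zero]
      have hw2 : weight₂ q ψ v = 0 := by rw [weight₂, ha0, MulChar.map_zero]
      rw [hw0, hw1, hw2]
      constructor
      · simp_rw [fun t => sum_unitPart_of_forall_dvd (ψ := ψ) (hu t) (ha' t) (h t).2 (h t).1,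
          (hae _).2, Finset.sum_const, Finset.card_univ, hcard, nsmul_eq_mul]
        push_cast
        ring
      · simp_rw [fun t => divisiblePart_shift_of_forall_dvd (ψ := ψ) (hu t) (ha' t) (h t).2
          (h t).1, Finset.sum_const_zero]
        ring
    · obtain ⟨t₀, h1, h2, h3⟩ := exists_unique_line hv ha hcd
      have hw0 : weight₀ q ψ v = 0 := by
        refine if_neg fun h => hcd ?_
        simp only [intCast_eq_zero_iff_dvd] at h
        exact h.2.2
      have hw1 : weight₁ q (1 : DirichletCharacter ℂ q) v = 1 := by
        rw [weight₁, if_pos ha0]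
        split_ifs with hc
        · refine MulChar.one_apply (Ne.isUnit (neg_ne_zero.2 fun hd => hcd ?_))
          exact ⟨(intCast_eq_zero_iff_dvd _).1 hc, (intCast_eq_zero_iff_dvd _).1 hd⟩
        · exact MulChar.one_apply (Ne.isUnit hc)
      have hw2 : weight₂ q ψ v = 0 := by rw [weight₂, ha0, MulChar.map_zero]
      rw [hw0, hw1, hw2, Fintype.sum_eq_single t₀, Fintype.sum_eq_single t₀,
        sum_unitPart_of_dvd (hu t₀) (ha' t₀) h1 h2,
        sum_divisiblePart_of_dvd (hu t₀) (ha' t₀) h1 h2, conjSum]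
      · constructor <;> ring
      · intro t ht
        simp_rw [fun y₁ y₂ => (parts_shift_eq_zero (ψ := ψ) (ha' t) (h3 t ht) y₁ y₂).2,
          Finset.sum_const_zero]
      · intro t ht
        simp_rw [fun y₁ y₂ => (parts_shift_eq_zero (ψ := ψ) (ha' t) (h3 t ht) y₁ y₂).1,
          Finset.sum_const_zero]
  · have ha0 : (v.a : ZMod q) ≠ 0 := fun h => ha ((intCast_eq_zero_iff_dvd v.a).1 h)
    have ha' : ∀ t : Option (ZMod q), ¬(q : ℤ) ∣ (v.act (lineElement q t)⁻¹).a := fun t => by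
      rwa [(hae t).1]
    have hw0 : weight₀ q ψ v = 0 := if_neg fun h => ha0 h.1
    have hw1 : weight₁ q (1 : DirichletCharacter ℂ q) v = 0 := if_neg ha0
    rw [hw0, hw1, weight₂]
    constructor
    · simp_rw [fun t => sum_unitPart_of_not_dvd (ψ := ψ) (hu t) (ha' t), (hae _).1,
        Finset.sum_const, Finset.card_univ, hcard, nsmul_eq_mul, neg_eq_neg_one_mul (v.a : ZMod q),
        map_mul, conjSqSum]
      push_cast
      ring
    · simp_rw [fun t y₁ y₂ => divisiblePart_of_not_dvd (ψ := ψ) ((hu t).shift y₁ y₂) (ha' t),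
        Finset.sum_const_zero]
      ring

lemma conjSum_of_ne_one (h : ψ ≠ 1) : conjSum ψ = 0 := by
  rw [conjSum, ← map_sum, MulChar.sum_eq_zero_of_ne_one h, map_zero]

lemma sum_one_apply : ∑ x : ZMod q, (1 : DirichletCharacter ℂ q) x = (q : ℂ) - 1 := by
  rw [MulChar.sum_one_eq_card_units, ZMod.card_units, Nat.cast_sub (Fact.out : q.Prime).one_lt.le,
    Nat.cast_one]

lemma conjSum_one : conjSum (1 : DirichletCharacter ℂ q) = q - 1 := by
  rw [conjSum, ← map_sum, sum_one_apply]
  simp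

lemma conjSqSum_eq (ψ : DirichletCharacter ℂ q) : conjSqSum ψ = conjSum (ψ ^ 2) := by
  refine Finset.sum_congr rfl fun x _ => ?_
  rw [map_pow, MulChar.pow_apply' _ two_ne_zero]

/-- A nontrivial `ψ` with `ψ² = 1` is 1 on squares and `-1` at some non-square unit `g`. If `-1` is
not a square then `-g` is, whence `ψ(-1) = -1`. -/
lemma apply_neg_one_eq_legendreSym (h : ψ ^ 2 = 1) (h1 : ψ ≠ 1) :
    ψ (-1) = (legendreSym q (-1) : ℂ) := by
  obtain ⟨g, hg⟩ : ∃ g : (ZMod q)ˣ, ψ g ≠ 1 := by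
    by_contra hcon
    push Not at hcon
    exact h1 (MulChar.ext fun g => by rw [hcon g, MulChar.one_apply_coe])
  have hsq : ∀ x : ZMod q, x ≠ 0 → IsSquare x → ψ x = 1 := by
    rintro _ hx ⟨y, rfl⟩
    rw [map_mul, apply_mul_self_of_sq h (left_ne_zero_of_mul hx)]
  have hgs : ¬IsSquare (g : ZMod q) := fun hs => hg (hsq _ g.ne_zero hs)
  have hgv : ψ g = -1 := (mul_self_eq_one_iff.1 (apply_mul_self_of_sq h g.ne_zero)).resolve_left hg
  have h10 : (-1 : ZMod q) ≠ 0 := neg_ne_zero.2 one_ne_zero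
  have hcast : ((-1 : ℤ) : ZMod q) = -1 := by push_cast; rfl
  by_cases hs : IsSquare (-1 : ZMod q)
  · rw [hsq _ h10 hs, (legendreSym.eq_one_iff q (by rwa [hcast])).2 (by rwa [hcast])]
    simp
  -- In characteristic two `-1 = 1` is a square, so this case is excluded here.
  · have hq2 : ringChar (ZMod q) ≠ 2 := by
      intro h2
      have : q = 2 := by rwa [ZMod.ringChar_zmod_n] at h2
      subst this
      exact hs ⟨1, by rw [mul_one]; exact CharTwo.neg_eq 1⟩
    have hgm : IsSquare ((g : ZMod q) * -1) := by
      rw [← quadraticChar_one_iff_isSquare (mul_ne_zero g.ne_zero h10), map_mul,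
        quadraticChar_neg_one_iff_not_isSquare.2 hgs, quadraticChar_neg_one_iff_not_isSquare.2 hs]
      rfl
    have h2 := hsq _ (mul_ne_zero g.ne_zero h10) hgm
    rw [map_mul, hgv] at h2
    rw [(legendreSym.eq_neg_one_iff q).2 (by rwa [hcast])]
    push_cast
    linear_combination -h2

end HeckeSums

/-! ### The Hecke image for an arbitrary local character at `q`. -/

section Coefficients

variable {N N₀ N₁ N₂ q : ℕ} [Fact q.Prime]

/-- The weight away from `q` is invariant under the representatives, which lie in `GammaInfPlus`,
and factors out. The powers of `q` come from `q^{k-3}`, the `q^{-k}` of the unit part, and the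
multiplicities in `sum_parts`. -/
lemma sum_contractWeight [NeZero (q ^ 2)] (hN : Squarefree N) (hρ : N₀ * N₁ * N₂ = N)
    {χ : DirichletCharacter ℂ N} (hχ : ∀ p, p.Prime → p ∣ N₁ → component χ p ^ 2 = 1)
    (hq : q ∣ N₀) {k : ℕ} (hk : 4 ≤ k) {v : PVec} (hv : v.IsCusp) :
    (q : ℂ) ^ ((k : ℤ) - 3) * ∑ i : HeckeIndex q,
        contractWeight q k (weight χ N₀ N₁) (v.act (heckeRep q i)⁻¹) =
      component χ N₂ ((q : ZMod N₂) ^ 2) * ((q : ℂ) + 1) * weight χ N₀ N₁ v +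
        (q : ℂ)⁻¹ * (component χ (N / q) (q : ZMod (N / q)) * (q : ℂ) ^ (k - 1) +
          component χ N₂ ((q : ZMod N₂) ^ 2)) * conjSum (component χ q) *
          (weight₁ q 1 v * weightAway q χ N₀ N₁ v) +
        component χ N₂ ((q : ZMod N₂) ^ 2) * ((q : ℂ) ^ 2)⁻¹ * ((q : ℂ) + 1) *
          component χ q (-1) * conjSqSum (component χ q) * weight χ (N₀ / q) N₁ v := by
  have hqN := mem_primeFactors_of_dvd hN hρ hq
  have hq' : (q : ℂ) ≠ 0 := Nat.cast_ne_zero.2 (Fact.out : q.Prime).ne_zero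
  obtain ⟨m, rfl⟩ : ∃ m, k = m + 3 := ⟨k - 3, by omega⟩
  have e1 : (q : ℂ) ^ (((m + 3 : ℕ) : ℤ) - 3) = (q : ℂ) ^ m := by
    rw [show ((m + 3 : ℕ) : ℤ) - 3 = (m : ℤ) by push_cast; ring, zpow_natCast]
  have h1 : ∀ i : HeckeIndex q,
      contractWeight q (m + 3) (weight χ N₀ N₁) (v.act (heckeRep q i)⁻¹) =
      weightAway q χ N₀ N₁ v * (((q : ℂ) ^ (m + 3))⁻¹ * component χ N₂ ((q : ZMod N₂) ^ 2)) *
        unitPart q (component χ q) (v.act (heckeRep q i)⁻¹) +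
      weightAway q χ N₀ N₁ v * component χ (N / q) (q : ZMod (N / q)) *
        divisiblePart q (component χ q) (v.act (heckeRep q i)⁻¹) := by
    intro i
    rw [contractWeight_weight hN hρ hχ hq _ (hv.act _),
      weightAway_act hχ (inv_mem (heckeRep_mem_gammaInfPlus i)) hv]
    ring
  rw [Finset.sum_congr rfl fun i _ => h1 i, Finset.sum_add_distrib, ← Finset.mul_sum,
    ← Finset.mul_sum, (sum_parts hv).1, (sum_parts hv).2, e1, weight_eq_weight₀ χ hqN hq,
    weight_eq_weight₂ hN hρ χ hq, show m + 3 - 1 = m + 2 by omega]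
  field_simp
  ring

/-- This formula is uniform in `χ_q`. The middle series uses the trivial character at `q`, and is
identified with an Eisenstein series only when `χ_q = 1`; for other `χ_q` its factor `conjSum`
vanishes. -/
theorem heckeT1_eisenstein_eq (hN : Squarefree N) (hρ : N₀ * N₁ * N₂ = N)
    {χ : DirichletCharacter ℂ N} (hχ : ∀ p, p.Prime → p ∣ N₁ → component χ p ^ 2 = 1)
    (hq : q ∣ N₀) {k : ℕ} (hk : 4 ≤ k) {τ : Matrix (Fin 2) (Fin 2) ℂ} (hτ : τ ∈ upperHalfSpace) :
    heckeT1 k χ q (eisenstein k χ N₀ N₁ N₂) τ =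
      component χ N₂ ((q : ZMod N₂) ^ 2) * ((q : ℂ) + 1) * eisenstein k χ N₀ N₁ N₂ τ +
        (q : ℂ)⁻¹ * (component χ (N / q) (q : ZMod (N / q)) * (q : ℂ) ^ (k - 1) +
          component χ N₂ ((q : ZMod N₂) ^ 2)) * conjSum (component χ q) *
          ((1 / 2 : ℂ) * ∑' v : Cusp, weight₁ q 1 v.1 * weightAway q χ N₀ N₁ v.1 *
            (v.1.eval τ ^ k)⁻¹) +
        component χ N₂ ((q : ZMod N₂) ^ 2) * ((q : ℂ) ^ 2)⁻¹ * ((q : ℂ) + 1) *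
          component χ q (-1) * conjSqSum (component χ q) *
          eisenstein k χ (N₀ / q) N₁ (q * N₂) τ := by
  have hq0 := (Fact.out : q.Prime).ne_zero
  have : NeZero (q ^ 2) := ⟨pow_ne_zero 2 hq0⟩
  have hρ'' : N₀ / q * N₁ * (q * N₂) = N := by
    obtain ⟨m, rfl⟩ := hq
    rw [Nat.mul_div_cancel_left m (Fact.out : q.Prime).pos, ← hρ]
    ring
  have hA : ∀ v : PVec, ‖weightAway q χ N₀ N₁ v‖ ≤ 1 := norm_weightAway_le χ N₀ N₁
  have s1 := summable_mul_inv_eval_pow hτ hk fun v : Cusp => norm_weight_le χ N₀ N₁ v.1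
  have s2 := summable_mul_inv_eval_pow hτ hk fun v : Cusp =>
    ((norm_mul_le (weight₁ q (1 : DirichletCharacter ℂ q) v.1) (weightAway q χ N₀ N₁ v.1)).trans
      (mul_le_one₀ (norm_weight₁_le q 1 v.1) (norm_nonneg _) (hA v.1)))
  have s3 := summable_mul_inv_eval_pow hτ hk fun v : Cusp => norm_weight_le χ (N₀ / q) N₁ v.1
  rw [heckeT1_eisenstein hN hρ hχ hq hk hτ, eisenstein_eq_tsum hN hρ hχ,
    eisenstein_eq_tsum hN hρ'' hχ]
  simp_rw [fun v : Cusp => sum_contractWeight hN hρ hχ hq hk v.2, add_mul,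
    mul_assoc _ (weight _ _ _ _), mul_assoc _ (weight₁ q 1 _ * _)]
  rw [Summable.tsum_add ((s1.mul_left _).add (s2.mul_left _)) (s3.mul_left _),
    Summable.tsum_add (s1.mul_left _) (s2.mul_left _), tsum_mul_left, tsum_mul_left, tsum_mul_left]
  ring

end Coefficients

end SiegelTwo

end

theorem proposition3p10 (k : ℕ) (hk : 4 ≤ k) (N N₀ N₁ N₂ : ℕ) (hN : Squarefree N)
    (hρ : N₀ * N₁ * N₂ = N) (χ : DirichletCharacter ℂ N)
    (hχ : SiegelTwo.component χ N₁ ^ 2 = 1) (q : ℕ) [Fact q.Prime] (hq : q ∣ N₀) :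
    (SiegelTwo.component χ q = 1 →
      ∀ τ ∈ SiegelTwo.upperHalfSpace,
        SiegelTwo.heckeT1 k χ q (SiegelTwo.eisenstein k χ N₀ N₁ N₂) τ =
          SiegelTwo.component χ N₂ ((q : ZMod N₂) ^ 2) * ((q : ℂ) + 1) *
              SiegelTwo.eisenstein k χ N₀ N₁ N₂ τ +
            (q : ℂ)⁻¹ *
              (SiegelTwo.component χ (N / q) (q : ZMod (N / q)) * (q : ℂ) ^ (k - 1) +
                SiegelTwo.component χ N₂ ((q : ZMod N₂) ^ 2)) *
              ((q : ℂ) - 1) * SiegelTwo.eisenstein k χ (N₀ / q) (q * N₁) N₂ τ +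
            SiegelTwo.component χ N₂ ((q : ZMod N₂) ^ 2) * ((q : ℂ) ^ 2)⁻¹ *
              ((q : ℂ) ^ 2 - 1) * SiegelTwo.eisenstein k χ (N₀ / q) N₁ (q * N₂) τ) ∧
    (SiegelTwo.component χ q ^ 2 = 1 → SiegelTwo.component χ q ≠ 1 →
      ∀ τ ∈ SiegelTwo.upperHalfSpace,
        SiegelTwo.heckeT1 k χ q (SiegelTwo.eisenstein k χ N₀ N₁ N₂) τ =
          SiegelTwo.component χ N₂ ((q : ZMod N₂) ^ 2) * ((q : ℂ) + 1) *
              SiegelTwo.eisenstein k χ N₀ N₁ N₂ τ +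
            (legendreSym q (-1) : ℂ) * SiegelTwo.component χ N₂ ((q : ZMod N₂) ^ 2) *
              ((q : ℂ) ^ 2)⁻¹ * ((q : ℂ) ^ 2 - 1) *
              SiegelTwo.eisenstein k χ (N₀ / q) N₁ (q * N₂) τ) ∧
    (SiegelTwo.component χ q ^ 2 ≠ 1 →
      ∀ τ ∈ SiegelTwo.upperHalfSpace,
        SiegelTwo.heckeT1 k χ q (SiegelTwo.eisenstein k χ N₀ N₁ N₂) τ =
          SiegelTwo.component χ N₂ ((q : ZMod N₂) ^ 2) * ((q : ℂ) + 1) *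
              SiegelTwo.eisenstein k χ N₀ N₁ N₂ τ) := by
  have hN₁ : N₁ ∣ N := hρ ▸ (dvd_mul_left N₁ N₀).mul_right N₂
  have hχ' : ∀ p, p.Prime → p ∣ N₁ → SiegelTwo.component χ p ^ 2 = 1 :=
    fun p _ hp => SiegelTwo.component_sq_eq_one hN χ hN₁ hχ hp
  refine ⟨fun h1 τ hτ => ?_, fun h2 h1 τ hτ => ?_, fun h2 τ hτ => ?_⟩
  -- The series for `ρ'` has rank one at `q` as well, so its expansion needs the quadratic condition
  -- there, which holds as `χ_q = 1`.
  · have hχ'' : ∀ p, p.Prime → p ∣ q * N₁ → SiegelTwo.component χ p ^ 2 = 1 := by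
      intro p hp hpq
      rcases hp.dvd_mul.1 hpq with h | h
      · rw [(Nat.prime_dvd_prime_iff_eq hp Fact.out).1 h, h1, one_pow]
      · exact hχ' p hp h
    have hρ' : N₀ / q * (q * N₁) * N₂ = N := by
      rw [← mul_assoc, Nat.div_mul_cancel hq, hρ]
    have hneg : (1 : DirichletCharacter ℂ q) (-1) = 1 :=
      MulChar.one_apply (Ne.isUnit (neg_ne_zero.2 one_ne_zero))
    rw [SiegelTwo.heckeT1_eisenstein_eq hN hρ hχ' hq hk hτ,
      SiegelTwo.eisenstein_eq_tsum hN hρ' hχ'']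
    simp_rw [SiegelTwo.weight_eq_weight₁ hN hρ χ hq]
    rw [SiegelTwo.conjSqSum_eq, h1, one_pow, SiegelTwo.conjSum_one, hneg]
    ring
  -- For quadratic nontrivial `χ_q` the sum of the character vanishes, but its sum over squares is
  -- still `q - 1`; this leaves the term in `E_ρ''` with the sign `χ_q(-1)`.
  · rw [SiegelTwo.heckeT1_eisenstein_eq hN hρ hχ' hq hk hτ, SiegelTwo.conjSqSum_eq, h2,
      SiegelTwo.conjSum_one, SiegelTwo.conjSum_of_ne_one h1,
      SiegelTwo.apply_neg_one_eq_legendreSym h2 h1]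
    ring
  · have h1 : SiegelTwo.component χ q ≠ 1 := fun h => h2 (by rw [h, one_pow])
    rw [SiegelTwo.heckeT1_eisenstein_eq hN hρ hχ' hq hk hτ, SiegelTwo.conjSqSum_eq,
      SiegelTwo.conjSum_of_ne_one h2, SiegelTwo.conjSum_of_ne_one h1]
    ring
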